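/- For $n\ge 1$ let $H_n$ be the real vector space of $n\times n$ complex Hermitian matrices, with the Euclidean (Lebesgue) measure $m_n$ associated to the inner product $\langle x,y\rangle=\operatorname{tr}(xy)$. For $\mu\ge 0$ let $\mathbb P_{n,\mu}$ be the probability measure on $H_n$ $$\mathbb P_{n,\mu}(dx)=\frac1{C_{n,\mu}}\,|\det x|^{2\mu}\,e^{-\operatorname{tr}(x^2)}\,m_n(dx),\qquad C_{n,\mu}=\int_{H_n}|\det x|^{2\mu}e^{-\operatorname{tr}(x^2)}\,m_n(dx).$$ Let $(\mu_n)_n$ be a sequence of nonnegative real numbers such that $\lim_{n\to\infty}\mu_n/n=c\ge 0$, and let $\nu_n$ be the mean eigenvalue distribution, that is, the probability measure on $\mathbb R$ with $$\int_{\mathbb R} f(t)\,\nu_n(dt)=\int_{H_n}\frac1n\sum_{i=1}^n f(\lambda_i(x))\,\mathbb P_{n,\mu_n}(dx)$$ for all bounded measurable $f$, where $\lambda_1(x),\dots,\lambda_n(x)$ are the eigenvalues of $x$ counted with multiplicity. Put $$a=\sqrt{1+c-\sqrt{1+2c}},\qquad b=\sqrt{1+c+\sqrt{1+2c}},\qquad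 S=[-b,-a]\cup[a,b],$$ and let $\nu_c$ be the measure supported on $S$ with Lebesgue density $$f_c(t)=\frac1{\pi|t|}\sqrt{(t^2-a^2)(b^2-t^2)}\qquad(t\in S).$$ Then $\nu_c$ is a probability measure and, after scaling by $1/\sqrt n$, the measures $\nu_n$ converge weakly to $\nu_c$: for every bounded continuous function $\varphi$ on $\mathbb R$, $$\lim_{n\to\infty}\int_{\mathbb R}\varphi\Big(\frac u{\sqrt n}\Big)\,\nu_n(du)=\int_S\varphi(u)\,\nu_c(du).$$ If $c=0$, then $\nu_c$ is the Wigner semicircle law on $[-\sqrt2,\sqrt2]$, with density $\frac1\pi\sqrt{2-t^2}$. -/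

import Mathlib

open MeasureTheory Filter Topology
open scoped ENNReal BoundedContinuousFunction

noncomputable section

namespace GenHermitian

/-- The real vector space of `n × n` complex Hermitian matrices. It is a type synonym, so that it
carries the Euclidean structure of the inner product `tr (x y)` and no other norm. -/
def Herm (n : ℕ) : Type := selfAdjoint (Matrix (Fin n) (Fin n) ℂ)

namespace Herm

variable {n : ℕ}

instance : AddCommGroup (Herm n) :=
  inferInstanceAs (AddCommGroup (selfAdjoint (Matrix (Fin n) (Fin n) ℂ)))

instance : Module ℝ (Herm n) :=
  inferInstanceAs (Module ℝ (selfAdjoint (Matrix (Fin n) (Fin n) ℂ)))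

/-- The underlying complex matrix, as a real-linear map. -/
def toMatrix : Herm n →ₗ[ℝ] Matrix (Fin n) (Fin n) ℂ where
  toFun x := x.1
  map_add' _ _ := rfl
  map_smul' _ _ := rfl

theorem toMatrix_injective : Function.Injective (toMatrix (n := n)) := Subtype.val_injective

theorem isHermitian (x : Herm n) : (toMatrix x).IsHermitian := x.2

instance : FiniteDimensional ℝ (Herm n) := by
  have : Module.Finite ℝ (Matrix (Fin n) (Fin n) ℂ) := Module.Finite.trans ℂ _
  exact Module.Finite.of_injective toMatrix toMatrix_injective

theorem trace_mul_self_re (x : Herm n) :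
    (Matrix.trace (toMatrix x * toMatrix x)).re = ∑ i, ∑ j, ‖toMatrix x i j‖ ^ 2 := by
  simp only [Matrix.trace, Matrix.diag, Matrix.mul_apply, Complex.re_sum]
  refine Finset.sum_congr rfl fun i _ => Finset.sum_congr rfl fun j _ => ?_
  rw [← (isHermitian x).apply j i, Complex.star_def, Complex.mul_conj, Complex.ofReal_re,
    Complex.normSq_eq_norm_sq]

/-- The inner product `⟨x, y⟩ = tr (x y)` (which is real for Hermitian `x` and `y`). -/
abbrev innerCore : InnerProductSpace.Core ℝ (Herm n) where
  inner x y := (Matrix.trace (toMatrix x * toMatrix y)).re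
  conj_inner_symm x y := by
    change (Matrix.trace (toMatrix y * toMatrix x)).re = _
    rw [Matrix.trace_mul_comm]
  re_inner_nonneg x := by
    change 0 ≤ (Matrix.trace (toMatrix x * toMatrix x)).re
    rw [trace_mul_self_re]
    positivity
  add_left x y z := by
    simp only [map_add, add_mul, Matrix.trace_add, Complex.add_re]
  smul_left x y r := by
    simp
  definite x h := by
    change (Matrix.trace (toMatrix x * toMatrix x)).re = 0 at h
    rw [trace_mul_self_re, Finset.sum_eq_zero_iff_of_nonneg (fun i _ => by positivity)] at h
    apply toMatrix_injective
    ext i j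
    have hi := h i (Finset.mem_univ i)
    rw [Finset.sum_eq_zero_iff_of_nonneg (fun i _ => by positivity)] at hi
    simpa using hi j (Finset.mem_univ j)

instance : NormedAddCommGroup (Herm n) := innerCore.toNormedAddCommGroup

instance : InnerProductSpace ℝ (Herm n) := InnerProductSpace.ofCore innerCore.toCore

instance : MeasurableSpace (Herm n) := borel _

instance : BorelSpace (Herm n) := ⟨rfl⟩

theorem inner_def (x y : Herm n) :
    inner ℝ x y = (Matrix.trace (toMatrix x * toMatrix y)).re := rfl

end Herm

/-- The unnormalized density `|det x| ^ (2 μ) * exp (- tr (x ^ 2))`. -/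
def weight (n : ℕ) (μ : ℝ) (x : Herm n) : ℝ :=
  ‖(Herm.toMatrix x).det‖ ^ (2 * μ) * Real.exp (-(Matrix.trace (Herm.toMatrix x ^ 2)).re)

/-- The measure on Hermitian matrices with density proportional to `weight n μ` with respect to the
Euclidean (Lebesgue) measure `volume` of the inner product `tr (x y)`, normalized by its
total mass. -/
def ensemble (n : ℕ) (μ : ℝ) : Measure (Herm n) :=
  (∫⁻ x : Herm n, ENNReal.ofReal (weight n μ x))⁻¹ •
    (volume : Measure (Herm n)).withDensity (fun x => ENNReal.ofReal (weight n μ x))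

/-- The mean eigenvalue distribution: the measure `ν` on `ℝ` with
`∫ f dν = ∫ (1 / n) ∑ᵢ f (λᵢ x) d(ensemble n μ)(x)`, where `λᵢ x` are the eigenvalues of `x`
counted with multiplicity. -/
def meanEigenvalueDist (n : ℕ) (μ : ℝ) : Measure ℝ :=
  (n : ℝ≥0∞)⁻¹ • ∑ i : Fin n, (ensemble n μ).map (fun x => (Herm.isHermitian x).eigenvalues i)

def endA (c : ℝ) : ℝ := √(1 + c - √(1 + 2 * c))

def endB (c : ℝ) : ℝ := √(1 + c + √(1 + 2 * c))

/-- The set `[-b, -a] ∪ [a, b]`. -/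
def limitSupport (c : ℝ) : Set ℝ :=
  Set.Icc (-endB c) (-endA c) ∪ Set.Icc (endA c) (endB c)

def limitDensity (c t : ℝ) : ℝ :=
  1 / (Real.pi * |t|) * √((t ^ 2 - endA c ^ 2) * (endB c ^ 2 - t ^ 2))

/-- The measure on `ℝ` with Lebesgue density `limitDensity c` on `limitSupport c`, and zero
elsewhere. -/
def limitMeasure (c : ℝ) : Measure ℝ :=
  (volume.restrict (limitSupport c)).withDensity (fun t => ENNReal.ofReal (limitDensity c t))

/-- The semicircle law on `[-√2, √2]`, with density `(1 / π) √(2 - t ^ 2)`. -/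
def semicircleLaw : Measure ℝ :=
  (volume.restrict (Set.Icc (-√2) √2)).withDensity
    (fun t => ENNReal.ofReal (1 / Real.pi * √(2 - t ^ 2)))

end GenHermitian

end

/-! The argument is the method of moments. The eigenvalues form a determinantal ensemble, so the
mean eigenvalue distribution has density `(1 / n) ∑ φₖ ^ 2 w`, summed over `k < n`, where `w = |x| ^
(2 μ) exp (-x ^ 2)` and `φₖ` are its orthonormal polynomials. This needs the Weyl integration
formula, which is derived here without differentiating the diagonalization map. The Gaussian matrix
integral and the integral against `Δ(λ) ^ 2 exp (-|λ| ^ 2)`, as functionals of the power sums,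
satisfy the same loop equations, both obtained by Gaussian integration by parts. These equations
determine a functional up to a constant (`LoopEquations.eq_of_apply_one`). Hence the two integrals
are proportional on symmetric polynomials, and exponential moments upgrade this to an equality of
symmetrized laws (`symEigLaw_eq`). The factor `|det x| ^ (2 μ)` is a symmetric function of the
eigenvalues, so it is carried along.

The Dunkl operator provides the orthogonal polynomials and their three-term recurrence. The
recurrence coefficients depend on the parity of the index, but multiplication by `x ^ 2` couples `k`
only to `k` and `k ± 2`, and its entries have parity-free limits. If `k / n → τ`, the entries
divided by `n` tend to `τ + c` on the diagonal and `e / 2` off it, with `e = √(τ (τ + 2 c))`. Powers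
of the matrix then look locally like powers of a Toeplitz matrix: the diagonal entry of the `m`-th
power, divided by `n ^ m`, tends to the mean of `(τ + c + e cos θ) ^ m` over `θ`, a moment of an
arcsine law (`tendsto_momentEntry`). Averaging over `k < n` integrates this over `τ ∈ (0, 1)`.

On the other side, `e ^ 2 - (s - τ - c) ^ 2 = 2 τ s - (s - c) ^ 2` is linear in `τ`, so the mixture
of arcsine densities integrates explicitly, and it is the image of the limit measure under squaring
(`lintegral_sq_limitMeasure`). Even moments therefore converge to the right limits, odd moments
vanish by symmetry, and compact support of the limit turns convergence of moments into weak
convergence. -/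

noncomputable section

namespace GenHermitian

/-! ### Integration by parts against the Gaussian weight -/

section Gaussian

variable {E : Type*} [NormedAddCommGroup E]

/-- Continuous functions of at most exponential growth. -/
structure ExpGrowth (f : E → ℂ) : Prop where
  continuous : Continuous f
  bound : ∃ C s : ℝ, 0 ≤ C ∧ 0 ≤ s ∧ ∀ x, ‖f x‖ ≤ C * Real.exp (s * ‖x‖)

namespace ExpGrowth

variable {f g : E → ℂ}

theorem const (c : ℂ) : ExpGrowth (fun _ : E => c) :=
  ⟨continuous_const, ‖c‖, 0, norm_nonneg _, le_rfl, by simp⟩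

theorem add (hf : ExpGrowth f) (hg : ExpGrowth g) : ExpGrowth (fun x => f x + g x) := by
  obtain ⟨C, s, hC, hs, h⟩ := hf.bound
  obtain ⟨D, t, hD, ht, k⟩ := hg.bound
  refine ⟨hf.continuous.add hg.continuous, C + D, s + t, by positivity, by positivity, fun x => ?_⟩
  refine (norm_add_le _ _).trans ((add_le_add (h x) (k x)).trans ?_)
  rw [add_mul]
  have := norm_nonneg x
  gcongr <;> linarith

theorem mul (hf : ExpGrowth f) (hg : ExpGrowth g) : ExpGrowth (fun x => f x * g x) := by
  obtain ⟨C, s, hC, hs, h⟩ := hf.bound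
  obtain ⟨D, t, hD, ht, k⟩ := hg.bound
  refine ⟨hf.continuous.mul hg.continuous, C * D, s + t, by positivity, by positivity, fun x => ?_⟩
  rw [norm_mul]
  calc ‖f x‖ * ‖g x‖ ≤ (C * Real.exp (s * ‖x‖)) * (D * Real.exp (t * ‖x‖)) := by
        gcongr
        · exact h x
        · exact k x
    _ = _ := by rw [add_mul, Real.exp_add]; ring

theorem sum {ι : Type*} (s : Finset ι) {f : ι → E → ℂ} (hf : ∀ i ∈ s, ExpGrowth (f i)) :
    ExpGrowth (fun x => ∑ i ∈ s, f i x) := by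
  classical
  induction s using Finset.induction_on with
  | empty => simpa using const 0
  | insert a s ha ih =>
    simp only [Finset.sum_insert ha]
    exact (hf a (by simp)).add (ih fun i hi => hf i (by simp [hi]))

variable [InnerProductSpace ℝ E]

theorem clm (L : E →L[ℝ] ℂ) : ExpGrowth (fun x => L x) := by
  refine ⟨L.continuous, ‖L‖, 1, norm_nonneg _, zero_le_one, fun x => (L.le_opNorm x).trans ?_⟩
  gcongr
  linarith [Real.add_one_le_exp (1 * ‖x‖)]

variable [FiniteDimensional ℝ E] [MeasurableSpace E] [BorelSpace E]

theorem integrable (hf : ExpGrowth f) :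
    Integrable (fun x => f x * (Real.exp (-‖x‖ ^ 2) : ℂ)) := by
  obtain ⟨C, s, hC, hs, h⟩ := hf.bound
  -- Half of the Gaussian exponent absorbs the growth, by `s r ≤ s ^ 2 / 2 + r ^ 2 / 2`.
  have key : Integrable (fun x : E => C * Real.exp (s ^ 2 / 2) * Real.exp (-(1 / 2) * ‖x‖ ^ 2)) := by
    have := (GaussianFourier.integrable_cexp_neg_mul_sq_norm_add (V := E) (b := (1 / 2 : ℂ))
      (by norm_num) 0 0).norm
    refine Integrable.const_mul (this.congr (Eventually.of_forall fun x => ?_)) _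
    simp only [zero_mul, add_zero]
    rw [Complex.norm_exp]
    congr 1
    have : (-(1 / 2 : ℂ) * (‖x‖ : ℂ) ^ 2) = ((-(1 / 2) * ‖x‖ ^ 2 : ℝ) : ℂ) := by push_cast; ring
    rw [this, Complex.ofReal_re]
  refine key.mono' ?_ (Eventually.of_forall fun x => ?_)
  · exact (hf.continuous.mul (by fun_prop)).aestronglyMeasurable
  · rw [norm_mul, Complex.norm_real, Real.norm_of_nonneg (Real.exp_pos _).le]
    calc ‖f x‖ * Real.exp (-‖x‖ ^ 2) ≤ C * Real.exp (s * ‖x‖) * Real.exp (-‖x‖ ^ 2) := by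
          gcongr; exact h x
      _ = C * Real.exp (s * ‖x‖ + -‖x‖ ^ 2) := by rw [Real.exp_add]; ring
      _ ≤ C * Real.exp (s ^ 2 / 2 + -(1 / 2) * ‖x‖ ^ 2) := by
          refine mul_le_mul_of_nonneg_left (Real.exp_le_exp.2 ?_) hC
          nlinarith [sq_nonneg (s - ‖x‖)]
      _ = _ := by rw [Real.exp_add]; ring

/-- Gaussian integration by parts in the direction `v`. -/
theorem integral_lineDeriv {f f' : E → ℂ} {v : E} (hf : ExpGrowth f) (hf' : ExpGrowth f')
    (h : ∀ x, HasLineDerivAt ℝ f (f' x) x v) :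
    ∫ x, f' x * (Real.exp (-‖x‖ ^ 2) : ℂ) =
      2 * ∫ x, ((inner ℝ v x : ℝ) : ℂ) * f x * (Real.exp (-‖x‖ ^ 2) : ℂ) := by
  have hin : ExpGrowth (fun x : E => ((inner ℝ v x : ℝ) : ℂ)) :=
    clm (Complex.ofRealCLM.comp (innerSL ℝ v))
  have hfi := (hin.mul hf).integrable
  have hg : ∀ x : E, HasLineDerivAt ℝ (fun x : E => (Real.exp (-‖x‖ ^ 2) : ℂ))
      (((-2 * inner ℝ v x * Real.exp (-‖x‖ ^ 2) : ℝ)) : ℂ) x v := by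
    intro x
    have h1 : HasFDerivAt (fun x : E => Real.exp (-‖x‖ ^ 2))
        (Real.exp (-‖x‖ ^ 2) • (-(2 • innerSL ℝ x) : E →L[ℝ] ℝ)) x := by
      have := ((hasStrictFDerivAt_norm_sq x).hasFDerivAt.neg).exp
      simpa using this
    have h2 := (Complex.ofRealCLM.hasFDerivAt.comp x h1).hasLineDerivAt v
    have h3 : (Complex.ofRealCLM ∘L
        (Real.exp (-‖x‖ ^ 2) • (-(2 • innerSL ℝ x) : E →L[ℝ] ℝ))) v =
        (((-2 * inner ℝ v x * Real.exp (-‖x‖ ^ 2) : ℝ)) : ℂ) := by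
      simp [real_inner_comm]
      ring
    rw [h3] at h2
    exact h2
  have := integral_bilinear_hasLineDerivAt_right_eq_neg_left_of_integrable (μ := (volume : Measure E))
    (f := f) (f' := f') (g := fun x : E => (Real.exp (-‖x‖ ^ 2) : ℂ))
    (g' := fun x => (((-2 * inner ℝ v x * Real.exp (-‖x‖ ^ 2) : ℝ)) : ℂ)) (v := v)
    (B := ContinuousLinearMap.mul ℝ ℂ) hf'.integrable ?_ hf.integrable (fun x _ => h x)
    (fun x _ => hg x)
  · simp only [ContinuousLinearMap.mul_apply'] at this
    rw [← neg_eq_iff_eq_neg] at this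
    rw [← this, ← integral_neg, ← integral_const_mul]
    congr 1 with x
    push_cast
    ring
  · refine (hfi.const_mul (-2)).congr (Eventually.of_forall fun x => ?_)
    simp only [ContinuousLinearMap.mul_apply']
    push_cast
    ring

end ExpGrowth

end Gaussian

/-! ### Loop equations for functionals on formal power sums

The variable `X k` of `MvPolynomial ℕ ℂ` stands for the `k`-th power sum of the eigenvalues. -/

section LoopEquations

open MvPolynomial

/-- The action of the vector field `x ^ k` on polynomials in the power sums. -/
def powerFlow (k : ℕ) : Derivation ℂ (MvPolynomial ℕ ℂ) (MvPolynomial ℕ ℂ) :=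
  mkDerivation ℂ fun l => (l : ℂ) • X (k + l - 1)

/-- The divergence of the vector field `x ^ k`, as a polynomial in the power sums. -/
def powerDiv (k : ℕ) : MvPolynomial ℕ ℂ := ∑ i ∈ Finset.range k, X i * X (k - 1 - i)

/-- The loop equations of the Gaussian unitary ensemble of size `N`. -/
structure LoopEquations (N : ℂ) (Φ : MvPolynomial ℕ ℂ →ₗ[ℂ] ℂ) : Prop where
  zero : ∀ q, Φ (X 0 * q) = N * Φ q
  succ : ∀ k q, 2 * Φ (X (k + 1) * q) = Φ (powerDiv k * q) + Φ (powerFlow k q)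

/-- Give `X k` weight `k`. The equation `succ` trades `X (k + 1)` for terms whose total weight is
smaller by two, so strong induction on the weight applies. The monomials of weight zero are the
powers of `X 0`, which `zero` reduces to the value at `1`. -/
theorem LoopEquations.monomial_eq_zero {N : ℂ} {Φ : MvPolynomial ℕ ℂ →ₗ[ℂ] ℂ}
    (h : LoopEquations N Φ) (h1 : Φ 1 = 0) :
    ∀ (W : ℕ) (d : ℕ →₀ ℕ), Finsupp.weight (id : ℕ → ℕ) d = W → Φ (monomial d 1) = 0 := by
  intro W
  induction W using Nat.strong_induction_on with
  | _ W ih =>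
  intro d hd
  by_cases hk : ∃ k, d (k + 1) ≠ 0
  · obtain ⟨k, hk⟩ := hk
    obtain ⟨e, rfl⟩ : ∃ e, d = Finsupp.single (k + 1) 1 + e := by
      refine ⟨d - Finsupp.single (k + 1) 1, ?_⟩
      rw [add_tsub_cancel_of_le]
      simpa [Finsupp.single_le_iff] using Nat.one_le_iff_ne_zero.2 hk
    have hW : W = k + 1 + Finsupp.weight (id : ℕ → ℕ) e := by
      rw [← hd, map_add]
      simp [Finsupp.weight_single]
    have key := h.succ k (monomial e 1)
    have e1 : Φ (powerDiv k * monomial e 1) = 0 := by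
      rw [powerDiv, Finset.sum_mul, map_sum]
      refine Finset.sum_eq_zero fun i hi => ?_
      have hi := Finset.mem_range.1 hi
      rw [X, X, monomial_mul, monomial_mul]
      simp only [mul_one]
      refine ih (k - 1 + Finsupp.weight (id : ℕ → ℕ) e) (by omega) _ ?_
      simp only [map_add, Finsupp.weight_single]
      simp
      omega
    have e2 : Φ (powerFlow k (monomial e 1)) = 0 := by
      rw [powerFlow, mkDerivation_monomial, one_smul, Finsupp.sum, map_sum]
      refine Finset.sum_eq_zero fun i hi => ?_
      rcases Nat.eq_zero_or_pos i with rfl | hi0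
      · simp
      · have hle : Finsupp.single i 1 ≤ e := by
          simpa [Finsupp.single_le_iff] using Nat.one_le_iff_ne_zero.2 (Finsupp.mem_support_iff.1 hi)
        obtain ⟨e', rfl⟩ : ∃ e', e = Finsupp.single i 1 + e' :=
          ⟨e - Finsupp.single i 1, by rw [add_tsub_cancel_of_le hle]⟩
        rw [add_tsub_cancel_left, smul_eq_mul, mul_smul_comm, X, monomial_mul, map_smul]
        have hm : ∀ (s : ℕ →₀ ℕ) (r : ℂ), Φ (monomial s r) = r • Φ (monomial s 1) := by
          intro s r
          rw [← map_smul, smul_monomial, smul_eq_mul, mul_one]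
        rw [hm]
        have : Finsupp.weight (id : ℕ → ℕ) (Finsupp.single i 1 + e') =
            i + Finsupp.weight (id : ℕ → ℕ) e' := by
          simp [map_add, Finsupp.weight_single]
        rw [ih (k + i - 1 + Finsupp.weight (id : ℕ → ℕ) e') (by omega) _ ?_]
        · simp
        · simp only [map_add, Finsupp.weight_single]
          simp
          omega
    rw [e1, e2, add_zero, X, monomial_mul, one_mul] at key
    simpa using key
  · push Not at hk
    have : d = Finsupp.single 0 (d 0) := by
      ext i
      cases i with
      | zero => simp
      | succ i => simp [hk i]
    rw [this]
    generalize d 0 = m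
    induction m with
    | zero => simpa using h1
    | succ m ihm =>
      have := h.zero (monomial (Finsupp.single 0 m) 1)
      rw [X, monomial_mul, ← Finsupp.single_add, one_mul, ihm, mul_zero, add_comm] at this
      exact this

/-- The loop equations determine a functional up to its value at `1`. -/
theorem LoopEquations.eq_of_apply_one {N : ℂ} {Φ Ψ : MvPolynomial ℕ ℂ →ₗ[ℂ] ℂ}
    (hΦ : LoopEquations N Φ) (hΨ : LoopEquations N Ψ) (h1 : Φ 1 = Ψ 1) : Φ = Ψ := by
  have h : LoopEquations N (Φ - Ψ) := by
    refine ⟨fun q => ?_, fun k q => ?_⟩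
    · simp only [LinearMap.sub_apply, hΦ.zero, hΨ.zero]; ring
    · simp only [LinearMap.sub_apply, mul_sub, hΦ.succ, hΨ.succ]; ring
  rw [← sub_eq_zero]
  refine (basisMonomials ℕ ℂ).ext fun d => ?_
  simpa using h.monomial_eq_zero (by simp [h1]) _ d rfl

theorem LoopEquations.smul {N : ℂ} {Φ : MvPolynomial ℕ ℂ →ₗ[ℂ] ℂ} (h : LoopEquations N Φ) (c : ℂ) :
    LoopEquations N (c • Φ) := by
  refine ⟨fun q => ?_, fun k q => ?_⟩
  · simp only [LinearMap.smul_apply, smul_eq_mul, h.zero]; ring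
  · simp only [LinearMap.smul_apply, smul_eq_mul, ← mul_add, ← h.succ]; ring

end LoopEquations

/-! ### The Vandermonde product and power vector fields -/

section Vandermonde

open MvPolynomial

variable (n : ℕ)

/-- The product of the differences of the variables. -/
def vand : MvPolynomial (Fin n) ℂ := ∏ i, ∏ j ∈ Finset.Ioi i, (X j - X i)

/-- The derivation `∑ i, X i ^ k ∂ᵢ`. -/
def powerDeriv (k : ℕ) : Derivation ℂ (MvPolynomial (Fin n) ℂ) (MvPolynomial (Fin n) ℂ) :=
  ∑ i, (X i ^ k : MvPolynomial (Fin n) ℂ) • pderiv i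

theorem powerDeriv_apply (k : ℕ) (P : MvPolynomial (Fin n) ℂ) :
    powerDeriv n k P = ∑ i, X i ^ k * pderiv i P := by
  have h : ⇑(powerDeriv n k) =
      ∑ i, ⇑((X i ^ k : MvPolynomial (Fin n) ℂ) • pderiv (R := ℂ) i) :=
    map_sum Derivation.coeFnAddMonoidHom _ _
  rw [h, Finset.sum_apply]
  rfl

theorem powerDeriv_X (k : ℕ) (i : Fin n) : powerDeriv n k (X i) = X i ^ k := by
  rw [powerDeriv_apply, Finset.sum_eq_single i]
  · simp
  · intro j _ hj
    simp [pderiv_X, hj.symm]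
  · simp

theorem _root_.Derivation.prod_eq_prod_mul_sum {R A ι : Type*} [CommSemiring R] [CommSemiring A]
    [Algebra R A] (D : Derivation R A A) (s : Finset ι) (f g : ι → A)
    (h : ∀ i ∈ s, D (f i) = f i * g i) : D (∏ i ∈ s, f i) = (∏ i ∈ s, f i) * ∑ i ∈ s, g i := by
  classical
  induction s using Finset.induction_on with
  | empty => simp
  | insert a s ha ih =>
    rw [Finset.prod_insert ha, Finset.sum_insert ha, Derivation.leibniz,
      ih fun i hi => h i (by simp [hi]), h a (by simp), smul_eq_mul, smul_eq_mul]
    ring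

/-- The complete homogeneous polynomial of degree `k - 1` in two variables. -/
def pairSum (k : ℕ) (i j : Fin n) : MvPolynomial (Fin n) ℂ :=
  ∑ a ∈ Finset.range k, X j ^ a * X i ^ (k - 1 - a)

theorem pairSum_comm (k : ℕ) (i j : Fin n) : pairSum n k i j = pairSum n k j i := by
  rw [pairSum, pairSum, ← Finset.sum_range_reflect]
  refine Finset.sum_congr rfl fun a ha => ?_
  have := Finset.mem_range.1 ha
  rw [mul_comm, show k - 1 - (k - 1 - a) = a by omega]

/-- Each factor `X j - X i` divides its own derivative `X j ^ k - X i ^ k`, with quotient `pairSum`;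
logarithmic derivatives of the factors add up. -/
theorem powerDeriv_vand (k : ℕ) :
    powerDeriv n k (vand n) = vand n * ∑ i, ∑ j ∈ Finset.Ioi i, pairSum n k i j := by
  refine Derivation.prod_eq_prod_mul_sum _ _ _ _ fun i _ => ?_
  refine Derivation.prod_eq_prod_mul_sum _ _ _ _ fun j _ => ?_
  rw [map_sub, powerDeriv_X, powerDeriv_X, pairSum, mul_comm]
  exact (Commute.all _ _).geom_sum₂_mul k |>.symm

theorem sum_sum_eq_two_mul_add_diag {M : Type*} [CommSemiring M] (f : Fin n → Fin n → M)
    (hf : ∀ i j, f i j = f j i) :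
    ∑ i, ∑ j, f i j = 2 * (∑ i, ∑ j ∈ Finset.Ioi i, f i j) + ∑ i, f i i := by
  have h : ∀ i, ∑ j, f i j = ∑ j ∈ Finset.Ioi i, f i j + ∑ j ∈ Finset.Iio i, f i j + f i i := by
    intro i
    have hd : Disjoint (Finset.Ioi i) (Finset.Iio i) := by
      rw [Finset.disjoint_left]; intro j; simp; exact fun h => h.le
    rw [← Finset.sum_union hd, add_comm, ← Finset.sum_insert (by simp)]
    refine Finset.sum_congr ?_ fun _ _ => rfl
    ext j
    rcases lt_trichotomy i j with h | h | h <;> simp [h]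
  simp_rw [h, Finset.sum_add_distrib]
  have h2 : ∑ i, ∑ j ∈ Finset.Iio i, f i j = ∑ i, ∑ j ∈ Finset.Ioi i, f i j := by
    rw [Finset.sum_comm' (t' := Finset.univ) (s' := fun j => Finset.Ioi j) (by simp)]
    exact Finset.sum_congr rfl fun i _ => Finset.sum_congr rfl fun j _ => hf _ _
  rw [h2]
  ring

theorem sum_pairSum (k : ℕ) :
    ∑ i, ∑ j, pairSum n k i j = aeval (fun l => psum (Fin n) ℂ l) (powerDiv k) := by
  simp only [powerDiv, map_sum, map_mul, aeval_X, pairSum, psum]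
  simp_rw [Finset.sum_mul_sum]
  rw [Finset.sum_comm]
  simp_rw [Finset.sum_comm (s := Finset.univ) (t := Finset.range k)]

theorem pairSum_self (k : ℕ) (i : Fin n) : pairSum n k i i = (k : MvPolynomial (Fin n) ℂ) * X i ^ (k - 1) := by
  rw [pairSum, Finset.sum_congr rfl (g := fun _ => (X i : MvPolynomial (Fin n) ℂ) ^ (k - 1))]
  · simp
  · intro a ha
    have := Finset.mem_range.1 ha
    rw [← pow_add, show a + (k - 1 - a) = k - 1 by omega]

theorem powerDeriv_aeval_psum (k : ℕ) (q : MvPolynomial ℕ ℂ) :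
    powerDeriv n k (aeval (fun l => psum (Fin n) ℂ l) q) =
      aeval (fun l => psum (Fin n) ℂ l) (powerFlow k q) := by
  induction q using MvPolynomial.induction_on with
  | C a => simp
  | add p q hp hq => simp only [map_add, hp, hq]
  | mul_X p l hp =>
    have hl : powerDeriv n k (psum (Fin n) ℂ l) = (l : ℂ) • psum (Fin n) ℂ (k + l - 1) := by
      rw [psum, map_sum, psum, Finset.smul_sum]
      refine Finset.sum_congr rfl fun i _ => ?_
      rw [Derivation.leibniz_pow, powerDeriv_X]
      -- For `l = 0` the index `k + l - 1` is meaningless, but its coefficient vanishes.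
      rcases Nat.eq_zero_or_pos l with rfl | hl
      · simp
      · rw [show k + l - 1 = (l - 1) + k by omega, pow_add, smul_eq_mul, Nat.cast_smul_eq_nsmul]
    rw [map_mul, aeval_X, Derivation.leibniz, Derivation.leibniz, hp, hl, map_add]
    simp only [powerFlow, mkDerivation_X, smul_eq_mul, map_mul, map_smul, aeval_X]

/-- The divergence identity behind the loop equations of the eigenvalue density. -/
theorem sum_pderiv_mul_vand_sq (k : ℕ) (q : MvPolynomial ℕ ℂ) :
    ∑ i, pderiv i (X i ^ k * (aeval (fun l => psum (Fin n) ℂ l) q * vand n ^ 2)) =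
      aeval (fun l => psum (Fin n) ℂ l) (powerDiv k * q + powerFlow k q) * vand n ^ 2 := by
  have h1 : ∀ i : Fin n, ∀ P : MvPolynomial (Fin n) ℂ, pderiv i (X i ^ k * P) =
      X i ^ k * pderiv i P + pairSum n k i i * P := by
    intro i P
    rw [Derivation.leibniz, Derivation.leibniz_pow, pderiv_X_self, pairSum_self]
    simp only [smul_eq_mul, nsmul_eq_mul, mul_one]
    ring
  simp_rw [h1]
  -- The squared Vandermonde contributes twice the sum of `pairSum` over `i < j`, and the derivative
  -- of `X i ^ k` contributes the diagonal. Together they are the full double sum, which factors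
  -- into power sums as `powerDiv k`.
  rw [Finset.sum_add_distrib, ← powerDeriv_apply, Derivation.leibniz, Derivation.leibniz_pow,
    powerDeriv_vand, powerDeriv_aeval_psum, map_add, map_mul, ← sum_pairSum,
    sum_sum_eq_two_mul_add_diag n _ (pairSum_comm n k), ← Finset.sum_mul]
  simp only [smul_eq_mul, nsmul_eq_mul]
  push_cast
  ring

end Vandermonde

/-! ### Gaussian integrals of polynomials in given functions -/

section GaussFunctional

open MvPolynomial

variable {E : Type*} [NormedAddCommGroup E] {σ : Type*}

theorem ExpGrowth.aeval {u : σ → E → ℂ} (hu : ∀ l, ExpGrowth (u l)) (q : MvPolynomial σ ℂ) :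
    ExpGrowth (fun x => aeval (fun l => u l x) q) := by
  induction q using MvPolynomial.induction_on with
  | C a => simpa using ExpGrowth.const a
  | add p q hp hq => simpa only [map_add] using hp.add hq
  | mul_X p l hp => simpa only [map_mul, aeval_X] using hp.mul (hu l)

variable [InnerProductSpace ℝ E] [FiniteDimensional ℝ E] [MeasurableSpace E] [BorelSpace E]

/-- The Gaussian integral of polynomials in a family of functions of exponential growth. -/
def gaussFunctional (u : σ → E → ℂ) (hu : ∀ l, ExpGrowth (u l)) : MvPolynomial σ ℂ →ₗ[ℂ] ℂ where
  toFun q := ∫ x, aeval (fun l => u l x) q * (Real.exp (-‖x‖ ^ 2) : ℂ)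
  map_add' p q := by
    simp only [map_add, add_mul]
    exact integral_add (ExpGrowth.aeval hu p).integrable (ExpGrowth.aeval hu q).integrable
  map_smul' c q := by
    simp only [map_smul, smul_eq_mul, mul_assoc, RingHom.id_apply]
    exact integral_const_mul _ _

theorem gaussFunctional_apply (u : σ → E → ℂ) (hu : ∀ l, ExpGrowth (u l)) (q : MvPolynomial σ ℂ) :
    gaussFunctional u hu q = ∫ x, aeval (fun l => u l x) q * (Real.exp (-‖x‖ ^ 2) : ℂ) := rfl

end GaussFunctional

/-! ### Loop equations of the eigenvalue density -/

section Eigenvalue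

open MvPolynomial

variable (n : ℕ)

/-- The coordinate functions, with complex values. -/
def coordFun (i : Fin n) (x : EuclideanSpace ℝ (Fin n)) : ℂ := (x i : ℂ)

theorem coordFun_expGrowth (i : Fin n) : ExpGrowth (coordFun n i) :=
  ExpGrowth.clm (Complex.ofRealCLM.comp (EuclideanSpace.proj i : EuclideanSpace ℝ (Fin n) →L[ℝ] ℝ))

theorem coordFun_hasLineDerivAt (P : MvPolynomial (Fin n) ℂ) (i : Fin n)
    (x : EuclideanSpace ℝ (Fin n)) :
    HasLineDerivAt ℝ (fun x => aeval (fun l => coordFun n l x) P)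
      (aeval (fun l => coordFun n l x) (pderiv i P)) x (EuclideanSpace.single i 1) := by
  induction P using MvPolynomial.induction_on with
  | C a => simpa [HasLineDerivAt] using hasDerivAt_const (0 : ℝ) a
  | add p q hp hq =>
    simp only [map_add]
    exact HasDerivAt.fun_add hp hq
  | mul_X p l hp =>
    have hl : HasLineDerivAt ℝ (coordFun n l) (if l = i then 1 else 0) x
        (EuclideanSpace.single i (1 : ℝ)) := by
      have := ((Complex.ofRealCLM.comp
        (EuclideanSpace.proj l : EuclideanSpace ℝ (Fin n) →L[ℝ] ℝ)).hasFDerivAt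
          (x := x)).hasLineDerivAt (EuclideanSpace.single i (1 : ℝ))
      refine HasDerivAt.congr_deriv this ?_
      by_cases h : l = i <;> simp [h]
    have := HasDerivAt.mul hp hl
    simp only [HasLineDerivAt, map_mul, aeval_X, Derivation.leibniz, smul_eq_mul, map_add] at this ⊢
    refine this.congr_deriv ?_
    rw [pderiv_X]
    by_cases h : l = i
    · subst h; simp; ring
    · simp [h, mul_comm]

/-- The functional of the eigenvalue density `Δ(λ) ^ 2 exp (-|λ| ^ 2)` on power sums. -/
def eigenFunctional : MvPolynomial ℕ ℂ →ₗ[ℂ] ℂ :=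
  gaussFunctional (coordFun n) (coordFun_expGrowth n) ∘ₗ
    LinearMap.mulRight ℂ (vand n ^ 2) ∘ₗ (aeval (fun l => psum (Fin n) ℂ l)).toLinearMap

theorem gaussFunctional_pderiv (P : MvPolynomial (Fin n) ℂ) (i : Fin n) :
    gaussFunctional (coordFun n) (coordFun_expGrowth n) (pderiv i P) =
      2 * gaussFunctional (coordFun n) (coordFun_expGrowth n) (X i * P) := by
  rw [gaussFunctional_apply, gaussFunctional_apply,
    ExpGrowth.integral_lineDeriv (ExpGrowth.aeval (coordFun_expGrowth n) P)
      (ExpGrowth.aeval (coordFun_expGrowth n) _) (fun x => coordFun_hasLineDerivAt n P i x)]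
  have h : ∀ x : EuclideanSpace ℝ (Fin n), inner ℝ (EuclideanSpace.single i (1 : ℝ)) x = x i := by
    intro x
    simpa using EuclideanSpace.inner_single_left (𝕜 := ℝ) i 1 x
  simp only [h, map_mul, aeval_X]
  rfl

/-- Integration by parts turns each term `∂ᵢ (X i ^ k P)` of the divergence identity
`sum_pderiv_mul_vand_sq` into `2 X i ^ (k + 1) P`, and summing over `i` produces the power sum of
order `k + 1`. -/
theorem eigenFunctional_loopEquations : LoopEquations (n : ℂ) (eigenFunctional n) := by
  refine ⟨fun q => ?_, fun k q => ?_⟩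
  · simp only [eigenFunctional, LinearMap.comp_apply, AlgHom.toLinearMap_apply, map_mul, aeval_X,
      LinearMap.mulRight_apply, psum_zero, Fintype.card_fin]
    rw [mul_assoc, ← smul_eq_mul (n : ℂ), ← map_smul]
    congr 1
    rw [Algebra.smul_def]
    simp
  · have h := congrArg (gaussFunctional (coordFun n) (coordFun_expGrowth n))
      (sum_pderiv_mul_vand_sq n k q)
    rw [map_sum] at h
    simp only [gaussFunctional_pderiv, ← Finset.mul_sum] at h
    rw [← map_sum] at h
    rw [← map_add]
    refine Eq.trans ?_ h
    simp only [eigenFunctional, LinearMap.comp_apply, AlgHom.toLinearMap_apply, map_mul, aeval_X,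
      LinearMap.mulRight_apply, psum]
    simp only [← mul_assoc, ← pow_succ', Finset.sum_mul]

end Eigenvalue

/-! ### Loop equations of the matrix ensemble -/

section MatrixLoop

open Herm

variable {n : ℕ}

theorem Herm.ofReal_inner (x y : Herm n) :
    ((inner ℝ x y : ℝ) : ℂ) = Matrix.trace (toMatrix x * toMatrix y) := by
  rw [Herm.inner_def, ← Complex.conj_eq_iff_re]
  rw [← Complex.star_def, ← Matrix.trace_conjTranspose, Matrix.conjTranspose_mul,
    (isHermitian x).eq, (isHermitian y).eq, Matrix.trace_mul_comm]

theorem Herm.norm_sq (x : Herm n) : ‖x‖ ^ 2 = (Matrix.trace (toMatrix x ^ 2)).re := by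
  rw [← real_inner_self_eq_norm_sq, Herm.inner_def, sq]

/-- Powers of Hermitian matrices. -/
def Herm.npow (x : Herm n) (k : ℕ) : Herm n :=
  (⟨toMatrix x ^ k, (isHermitian x).pow k⟩ : selfAdjoint (Matrix (Fin n) (Fin n) ℂ))

theorem Herm.toMatrix_npow (x : Herm n) (k : ℕ) : toMatrix (npow x k) = toMatrix x ^ k := rfl

variable {ι : Type*} [Fintype ι] (e : OrthonormalBasis ι ℝ (Herm n))

/-- For Hermitian `M` this is the expansion in an orthonormal basis. Both sides are complex linear,
and every matrix is `y + i z` with `y`, `z` Hermitian. -/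
theorem Herm.sum_trace_smul (M : Matrix (Fin n) (Fin n) ℂ) :
    ∑ a, Matrix.trace (toMatrix (e a) * M) • toMatrix (e a) = M := by
  have hH : ∀ y : Herm n, ∑ a, Matrix.trace (toMatrix (e a) * toMatrix y) • toMatrix (e a) =
      toMatrix y := by
    intro y
    conv_rhs => rw [← e.sum_repr' y, map_sum]
    refine Finset.sum_congr rfl fun a _ => ?_
    rw [map_smul, ← Herm.ofReal_inner]
    exact Complex.coe_smul _ _
  obtain ⟨y, z, rfl⟩ : ∃ y z : Herm n, M = toMatrix y + Complex.I • toMatrix z :=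
    ⟨(realPart M : selfAdjoint _), (imaginaryPart M : selfAdjoint _),
      (realPart_add_I_smul_imaginaryPart M).symm⟩
  simp only [mul_add, Matrix.trace_add, add_smul, Finset.sum_add_distrib, hH, mul_smul_comm,
    Matrix.trace_smul, smul_assoc, ← Finset.smul_sum]

theorem Herm.sum_apply_mul_apply (i j k l : Fin n) :
    ∑ a, toMatrix (e a) i j * toMatrix (e a) k l = if k = j ∧ l = i then 1 else 0 := by
  have h := congrArg (fun N : Matrix (Fin n) (Fin n) ℂ => N k l)
    (Herm.sum_trace_smul e (Matrix.single j i 1))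
  simp only [Matrix.sum_apply] at h
  simp only [Matrix.smul_apply, Matrix.trace_mul_single, smul_eq_mul, Matrix.single_apply] at h
  simp only [MulOpposite.op_one, one_smul] at h
  rw [h]
  exact if_congr (and_congr eq_comm eq_comm) rfl rfl

/-- Contracting two occurrences of the basis by `Herm.sum_apply_mul_apply` splits one trace into
two. This is the source of the quadratic terms of `powerDiv`. -/
theorem Herm.sum_trace_mul_mul_mul (A B : Matrix (Fin n) (Fin n) ℂ) :
    ∑ a, Matrix.trace (toMatrix (e a) * A * toMatrix (e a) * B) =
      Matrix.trace A * Matrix.trace B := by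
  simp only [Matrix.trace, Matrix.diag, Matrix.mul_apply, Finset.sum_mul]
  have : ∀ i l k j, ∑ a, toMatrix (e a) i j * A j k * toMatrix (e a) k l * B l i =
      if k = j ∧ l = i then A j k * B l i else 0 := by
    intro i l k j
    have h := congrArg (· * (A j k * B l i)) (Herm.sum_apply_mul_apply e i j k l)
    simp only [Finset.sum_mul] at h
    rw [ite_mul, one_mul, zero_mul] at h
    rw [← h]
    exact Finset.sum_congr rfl fun a _ => by ring
  rw [Finset.sum_comm]
  calc _ = ∑ i, ∑ l, ∑ k, ∑ j, ∑ a, toMatrix (e a) i j * A j k * toMatrix (e a) k l * B l i := by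
        refine Finset.sum_congr rfl fun i _ => ?_
        rw [Finset.sum_comm]
        refine Finset.sum_congr rfl fun l _ => ?_
        rw [Finset.sum_comm]
        refine Finset.sum_congr rfl fun k _ => ?_
        rw [Finset.sum_comm]
    _ = ∑ i, ∑ j, A j j * B i i := by
        refine Finset.sum_congr rfl fun i _ => ?_
        simp only [this]
        simp only [ite_and]
        rw [Finset.sum_comm]
        refine Finset.sum_congr rfl fun j _ => ?_
        rw [Finset.sum_comm]
        simp
    _ = _ := by rw [Finset.sum_comm]; simp [Finset.mul_sum]

/-- Matrix valued functions whose entries have exponential growth. -/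
def MatGrowth (F : Herm n → Matrix (Fin n) (Fin n) ℂ) : Prop := ∀ i j, ExpGrowth fun x => F x i j

theorem MatGrowth.const (A : Matrix (Fin n) (Fin n) ℂ) : MatGrowth (fun _ => A) :=
  fun i j => ExpGrowth.const (A i j)

theorem MatGrowth.toMatrix : MatGrowth (fun x : Herm n => toMatrix x) := fun i j =>
  ExpGrowth.clm (LinearMap.toContinuousLinearMap
    ((Matrix.entryLinearMap ℝ ℂ i j) ∘ₗ (Herm.toMatrix (n := n))))

theorem MatGrowth.mul {F G : Herm n → Matrix (Fin n) (Fin n) ℂ} (hF : MatGrowth F)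
    (hG : MatGrowth G) : MatGrowth (fun x => F x * G x) := fun i j => by
  simp only [Matrix.mul_apply]
  exact ExpGrowth.sum _ fun k _ => (hF i k).mul (hG k j)

theorem MatGrowth.npow (k : ℕ) : MatGrowth (fun x : Herm n => Herm.toMatrix x ^ k) := by
  induction k with
  | zero => simpa using MatGrowth.const 1
  | succ k ih => simpa only [pow_succ] using ih.mul MatGrowth.toMatrix

theorem MatGrowth.trace {F : Herm n → Matrix (Fin n) (Fin n) ℂ} (hF : MatGrowth F) :
    ExpGrowth (fun x => Matrix.trace (F x)) :=
  ExpGrowth.sum _ fun i _ => hF i i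

/-- The power sums of the eigenvalues of a Hermitian matrix, as traces. -/
def tracePow (l : ℕ) (x : Herm n) : ℂ := Matrix.trace (Herm.toMatrix x ^ l)

theorem tracePow_expGrowth (l : ℕ) : ExpGrowth (tracePow (n := n) l) := (MatGrowth.npow l).trace

section Deriv

attribute [local instance] Matrix.linftyOpNormedRing Matrix.linftyOpNormedAlgebra

theorem hasDerivAt_matrix_pow (A V : Matrix (Fin n) (Fin n) ℂ) (l : ℕ) :
    HasDerivAt (fun t : ℝ => (A + t • V) ^ l)
      (∑ i ∈ Finset.range l, A ^ i * V * A ^ (l - 1 - i)) 0 := by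
  induction l with
  | zero =>
    simp only [pow_zero, Finset.range_zero, Finset.sum_empty]
    exact hasDerivAt_const (0 : ℝ) (1 : Matrix (Fin n) (Fin n) ℂ)
  | succ l ih =>
    have h1 : HasDerivAt (fun t : ℝ => A + t • V) V 0 :=
      (((hasDerivAt_id (0 : ℝ)).smul_const V).const_add A).congr_deriv (one_smul _ _)
    have h2 := ih.mul h1
    simp only [pow_succ]
    refine h2.congr_deriv ?_
    rw [Finset.sum_range_succ]
    simp only [zero_smul, add_zero, Nat.add_sub_cancel, Nat.sub_self, pow_zero, mul_one,
      Finset.sum_mul, add_left_inj]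
    refine Finset.sum_congr rfl fun i hi => ?_
    have := Finset.mem_range.1 hi
    rw [mul_assoc, ← pow_succ, show l - 1 - i + 1 = l - i by omega]

theorem hasDerivAt_trace_mul_pow (A V B : Matrix (Fin n) (Fin n) ℂ) (l : ℕ) :
    HasDerivAt (fun t : ℝ => Matrix.trace (B * (A + t • V) ^ l))
      (∑ i ∈ Finset.range l, Matrix.trace (B * A ^ i * V * A ^ (l - 1 - i))) 0 := by
  have h := (hasDerivAt_matrix_pow A V l).const_mul B
  have := ((LinearMap.toContinuousLinearMap
    (Matrix.traceLinearMap (Fin n) ℝ ℂ)).hasFDerivAt).comp_hasDerivAt 0 h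
  refine this.congr_deriv ?_
  change Matrix.trace (B * ∑ i ∈ Finset.range l, A ^ i * V * A ^ (l - 1 - i)) = _
  rw [Finset.mul_sum, Matrix.trace_sum]
  simp only [mul_assoc]

end Deriv

theorem tracePow_hasLineDerivAt (l : ℕ) (x v : Herm n) :
    HasLineDerivAt ℝ (tracePow l) (l * Matrix.trace (toMatrix v * toMatrix x ^ (l - 1))) x v := by
  have h := hasDerivAt_trace_mul_pow (toMatrix x) (toMatrix v) 1 l
  simp only [one_mul] at h
  simp only [HasLineDerivAt, tracePow, map_add, map_smul]
  refine h.congr_deriv ?_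
  rw [Finset.sum_congr rfl (g := fun _ => Matrix.trace (toMatrix v * toMatrix x ^ (l - 1)))]
  · simp
  · intro i hi
    have := Finset.mem_range.1 hi
    rw [mul_assoc, Matrix.trace_mul_comm, mul_assoc, ← pow_add,
      show l - 1 - i + i = l - 1 by omega]

open MvPolynomial in
-- The derivative is packaged as a map linear in the direction: integration by parts uses it on
-- basis vectors, and linearity reassembles those into the direction `x ^ k`, where `l tr (v x ^ (l
-- - 1))` becomes `l tr (x ^ (k + l - 1))`.
theorem exists_lineDeriv_tracePow (k : ℕ) (q : MvPolynomial ℕ ℂ) :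
    ∃ D : Herm n → Herm n →ₗ[ℝ] ℂ, (∀ v, ExpGrowth fun x => D x v) ∧
      (∀ x v, HasLineDerivAt ℝ (fun x => aeval (fun l => tracePow l x) q) (D x v) x v) ∧
      ∀ x, D x (npow x k) = aeval (fun l => tracePow l x) (powerFlow k q) := by
  induction q using MvPolynomial.induction_on with
  | C a =>
    refine ⟨fun _ => 0, fun v => by simpa using ExpGrowth.const 0, fun x v => ?_, fun x => ?_⟩
    · simpa [HasLineDerivAt] using hasDerivAt_const (0 : ℝ) a
    · simp
  | add p q hp hq =>
    obtain ⟨D, h1, h2, h3⟩ := hp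
    obtain ⟨D', h1', h2', h3'⟩ := hq
    refine ⟨fun x => D x + D' x, fun v => (h1 v).add (h1' v), fun x v => ?_, fun x => ?_⟩
    · simp only [map_add]
      exact HasDerivAt.fun_add (h2 x v) (h2' x v)
    · simp [h3, h3']
  | mul_X p l hp =>
    obtain ⟨D, h1, h2, h3⟩ := hp
    let T : Herm n → Herm n →ₗ[ℝ] ℂ := fun x =>
      (Matrix.traceLinearMap (Fin n) ℝ ℂ) ∘ₗ
        (LinearMap.mulRight ℝ (toMatrix x ^ (l - 1))) ∘ₗ Herm.toMatrix
    have hT : ∀ x v, T x v = Matrix.trace (toMatrix v * toMatrix x ^ (l - 1)) := fun _ _ => rfl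
    refine ⟨fun x => tracePow l x • D x + (aeval (fun l => tracePow l x) p * l) • T x,
      fun v => ?_, fun x v => ?_, fun x => ?_⟩
    · simp only [LinearMap.add_apply, LinearMap.smul_apply, smul_eq_mul, hT]
      refine ((tracePow_expGrowth l).mul (h1 v)).add
        (((ExpGrowth.aeval tracePow_expGrowth p).mul (ExpGrowth.const _)).mul ?_)
      exact ((MatGrowth.const _).mul (MatGrowth.npow _)).trace
    · have := HasDerivAt.mul (h2 x v) (tracePow_hasLineDerivAt l x v)
      simp only [HasLineDerivAt, map_mul, aeval_X]
      refine this.congr_deriv ?_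
      simp only [LinearMap.add_apply, LinearMap.smul_apply, smul_eq_mul, hT, zero_smul, add_zero]
      ring
    · simp only [LinearMap.add_apply, LinearMap.smul_apply, smul_eq_mul, hT, h3,
        Derivation.leibniz, map_add, map_mul, aeval_X]
      rw [powerFlow, mkDerivation_X, map_smul, aeval_X, toMatrix_npow, ← pow_add, tracePow]
      rcases Nat.eq_zero_or_pos l with rfl | hl
      · simp
      · rw [tracePow, show k + (l - 1) = k + l - 1 by omega, smul_eq_mul]
        ring

/-- The functional of the Gaussian unitary ensemble on power sums. -/
def matrixFunctional (n : ℕ) : MvPolynomial ℕ ℂ →ₗ[ℂ] ℂ :=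
  gaussFunctional (E := Herm n) tracePow tracePow_expGrowth

open MvPolynomial in
-- Integrate by parts the vector field `x ^ k Q(x)`, one basis component at a time. The divergence
-- of `x ^ k` is `∑ tr (x ^ i) tr (x ^ (k - 1 - i))`, the derivative of `Q` along it is given by
-- `powerFlow`, and the Gaussian contributes `2 tr (x x ^ k)`.
theorem matrixFunctional_loopEquations (n : ℕ) : LoopEquations (n : ℂ) (matrixFunctional n) := by
  refine ⟨fun q => ?_, fun k q => ?_⟩
  · rw [← smul_eq_mul (n : ℂ), ← map_smul, matrixFunctional, gaussFunctional_apply,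
      gaussFunctional_apply]
    congr 1 with x
    simp [tracePow]
  · let e := stdOrthonormalBasis ℝ (Herm n)
    obtain ⟨D, h1, h2, h3⟩ := exists_lineDeriv_tracePow (n := n) k q
    let Q : Herm n → ℂ := fun x => aeval (fun l => tracePow l x) q
    have hQ : ExpGrowth Q := ExpGrowth.aeval tracePow_expGrowth q
    let F : _ → Herm n → ℂ := fun a x => Matrix.trace (toMatrix (e a) * toMatrix x ^ k) * Q x
    have hg : ∀ (A : Matrix (Fin n) (Fin n) ℂ) (k : ℕ),
        ExpGrowth fun x : Herm n => Matrix.trace (A * toMatrix x ^ k) := fun A k =>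
      ((MatGrowth.const A).mul (MatGrowth.npow k)).trace
    let F' : _ → Herm n → ℂ := fun a x =>
      (∑ i ∈ Finset.range k, Matrix.trace
        (toMatrix (e a) * toMatrix x ^ i * toMatrix (e a) * toMatrix x ^ (k - 1 - i))) * Q x +
      Matrix.trace (toMatrix (e a) * toMatrix x ^ k) * D x (e a)
    have hF : ∀ a, ExpGrowth (F a) := fun a => (hg _ _).mul hQ
    have hF' : ∀ a, ExpGrowth (F' a) := fun a =>
      ((ExpGrowth.sum _ fun i _ => ((((MatGrowth.const _).mul (MatGrowth.npow i)).mul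
        (MatGrowth.const _)).mul (MatGrowth.npow _)).trace).mul hQ).add ((hg _ _).mul (h1 _))
    have hder : ∀ a x, HasLineDerivAt ℝ (F a) (F' a x) x (e a) := by
      intro a x
      have := HasDerivAt.fun_mul (hasDerivAt_trace_mul_pow (toMatrix x) (toMatrix (e a))
        (toMatrix (e a)) k) (h2 x (e a))
      simp only [zero_smul, add_zero] at this
      simp only [HasLineDerivAt, F, map_add, map_smul]
      exact this
    have hibp := Finset.sum_congr rfl fun a (_ : a ∈ Finset.univ) =>
      ExpGrowth.integral_lineDeriv (hF a) (hF' a) (hder a)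
    rw [← integral_finsetSum _ fun a _ => (hF' a).integrable, ← Finset.mul_sum,
      ← integral_finsetSum] at hibp
    swap
    · intro a _
      refine (ExpGrowth.mul ?_ (hF a)).integrable
      exact ExpGrowth.clm (Complex.ofRealCLM.comp (innerSL ℝ (e a)))
    rw [← map_add]
    refine Eq.trans (congrArg (2 * ·) ?_) (hibp.symm.trans ?_)
    · rw [matrixFunctional, gaussFunctional_apply]
      congr 1 with x
      rw [← Finset.sum_mul]
      congr 1
      simp only [F, ← mul_assoc]
      rw [← Finset.sum_mul, map_mul, aeval_X]
      congr 1
      have := e.sum_inner_mul_inner x (npow x k)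
      have h := congrArg (fun r : ℝ => (r : ℂ)) this
      simp only [Complex.ofReal_sum, Complex.ofReal_mul, Herm.ofReal_inner, toMatrix_npow] at h
      rw [← pow_succ'] at h
      rw [tracePow, ← h]
      refine Finset.sum_congr rfl fun a _ => ?_
      rw [Herm.ofReal_inner, Matrix.trace_mul_comm (toMatrix x)]
    · rw [matrixFunctional, gaussFunctional_apply]
      congr 1 with x
      rw [← Finset.sum_mul]
      congr 1
      simp only [F']
      rw [Finset.sum_add_distrib, ← Finset.sum_mul, Finset.sum_comm]
      simp only [Herm.sum_trace_mul_mul_mul e, map_add, map_mul]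
      congr 1
      · simp [powerDiv, tracePow, Q]
      · rw [← h3, ← e.sum_repr' (npow x k), map_sum]
        refine Finset.sum_congr rfl fun a _ => ?_
        rw [map_smul, Complex.real_smul, Herm.ofReal_inner, toMatrix_npow]

end MatrixLoop

/-! ### Eigenvalues of Hermitian matrices -/

section Eig

open Herm

variable {n : ℕ}

/-- The vector of eigenvalues. -/
def eig (x : Herm n) : Fin n → ℝ := (isHermitian x).eigenvalues

theorem tracePow_eq_sum_eig (l : ℕ) (x : Herm n) : tracePow l x = ∑ i, (eig x i : ℂ) ^ l := by
  rw [tracePow, (isHermitian x).spectral_theorem, ← map_pow, Unitary.conjStarAlgAut_apply,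
    Matrix.trace_mul_cycle, Unitary.coe_star_mul_self, one_mul, Matrix.diagonal_pow,
    Matrix.trace_diagonal]
  rfl

theorem norm_sq_eq_sum_eig (x : Herm n) : ‖x‖ ^ 2 = ∑ i, eig x i ^ 2 := by
  rw [Herm.norm_sq]
  change (tracePow 2 x).re = _
  rw [tracePow_eq_sum_eig]
  norm_cast

theorem norm_det_eq_prod_eig (x : Herm n) : ‖(toMatrix x).det‖ = ∏ i, |eig x i| := by
  rw [(isHermitian x).det_eq_prod_eigenvalues, norm_prod]
  simp [eig]

theorem norm_eig_le (x : Herm n) : ‖eig x‖ ≤ ‖x‖ := by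
  refine (pi_norm_le_iff_of_nonneg (norm_nonneg _)).2 fun i => ?_
  rw [Real.norm_eq_abs, ← Real.sqrt_sq (norm_nonneg x), ← Real.sqrt_sq_eq_abs,
    norm_sq_eq_sum_eig]
  exact Real.sqrt_le_sqrt (Finset.single_le_sum (f := fun i => eig x i ^ 2)
    (fun i _ => sq_nonneg _) (Finset.mem_univ i))

/-- A polynomial is determined by its values at the natural numbers, hence so is the multiset of its
roots, and sorting recovers the tuple. -/
theorem antitone_eq_of_prod_sub_eq {m : ℕ} {v w : Fin m → ℝ} (hv : Antitone v) (hw : Antitone w)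
    (h : ∀ k : ℕ, ∏ i, ((k : ℝ) - v i) = ∏ i, ((k : ℝ) - w i)) : v = w := by
  open Polynomial in
  have hp : ∏ i, (X - C (v i)) = ∏ i, (X - C (w i)) := by
    refine Polynomial.eq_of_infinite_eval_eq _ _ ?_
    refine (Set.infinite_range_of_injective (Nat.cast_injective (R := ℝ))).mono ?_
    rintro _ ⟨k, rfl⟩
    simpa [Polynomial.eval_prod] using h k
  have hr := congrArg Polynomial.roots hp
  rw [Polynomial.roots_prod _ _ (by simp [Finset.prod_ne_zero_iff, Polynomial.X_sub_C_ne_zero]),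
    Polynomial.roots_prod _ _ (by simp [Finset.prod_ne_zero_iff, Polynomial.X_sub_C_ne_zero])] at hr
  simp only [Polynomial.roots_X_sub_C, Multiset.bind_singleton] at hr
  rw [Fin.univ_val_map, Fin.univ_val_map, Multiset.coe_eq_coe] at hr
  exact List.ofFn_injective (hr.eq_of_sortedGE hv.sortedGE_ofFn hw.sortedGE_ofFn)

theorem Herm.continuous_toMatrix : Continuous (toMatrix (n := n)) :=
  continuous_matrix fun i j => (MatGrowth.toMatrix i j).continuous

/-- Continuity of the eigenvalues is not needed. The values of the characteristic polynomial at
natural numbers are continuous in `x`, and the map from ordered tuples to these values is measurable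
and injective on a standard Borel space, hence a measurable embedding by the Lusin–Souslin theorem.
-/
theorem measurable_eig : Measurable (eig (n := n)) := by
  let W : Set (Fin (Fintype.card (Fin n)) → ℝ) := {v | Antitone v}
  have hW : MeasurableSet W := by
    have : IsClosed W := by
      simp only [W, Antitone, Set.ofPred_forall]
      exact isClosed_iInter fun i => isClosed_iInter fun j => isClosed_iInter fun _ =>
        isClosed_le (continuous_apply _) (continuous_apply _)
    exact this.measurableSet
  have : StandardBorelSpace W := hW.standardBorel
  let g : W → ℕ → ℝ := fun v k => ∏ i, ((k : ℝ) - v.1 i)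
  have hg : Measurable g := by
    refine measurable_pi_lambda _ fun k => Finset.measurable_prod _ fun i _ => ?_
    exact measurable_const.sub ((measurable_pi_apply i).comp measurable_subtype_coe)
  have hinj : Function.Injective g := fun v w h =>
    Subtype.ext (antitone_eq_of_prod_sub_eq v.2 w.2 fun k => congrFun h k)
  let e₀ : Herm n → W := fun x => ⟨(isHermitian x).eigenvalues₀, (isHermitian x).eigenvalues₀_antitone⟩
  have he₀ : Measurable e₀ := by
    rw [← (hg.measurableEmbedding hinj).measurable_comp_iff]
    refine measurable_pi_lambda _ fun k => ?_
    have hk : ∀ x : Herm n, (g ∘ e₀) x k = ((Matrix.scalar (Fin n) (k : ℂ) - toMatrix x).det).re := by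
      intro x
      rw [← Matrix.eval_charpoly, (isHermitian x).charpoly_eq, Polynomial.eval_prod]
      simp only [Polynomial.eval_sub, Polynomial.eval_X, Polynomial.eval_C]
      have : ∏ i, ((k : ℂ) - ((isHermitian x).eigenvalues i : ℂ)) =
          ((∏ i, ((k : ℝ) - (isHermitian x).eigenvalues i) : ℝ) : ℂ) := by push_cast; rfl
      erw [this]
      rw [Complex.ofReal_re]
      simp only [Function.comp_apply, g, e₀, Matrix.IsHermitian.eigenvalues]
      exact (Equiv.prod_comp (Fintype.equivOfCardEq (Fintype.card_fin _)).symm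
        fun i => ((k : ℝ) - (isHermitian x).eigenvalues₀ i)).symm
    simp_rw [hk]
    refine (Complex.continuous_re.comp ?_).measurable
    exact (continuous_const.sub Herm.continuous_toMatrix).matrix_det
  refine measurable_pi_lambda _ fun i => ?_
  let σ : Fin (Fintype.card (Fin n)) ≃ Fin n := Fintype.equivOfCardEq (Fintype.card_fin _)
  exact (measurable_pi_apply (σ.symm i)).comp (measurable_subtype_coe.comp he₀)

end Eig

/-! ### Moments determine measures with exponential moments -/

section Determinacy

open MvPolynomial

variable {n : ℕ}

/-- The exponential series can be integrated termwise, since its partial sums are dominated by `exp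
|L y|`, which the exponential moments make integrable. -/
theorem hasSum_charFunDual {ρ : Measure (Fin n → ℝ)}
    (hρ : ∀ s : ℝ, Integrable (fun y => Real.exp (s * ‖y‖)) ρ)
    (L : StrongDual ℝ (Fin n → ℝ)) :
    HasSum (fun m : ℕ => ∫ y, ((L y : ℂ) * Complex.I) ^ m / (m.factorial : ℂ) ∂ρ)
      (charFunDual ρ L) := by
  rw [charFunDual_apply]
  refine hasSum_integral_of_dominated_convergence (fun m y => |L y| ^ m / m.factorial) (fun m => ?_)
    (fun m => ?_) ?_ ?_ ?_
  · exact Continuous.aestronglyMeasurable (by fun_prop)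
  · refine Eventually.of_forall fun y => le_of_eq ?_
    simp
  · exact Eventually.of_forall fun y => Real.summable_pow_div_factorial _
  · have h : ∀ y, ∑' m : ℕ, |L y| ^ m / (m.factorial : ℝ) = Real.exp |L y| := by
      intro y
      rw [Real.exp_eq_exp_ℝ, NormedSpace.exp_eq_tsum_div]
    simp_rw [h]
    refine (hρ ‖L‖).mono' (Continuous.aestronglyMeasurable (by fun_prop)) ?_
    refine Eventually.of_forall fun y => ?_
    rw [Real.norm_of_nonneg (Real.exp_pos _).le]
    exact Real.exp_le_exp.2 (L.le_opNorm y)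
  · refine Eventually.of_forall fun y => ?_
    rw [Complex.exp_eq_exp_ℂ]
    exact NormedSpace.expSeries_div_hasSum_exp _

theorem measure_ext_of_moments {ρ ρ' : Measure (Fin n → ℝ)} [IsFiniteMeasure ρ] [IsFiniteMeasure ρ']
    (hρ : ∀ s : ℝ, Integrable (fun y => Real.exp (s * ‖y‖)) ρ)
    (hρ' : ∀ s : ℝ, Integrable (fun y => Real.exp (s * ‖y‖)) ρ')
    (h : ∀ P : MvPolynomial (Fin n) ℂ, ∫ y, aeval (fun i => (y i : ℂ)) P ∂ρ =
      ∫ y, aeval (fun i => (y i : ℂ)) P ∂ρ') : ρ = ρ' := by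
  refine Measure.ext_of_charFunDual (funext fun L => ?_)
  refine (hasSum_charFunDual hρ L).unique ?_
  refine (hasSum_charFunDual hρ' L).congr_fun ?_
  intro m
  -- The `m`-th term of the exponential series of `i L y`, written as a polynomial in the
  -- coordinates of `y`.
  let P : MvPolynomial (Fin n) ℂ :=
    C ((m.factorial : ℂ)⁻¹) * ((∑ i, C (L (Pi.single i 1) : ℂ) * X i) * C Complex.I) ^ m
  have hP : ∀ y : Fin n → ℝ, ((L y : ℂ) * Complex.I) ^ m / (m.factorial : ℂ) =
      aeval (fun i => (y i : ℂ)) P := by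
    intro y
    have hy : L y = ∑ i, L (Pi.single i 1) * y i := by
      conv_lhs => rw [pi_eq_sum_univ' y, map_sum]
      refine Finset.sum_congr rfl fun i _ => ?_
      rw [map_smul, smul_eq_mul, mul_comm]
    simp only [P, map_mul, map_pow, map_sum, aeval_X, aeval_C]
    rw [hy]
    push_cast
    simp only [Algebra.algebraMap_self, RingHom.id_apply]
    rw [div_eq_inv_mul]
  simp_rw [hP]
  exact h P

end Determinacy

/-! ### Symmetric polynomials are polynomials in power sums -/

section Symmetric

open MvPolynomial

variable (n : ℕ)

/-- Newton's identities express `k` times the elementary symmetric polynomial through power sums and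
earlier ones; in characteristic zero one can divide by `k`. -/
theorem esymm_mem_range_aeval_psum (k : ℕ) :
    esymm (Fin n) ℂ k ∈ (aeval (fun l => psum (Fin n) ℂ l) :
      MvPolynomial ℕ ℂ →ₐ[ℂ] MvPolynomial (Fin n) ℂ).range := by
  induction k using Nat.strong_induction_on with
  | _ k ih =>
  rcases Nat.eq_zero_or_pos k with rfl | hk
  · rw [esymm_zero]; exact one_mem _
  · have hsum : (k : MvPolynomial (Fin n) ℂ) * esymm (Fin n) ℂ k ∈
        (aeval (fun l => psum (Fin n) ℂ l) :
          MvPolynomial ℕ ℂ →ₐ[ℂ] MvPolynomial (Fin n) ℂ).range := by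
      rw [mul_esymm_eq_sum]
      refine mul_mem (pow_mem (neg_mem (one_mem _)) _) (sum_mem fun a ha => ?_)
      refine mul_mem (mul_mem (pow_mem (neg_mem (one_mem _)) _) (ih _ ?_)) ?_
      · exact (Finset.mem_filter.1 ha).2
      · exact ⟨X a.2, by simp⟩
    have : esymm (Fin n) ℂ k = ((k : ℂ)⁻¹) • ((k : MvPolynomial (Fin n) ℂ) * esymm (Fin n) ℂ k) := by
      have hk' : (k : ℂ) ≠ 0 := by exact_mod_cast hk.ne'
      rw [← nsmul_eq_mul, ← Nat.cast_smul_eq_nsmul ℂ, smul_smul, inv_mul_cancel₀ hk', one_smul]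
    rw [this]
    exact Subalgebra.smul_mem _ hsum _

theorem exists_aeval_psum_eq {P : MvPolynomial (Fin n) ℂ} (hP : P.IsSymmetric) :
    ∃ q : MvPolynomial ℕ ℂ, aeval (fun l => psum (Fin n) ℂ l) q = P := by
  obtain ⟨r, hr⟩ := esymmAlgHom_surjective (σ := Fin n) (R := ℂ) (n := n) (by simp) ⟨P, hP⟩
  have h := congrArg Subtype.val hr
  rw [esymmAlgHom_apply] at h
  change _ = P at h
  rw [← h]
  change _ ∈ (aeval (fun l => psum (Fin n) ℂ l) :
      MvPolynomial ℕ ℂ →ₐ[ℂ] MvPolynomial (Fin n) ℂ).range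
  have h2 : aeval (fun i : Fin n => esymm (Fin n) ℂ (i + 1)) r ∈
      Algebra.adjoin ℂ (Set.range fun i : Fin n => esymm (Fin n) ℂ (i + 1)) := by
    rw [Algebra.adjoin_range_eq_range_aeval]
    exact ⟨r, rfl⟩
  refine Algebra.adjoin_le ?_ h2
  rintro _ ⟨i, rfl⟩
  exact esymm_mem_range_aeval_psum n _

end Symmetric

/-! ### Integrals against nonnegative real densities -/

theorem integral_withDensity_ofReal {α E : Type*} [MeasurableSpace α] {ρ : Measure α}
    [NormedAddCommGroup E] [NormedSpace ℝ E] {g : α → ℝ} (hg : Measurable g) (h0 : ∀ x, 0 ≤ g x)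
    (f : α → E) :
    ∫ x, f x ∂(ρ.withDensity fun x => ENNReal.ofReal (g x)) = ∫ x, g x • f x ∂ρ := by
  rw [integral_withDensity_eq_integral_toReal_smul hg.ennreal_ofReal
    (Eventually.of_forall fun _ => ENNReal.ofReal_lt_top)]
  simp only [ENNReal.toReal_ofReal (h0 _)]

theorem integrable_withDensity_ofReal {α E : Type*} [MeasurableSpace α] {ρ : Measure α}
    [NormedAddCommGroup E] [NormedSpace ℝ E] {g : α → ℝ} (hg : Measurable g) (h0 : ∀ x, 0 ≤ g x)
    (f : α → E) :
    Integrable f (ρ.withDensity fun x => ENNReal.ofReal (g x)) ↔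
      Integrable (fun x => g x • f x) ρ := by
  rw [integrable_withDensity_iff_integrable_smul' hg.ennreal_ofReal
    (Eventually.of_forall fun _ => ENNReal.ofReal_lt_top)]
  simp only [ENNReal.toReal_ofReal (h0 _)]

/-! ### The Weyl integration formula -/

section Weyl

open MvPolynomial

variable {n : ℕ}

/-- The Vandermonde product. -/
def vandProd (y : Fin n → ℝ) : ℝ := ∏ i, ∏ j ∈ Finset.Ioi i, (y j - y i)

/-- The joint density of the eigenvalues of the Gaussian unitary ensemble, up to a constant. -/
def eigWeight (y : Fin n → ℝ) : ℝ := vandProd y ^ 2 * Real.exp (-∑ i, y i ^ 2)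

theorem continuous_vandProd : Continuous (vandProd (n := n)) := by
  unfold vandProd; fun_prop

theorem continuous_eigWeight : Continuous (eigWeight (n := n)) := by
  unfold eigWeight
  exact (continuous_vandProd.pow 2).mul (by fun_prop)

theorem eigWeight_nonneg (y : Fin n → ℝ) : 0 ≤ eigWeight y := by unfold eigWeight; positivity

theorem vandProd_sq_comp_perm (σ : Equiv.Perm (Fin n)) (y : Fin n → ℝ) :
    vandProd (y ∘ σ) ^ 2 = vandProd y ^ 2 := by
  have h : ∀ z : Fin n → ℝ, vandProd z = (Matrix.vandermonde z).det := fun z =>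
    (Matrix.det_vandermonde z).symm
  have h2 : Matrix.vandermonde (y ∘ σ) = (Matrix.vandermonde y).submatrix σ id := by
    ext i j; simp [Matrix.vandermonde_apply]
  rw [h, h, h2, Matrix.det_permute, mul_pow]
  have : ((Equiv.Perm.sign σ : ℤ) : ℝ) ^ 2 = 1 := by
    norm_cast
    simp
  rw [this, one_mul]

theorem eigWeight_comp_perm (σ : Equiv.Perm (Fin n)) (y : Fin n → ℝ) :
    eigWeight (y ∘ σ) = eigWeight y := by
  rw [eigWeight, eigWeight, vandProd_sq_comp_perm]
  congr 3
  exact Equiv.sum_comp σ fun i => y i ^ 2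

/-- The unnormalized Gaussian unitary ensemble. -/
def gue (n : ℕ) : Measure (Herm n) :=
  volume.withDensity fun x => ENNReal.ofReal (Real.exp (-‖x‖ ^ 2))

/-- The unnormalized joint law of the eigenvalues. -/
def eigLaw (n : ℕ) : Measure (Fin n → ℝ) := volume.withDensity fun y => ENNReal.ofReal (eigWeight y)

theorem integrable_mul_gauss_pi {F : (Fin n → ℝ) → ℂ}
    (hF : ExpGrowth fun x : EuclideanSpace ℝ (Fin n) => F (WithLp.ofLp x)) :
    Integrable (fun y : Fin n → ℝ => F y * (Real.exp (-∑ i, y i ^ 2) : ℂ)) := by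
  rw [← (PiLp.volume_preserving_ofLp (Fin n)).integrable_comp_emb
    (MeasurableEquiv.toLp 2 (Fin n → ℝ)).symm.measurableEmbedding]
  refine hF.integrable.congr (Eventually.of_forall fun x => ?_)
  simp [EuclideanSpace.real_norm_sq_eq]

theorem integral_mul_gauss_pi (F : (Fin n → ℝ) → ℂ) :
    ∫ y : Fin n → ℝ, F y * (Real.exp (-∑ i, y i ^ 2) : ℂ) =
      ∫ x : EuclideanSpace ℝ (Fin n), F (WithLp.ofLp x) * (Real.exp (-‖x‖ ^ 2) : ℂ) := by
  rw [← (PiLp.volume_preserving_ofLp (Fin n)).integral_comp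
    (MeasurableEquiv.toLp 2 (Fin n → ℝ)).symm.measurableEmbedding]
  simp [EuclideanSpace.real_norm_sq_eq]

theorem aeval_vand (y : Fin n → ℝ) : aeval (fun i => (y i : ℂ)) (vand n) = (vandProd y : ℂ) := by
  simp [vand, vandProd, map_prod]

theorem expGrowth_vandProd_sq :
    ExpGrowth fun x : EuclideanSpace ℝ (Fin n) => ((vandProd (WithLp.ofLp x) ^ 2 : ℝ) : ℂ) := by
  have := ExpGrowth.aeval (coordFun_expGrowth n) (vand n ^ 2)
  convert this using 2 with x
  rw [map_pow, Complex.ofReal_pow, ← aeval_vand]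
  rfl

theorem norm_ofLp_le (x : EuclideanSpace ℝ (Fin n)) : ‖WithLp.ofLp x‖ ≤ ‖x‖ :=
  (pi_norm_le_iff_of_nonneg (norm_nonneg _)).2 fun i => PiLp.norm_apply_le x i

theorem expGrowth_exp_norm (s : ℝ) :
    ExpGrowth fun x : EuclideanSpace ℝ (Fin n) => (Real.exp (s * ‖WithLp.ofLp x‖) : ℂ) := by
  refine ⟨?_, 1, |s|, zero_le_one, abs_nonneg _, fun x => ?_⟩
  · have : Continuous fun x : EuclideanSpace ℝ (Fin n) => WithLp.ofLp x :=
      PiLp.continuous_ofLp 2 _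
    fun_prop
  · rw [Complex.norm_real, Real.norm_of_nonneg (Real.exp_pos _).le, one_mul, Real.exp_le_exp]
    exact mul_le_mul (le_abs_self _) (norm_ofLp_le x) (norm_nonneg _) (abs_nonneg _)

theorem integrable_exp_eigLaw (s : ℝ) : Integrable (fun y => Real.exp (s * ‖y‖)) (eigLaw n) := by
  rw [eigLaw, integrable_withDensity_ofReal continuous_eigWeight.measurable eigWeight_nonneg]
  have := (integrable_mul_gauss_pi (n := n) (F := fun y => ((vandProd y ^ 2 : ℝ) : ℂ) *
    (Real.exp (s * ‖y‖) : ℂ)) (expGrowth_vandProd_sq.mul (expGrowth_exp_norm s))).re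
  refine this.congr (Eventually.of_forall fun y => ?_)
  simp only [eigWeight, smul_eq_mul, ← Complex.ofReal_mul]
  rw [RCLike.re_eq_complex_re, Complex.ofReal_re]
  ring

theorem integrable_exp_gue (s : ℝ) : Integrable (fun x => Real.exp (s * ‖x‖)) (gue n) := by
  rw [gue, integrable_withDensity_ofReal (by fun_prop) fun _ => (Real.exp_pos _).le]
  have h : ExpGrowth fun x : Herm n => (Real.exp (s * ‖x‖) : ℂ) := by
    refine ⟨by fun_prop, 1, |s|, zero_le_one, abs_nonneg _, fun x => ?_⟩
    rw [Complex.norm_real, Real.norm_of_nonneg (Real.exp_pos _).le, one_mul, Real.exp_le_exp]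
    exact mul_le_mul_of_nonneg_right (le_abs_self _) (norm_nonneg _)
  refine h.integrable.re.congr (Eventually.of_forall fun y => ?_)
  simp only [smul_eq_mul, ← Complex.ofReal_mul]
  rw [RCLike.re_eq_complex_re, Complex.ofReal_re]
  ring

instance : IsFiniteMeasure (eigLaw n) := by
  have h := integrable_exp_eigLaw (n := n) 0
  simp only [zero_mul, Real.exp_zero] at h
  exact (integrable_const_iff_isFiniteMeasure one_ne_zero).1 h

instance : IsFiniteMeasure (gue n) := by
  have h := integrable_exp_gue (n := n) 0
  simp only [zero_mul, Real.exp_zero] at h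
  exact (integrable_const_iff_isFiniteMeasure one_ne_zero).1 h

theorem eigenFunctional_eq_integral (q : MvPolynomial ℕ ℂ) :
    eigenFunctional n q =
      ∫ y, aeval (fun i => (y i : ℂ)) (aeval (fun l => psum (Fin n) ℂ l) q) ∂(eigLaw n) := by
  rw [eigLaw, integral_withDensity_ofReal continuous_eigWeight.measurable eigWeight_nonneg]
  simp only [eigenFunctional, LinearMap.comp_apply, AlgHom.toLinearMap_apply,
    LinearMap.mulRight_apply, gaussFunctional_apply]
  refine (integral_mul_gauss_pi (n := n) fun y => aeval (fun i => (y i : ℂ))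
    (aeval (fun l => psum (Fin n) ℂ l) q * vand n ^ 2)).symm.trans ?_
  congr 1 with y
  rw [map_mul, map_pow, aeval_vand, eigWeight, Complex.real_smul]
  push_cast
  ring

theorem matrixFunctional_eq_integral (q : MvPolynomial ℕ ℂ) :
    matrixFunctional n q =
      ∫ x, aeval (fun i => (eig x i : ℂ)) (aeval (fun l => psum (Fin n) ℂ l) q) ∂(gue n) := by
  rw [gue, integral_withDensity_ofReal (by fun_prop) fun _ => (Real.exp_pos _).le,
    matrixFunctional, gaussFunctional_apply]
  congr 1 with x
  rw [comp_aeval_apply, Complex.real_smul, mul_comm]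
  congr 3
  ext l
  simp [tracePow_eq_sum_eig, psum]

theorem eigLaw_real_univ_pos : 0 < (eigLaw n).real Set.univ := by
  have h : (eigLaw n).real Set.univ = ∫ y : Fin n → ℝ, eigWeight y := by
    have := integral_withDensity_ofReal (ρ := volume) (continuous_eigWeight (n := n)).measurable
      eigWeight_nonneg (fun _ => (1 : ℝ))
    simpa [eigLaw] using this
  have hfint : Integrable (eigWeight (n := n)) := by
    have := integrable_exp_eigLaw (n := n) 0
    rw [eigLaw, integrable_withDensity_ofReal continuous_eigWeight.measurable eigWeight_nonneg] at this
    simpa using this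
  rw [h, integral_pos_iff_support_of_nonneg eigWeight_nonneg hfint]
  -- The point with coordinates `0, 1, …, n - 1` has no repeated entries, so the Vandermonde product
  -- does not vanish there.
  refine (continuous_eigWeight.isOpen_support).measure_pos _ ⟨fun i => (i : ℝ), ?_⟩
  rw [Function.mem_support, eigWeight]
  refine mul_ne_zero (pow_ne_zero _ ?_) (Real.exp_pos _).ne'
  rw [vandProd]
  refine Finset.prod_ne_zero_iff.2 fun i _ => Finset.prod_ne_zero_iff.2 fun j hj => ?_
  rw [sub_ne_zero]
  have := Finset.mem_Ioi.1 hj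
  exact_mod_cast (Fin.lt_def.1 this).ne'

theorem gue_real_univ_pos : 0 < (gue n).real Set.univ := by
  rw [measureReal_def, ENNReal.toReal_pos_iff]
  refine ⟨?_, measure_lt_top _ _⟩
  rw [gue, withDensity_apply _ MeasurableSet.univ, Measure.restrict_univ,
    lintegral_pos_iff_support (by fun_prop)]
  have : (Function.support fun x : Herm n => ENNReal.ofReal (Real.exp (-‖x‖ ^ 2))) = Set.univ := by
    ext x
    simpa using Real.exp_pos _
  rw [this]
  exact isOpen_univ.measure_pos _ ⟨0, trivial⟩

/-- The ratio of the total masses of `gue` and `eigLaw`. -/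
def weylConst (n : ℕ) : ℝ := (gue n).real Set.univ / (eigLaw n).real Set.univ

theorem weylConst_pos : 0 < weylConst n := div_pos gue_real_univ_pos eigLaw_real_univ_pos

theorem matrixFunctional_eq_smul : matrixFunctional n = (weylConst n : ℂ) • eigenFunctional n := by
  refine (matrixFunctional_loopEquations n).eq_of_apply_one
    ((eigenFunctional_loopEquations n).smul _) ?_
  rw [LinearMap.smul_apply, matrixFunctional_eq_integral, eigenFunctional_eq_integral]
  simp only [map_one, integral_const, smul_eq_mul]
  rw [Complex.real_smul, Complex.real_smul, weylConst]
  have := (eigLaw_real_univ_pos (n := n)).ne'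
  have h : (((eigLaw n).real Set.univ : ℝ) : ℂ) ≠ 0 := by exact_mod_cast this
  push_cast
  field_simp

theorem aeval_rename_perm (σ : Equiv.Perm (Fin n)) (P : MvPolynomial (Fin n) ℂ) (y : Fin n → ℝ) :
    aeval (fun i => (y i : ℂ)) (rename σ P) = aeval (fun i => ((y ∘ σ) i : ℂ)) P := by
  rw [aeval_rename]; rfl

theorem continuous_aeval_ofReal (P : MvPolynomial (Fin n) ℂ) :
    Continuous fun y : Fin n → ℝ => aeval (fun i => (y i : ℂ)) P :=
  (MvPolynomial.continuous_eval P).comp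
    (show Continuous fun (y : Fin n → ℝ) (i : Fin n) => (y i : ℂ) by fun_prop)

theorem integrable_aeval_of_exp {α : Type*} [MeasurableSpace α] {ρ : Measure α} {u : α → Fin n → ℝ}
    (hu : Measurable u) (h : ∀ s : ℝ, Integrable (fun a => Real.exp (s * ‖u a‖)) ρ)
    (P : MvPolynomial (Fin n) ℂ) : Integrable (fun a => aeval (fun i => (u a i : ℂ)) P) ρ := by
  have hb : ∃ C s : ℝ, 0 ≤ C ∧ 0 ≤ s ∧
      ∀ y : Fin n → ℝ, ‖aeval (fun i => (y i : ℂ)) P‖ ≤ C * Real.exp (s * ‖y‖) := by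
    refine (ExpGrowth.aeval (E := Fin n → ℝ) (u := fun i y => (y i : ℂ)) (fun i => ?_) P).bound
    refine ⟨by fun_prop, 1, 1, zero_le_one, zero_le_one, fun y => ?_⟩
    rw [Complex.norm_real]
    linarith [norm_le_pi_norm y i, Real.add_one_le_exp (1 * ‖y‖)]
  obtain ⟨C, s, _, _, hb⟩ := hb
  refine ((h s).const_mul C).mono' ?_ (Eventually.of_forall fun a => hb (u a))
  have hc := continuous_aeval_ofReal P
  exact (hc.measurable.comp hu).aestronglyMeasurable

/-- The sum over all permutations of the law of the permuted eigenvalues. -/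
def symEigLaw (n : ℕ) : Measure (Fin n → ℝ) :=
  ∑ σ : Equiv.Perm (Fin n), (gue n).map fun x => eig x ∘ σ

theorem measurable_eig_comp (σ : Equiv.Perm (Fin n)) :
    Measurable fun x : Herm n => eig x ∘ σ :=
  measurable_pi_lambda _ fun i => (measurable_pi_apply (σ i)).comp measurable_eig

/-- Eigenvalues come in a fixed order, so only the symmetrized law can match `eigLaw`. Integrating
`P` against it amounts to integrating the symmetric polynomial `∑ rename σ P`, a polynomial in power
sums, to which `matrixFunctional_eq_smul` applies. Permutation invariance of `eigLaw` makes the `n!`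
terms equal, and `measure_ext_of_moments` concludes. -/
theorem symEigLaw_eq : symEigLaw n =
    ENNReal.ofReal (weylConst n * (n.factorial : ℝ)) • eigLaw n := by
  have hpos : 0 < weylConst n * (n.factorial : ℝ) := mul_pos weylConst_pos (by positivity)
  have hnorm : ∀ (σ : Equiv.Perm (Fin n)) (y : Fin n → ℝ), ‖y ∘ σ‖ ≤ ‖y‖ := fun σ y =>
    (pi_norm_le_iff_of_nonneg (norm_nonneg _)).2 fun i => norm_le_pi_norm y (σ i)
  have hexpσ : ∀ (σ : Equiv.Perm (Fin n)) (s : ℝ),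
      Integrable (fun x : Herm n => Real.exp (s * ‖eig x ∘ σ‖)) (gue n) := by
    intro σ s
    refine (integrable_exp_gue |s|).mono' ?_ (Eventually.of_forall fun x => ?_)
    · exact ((measurable_eig_comp σ).norm.const_mul s).exp.aestronglyMeasurable
    · rw [Real.norm_of_nonneg (Real.exp_pos _).le, Real.exp_le_exp]
      exact mul_le_mul (le_abs_self _) ((hnorm _ _).trans (norm_eig_le x)) (norm_nonneg _)
        (abs_nonneg _)
  have : IsFiniteMeasure (symEigLaw n) := by unfold symEigLaw; infer_instance
  have : IsFiniteMeasure (ENNReal.ofReal (weylConst n * (n.factorial : ℝ)) • eigLaw n) :=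
    Measure.smul_finite _ ENNReal.ofReal_ne_top
  refine measure_ext_of_moments (fun s => ?_) (fun s => ?_) fun P => ?_
  · rw [symEigLaw, integrable_finsetSum_measure]
    intro σ _
    rw [integrable_map_measure (Continuous.aestronglyMeasurable (by fun_prop))
      (measurable_eig_comp σ).aemeasurable]
    exact hexpσ σ s
  · exact (integrable_exp_eigLaw s).smul_measure ENNReal.ofReal_ne_top
  · have hc := continuous_aeval_ofReal (n := n)
    have hmp : ∀ σ : Equiv.Perm (Fin n), ∫ y, aeval (fun i => (y i : ℂ)) (rename σ P) ∂(eigLaw n) =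
        ∫ y, aeval (fun i => (y i : ℂ)) P ∂(eigLaw n) := by
      intro σ
      rw [eigLaw, integral_withDensity_ofReal continuous_eigWeight.measurable eigWeight_nonneg,
        integral_withDensity_ofReal continuous_eigWeight.measurable eigWeight_nonneg]
      simp only [aeval_rename_perm]
      rw [← (volume_measurePreserving_piCongrLeft (fun _ => ℝ) σ.symm).integral_comp
        (MeasurableEquiv.measurableEmbedding _)
        (fun y : Fin n → ℝ => eigWeight y • aeval (fun i => (y i : ℂ)) P)]
      congr 1 with y
      have : (MeasurableEquiv.piCongrLeft (fun _ : Fin n => ℝ) σ.symm) y = y ∘ σ := by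
        ext i
        have := Equiv.piCongrLeft_apply_apply (fun _ : Fin n => ℝ) σ.symm y (σ i)
        rw [Equiv.symm_apply_apply] at this
        exact this
      rw [this, eigWeight_comp_perm]
    have hfint : ∀ P : MvPolynomial (Fin n) ℂ,
        Integrable (fun y : Fin n → ℝ => aeval (fun i => (y i : ℂ)) P) (eigLaw n) :=
      fun P => integrable_aeval_of_exp measurable_id integrable_exp_eigLaw P
    have hS : (∑ σ : Equiv.Perm (Fin n), rename σ P).IsSymmetric := by
      intro τ
      rw [map_sum]
      simp only [rename_rename]
      exact Fintype.sum_equiv (Equiv.mulLeft τ) _ _ fun σ => rfl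
    obtain ⟨q, hq⟩ := exists_aeval_psum_eq n hS
    have h1 := congrArg (fun Φ => Φ q) (matrixFunctional_eq_smul (n := n))
    simp only [LinearMap.smul_apply, matrixFunctional_eq_integral, eigenFunctional_eq_integral,
      hq, map_sum, smul_eq_mul] at h1
    rw [integral_finsetSum _ fun σ _ => hfint _] at h1
    simp only [hmp, Finset.sum_const, Finset.card_univ, Fintype.card_perm, Fintype.card_fin,
      nsmul_eq_mul] at h1
    rw [integral_smul_measure, ENNReal.toReal_ofReal hpos.le, Complex.real_smul]
    push_cast
    rw [mul_assoc, ← h1, symEigLaw, integral_finsetSum_measure]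
    · rw [integral_finsetSum]
      · refine Finset.sum_congr rfl fun σ _ => ?_
        rw [integral_map (measurable_eig_comp σ).aemeasurable (hc P).aestronglyMeasurable]
        simp only [aeval_rename_perm]
      · intro σ _
        simp only [aeval_rename_perm]
        exact integrable_aeval_of_exp (measurable_eig_comp σ) (hexpσ σ) P
    · intro σ _
      rw [integrable_map_measure (hc P).aestronglyMeasurable (measurable_eig_comp σ).aemeasurable]
      exact integrable_aeval_of_exp (measurable_eig_comp σ) (hexpσ σ) P

/-- **Weyl integration formula** for symmetric functions of the eigenvalues. -/
theorem lintegral_eig_gue {g : (Fin n → ℝ) → ℝ≥0∞} (hg : Measurable g)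
    (hsymm : ∀ (σ : Equiv.Perm (Fin n)) y, g (y ∘ σ) = g y) :
    ∫⁻ x, g (eig x) ∂(gue n) = ENNReal.ofReal (weylConst n) * ∫⁻ y, g y ∂(eigLaw n) := by
  have h := congrArg (fun ρ => ∫⁻ y, g y ∂ρ) (symEigLaw_eq (n := n))
  simp only [symEigLaw, lintegral_finsetSum_measure, lintegral_smul_measure,
    lintegral_map hg (measurable_eig_comp _), hsymm, Finset.sum_const, Finset.card_univ,
    Fintype.card_perm, Fintype.card_fin, nsmul_eq_mul, smul_eq_mul] at h
  rw [mul_comm (weylConst n), ENNReal.ofReal_mul (by positivity), ENNReal.ofReal_natCast,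
    mul_assoc] at h
  exact (ENNReal.mul_right_inj (by exact_mod_cast n.factorial_ne_zero)
    (ENNReal.natCast_ne_top _)).1 h

end Weyl

/-! ### Generalized Hermite polynomials -/

section GenHermite

open Polynomial

/-- The weight `|x| ^ (2 μ) exp (-x ^ 2)`. -/
def hermWeight (μ x : ℝ) : ℝ := |x| ^ (2 * μ) * Real.exp (-x ^ 2)

theorem hermWeight_nonneg (μ x : ℝ) : 0 ≤ hermWeight μ x := by unfold hermWeight; positivity

theorem hermWeight_neg (μ x : ℝ) : hermWeight μ (-x) = hermWeight μ x := by simp [hermWeight]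

theorem measurable_hermWeight (μ : ℝ) : Measurable (hermWeight μ) := by
  unfold hermWeight; fun_prop

theorem integral_abs_rpow_mul_exp {s : ℝ} (hs : 0 ≤ s) :
    ∫ x : ℝ, |x| ^ s * Real.exp (-x ^ 2) = Real.Gamma ((s + 1) / 2) := by
  have h1 := integral_comp_abs (f := fun x => x ^ s * Real.exp (-x ^ (2 : ℝ)))
  rw [integral_rpow_mul_exp_neg_rpow two_pos (by linarith)] at h1
  simp only [Real.rpow_two, sq_abs] at h1
  rw [h1]
  ring

/-- A function that is not integrable has integral zero by convention, whereas this integral is a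
positive value of the Gamma function. -/
theorem integrable_abs_rpow_mul_exp {s : ℝ} (hs : 0 ≤ s) :
    Integrable fun x : ℝ => |x| ^ s * Real.exp (-x ^ 2) := by
  by_contra h
  have := integral_undef h
  rw [integral_abs_rpow_mul_exp hs] at this
  exact (Real.Gamma_pos_of_pos (by linarith : 0 < (s + 1) / 2)).ne' this

variable {μ : ℝ}

theorem abs_pow_mul_hermWeight (hμ : 0 ≤ μ) (m : ℕ) (x : ℝ) :
    |x| ^ m * hermWeight μ x = |x| ^ (m + 2 * μ) * Real.exp (-x ^ 2) := by
  rw [hermWeight, Real.rpow_add_of_nonneg (abs_nonneg x) (by positivity) (by positivity),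
    Real.rpow_natCast]
  ring

theorem integrable_pow_mul_hermWeight (hμ : 0 ≤ μ) (m : ℕ) :
    Integrable fun x : ℝ => x ^ m * hermWeight μ x := by
  refine (integrable_abs_rpow_mul_exp (s := m + 2 * μ) (by positivity)).mono'
    ((by fun_prop : Measurable fun x : ℝ => x ^ m).mul
      (measurable_hermWeight μ)).aestronglyMeasurable (Eventually.of_forall fun x => ?_)
  rw [← abs_pow_mul_hermWeight hμ, norm_mul, Real.norm_of_nonneg (hermWeight_nonneg _ _), norm_pow,
    Real.norm_eq_abs]

theorem integrable_eval_mul_hermWeight (hμ : 0 ≤ μ) (p : ℝ[X]) :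
    Integrable fun x : ℝ => p.eval x * hermWeight μ x := by
  induction p using Polynomial.induction_on' with
  | add p q hp hq =>
    simp only [eval_add, add_mul]
    exact hp.add hq
  | monomial m a =>
    simp only [eval_monomial, mul_assoc]
    exact (integrable_pow_mul_hermWeight hμ m).const_mul a

/-- Integration of polynomials against the weight. -/
def hermInt (hμ : 0 ≤ μ) : ℝ[X] →ₗ[ℝ] ℝ where
  toFun p := ∫ x, p.eval x * hermWeight μ x
  map_add' p q := by
    simp only [eval_add, add_mul]
    exact integral_add (integrable_eval_mul_hermWeight hμ p) (integrable_eval_mul_hermWeight hμ q)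
  map_smul' c p := by
    simp only [eval_smul, smul_eq_mul, mul_assoc, RingHom.id_apply]
    exact integral_const_mul _ _

theorem hermInt_apply (hμ : 0 ≤ μ) (p : ℝ[X]) :
    hermInt hμ p = ∫ x, p.eval x * hermWeight μ x := rfl

/-- The recurrence coefficients. -/
def hermCoeff (μ : ℝ) (k : ℕ) : ℝ := (k + if Odd k then 2 * μ else 0) / 2

theorem hermCoeff_zero : hermCoeff μ 0 = 0 := by simp [hermCoeff]

theorem hermCoeff_succ_pos (hμ : 0 ≤ μ) (k : ℕ) : 0 < hermCoeff μ (k + 1) := by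
  unfold hermCoeff; split_ifs <;> positivity

theorem hermCoeff_succ (k : ℕ) :
    hermCoeff μ (k + 1) = hermCoeff μ k + 1 / 2 + μ * (-1) ^ k := by
  unfold hermCoeff
  rcases Nat.even_or_odd k with h | h
  · rw [if_pos h.add_one, if_neg (Nat.not_odd_iff_even.2 h), h.neg_one_pow]
    push_cast; ring
  · rw [if_neg (Nat.not_odd_iff_even.2 h.add_one), if_pos h, h.neg_one_pow]
    push_cast; ring

theorem hermInt_X_pow_odd (hμ : 0 ≤ μ) {m : ℕ} (hm : Odd m) : hermInt hμ (X ^ m) = 0 := by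
  rw [hermInt_apply]
  have h := integral_neg_eq_self (fun x : ℝ => (X ^ m : ℝ[X]).eval x * hermWeight μ x) volume
  simp only [eval_pow, eval_X, hermWeight_neg, hm.neg_pow, neg_mul] at h ⊢
  rw [integral_neg] at h
  linarith

theorem hermInt_X_pow_even (hμ : 0 ≤ μ) {m : ℕ} (hm : Even m) :
    hermInt hμ (X ^ m) = Real.Gamma ((m + 2 * μ + 1) / 2) := by
  rw [hermInt_apply, ← integral_abs_rpow_mul_exp (by positivity)]
  congr 1 with x
  rw [← abs_pow_mul_hermWeight hμ, eval_pow, eval_X, hm.pow_abs]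

/-- For even `m` this is the functional equation of the Gamma function; for odd `m` both sides
vanish. -/
theorem hermInt_X_pow_add_two (hμ : 0 ≤ μ) (m : ℕ) :
    hermInt hμ (X ^ (m + 2)) = hermCoeff μ (m + 1) * hermInt hμ (X ^ m) := by
  rcases Nat.even_or_odd m with h | h
  · rw [hermInt_X_pow_even hμ h, hermInt_X_pow_even hμ (by simpa [Nat.even_add] using h), hermCoeff,
      if_pos h.add_one,
      show ((m + 2 : ℕ) + 2 * μ + 1) / 2 = (m + 2 * μ + 1) / 2 + 1 by push_cast; ring,
      Real.Gamma_add_one (by positivity)]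
    push_cast
    ring
  · rw [hermInt_X_pow_odd hμ h, hermInt_X_pow_odd hμ (by simpa [Nat.odd_add] using h), mul_zero]

/-- The Dunkl operator `f' + μ (f(x) - f(-x)) / x` on polynomials. -/
def dunkl (μ : ℝ) : ℝ[X] →ₗ[ℝ] ℝ[X] :=
  Polynomial.lsum fun m => (2 * hermCoeff μ m) • monomial (m - 1)

theorem dunkl_monomial (m : ℕ) (a : ℝ) :
    dunkl μ (monomial m a) = (2 * hermCoeff μ m) • monomial (m - 1) a := by
  rw [dunkl, Polynomial.lsum_apply, Polynomial.sum_monomial_index _ _ (by simp)]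
  simp

theorem dunkl_X_mul (f : ℝ[X]) :
    dunkl μ (X * f) = X * dunkl μ f + f + (2 * μ) • f.comp (-X) := by
  induction f using Polynomial.induction_on' with
  | add p q hp hq => simp only [mul_add, map_add, hp, hq, add_comp, smul_add]; ring
  | monomial m a =>
    rw [X_mul_monomial, dunkl_monomial, dunkl_monomial, Nat.add_sub_cancel]
    have h1 : (monomial m a).comp (-X) = ((-1 : ℝ) ^ m) • monomial m a := by
      rw [← C_mul_X_pow_eq_monomial]
      simp only [mul_comp, C_comp, pow_comp, X_comp, smul_eq_C_mul]
      rw [neg_pow, C_pow, C_neg, C_1]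
      ring
    rw [h1, hermCoeff_succ]
    rcases m with _ | m
    · simp only [hermCoeff_zero, pow_zero, one_smul, mul_zero, zero_smul, zero_add]
      rw [show (2 * (1 / 2 + μ * 1)) = 1 + 2 * μ by ring, add_smul, one_smul]
    · rw [mul_smul_comm, Nat.add_sub_cancel, X_mul_monomial]
      module

/-- Integration by parts for the Dunkl operator: the adjoint of `dunkl` is `2 x - dunkl`. On
monomials it reduces to the two-step moment recursion and an additivity property of `hermCoeff`. -/
theorem hermInt_dunkl (hμ : 0 ≤ μ) (f g : ℝ[X]) :
    hermInt hμ (dunkl μ f * g) + hermInt hμ (f * dunkl μ g) = 2 * hermInt hμ (X * f * g) := by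
  induction f using Polynomial.induction_on' with
  | add p q hp hq =>
    simp only [map_add, add_mul, mul_add]
    linarith
  | monomial i a =>
  induction g using Polynomial.induction_on' with
  | add p q hp hq =>
    simp only [map_add, mul_add]
    linarith
  | monomial j b =>
    have hm : ∀ (m : ℕ) (a : ℝ), hermInt hμ (monomial m a) = a * hermInt hμ (X ^ m) := by
      intro m a
      rw [← C_mul_X_pow_eq_monomial, ← smul_eq_C_mul, map_smul, smul_eq_mul]
    rw [dunkl_monomial, dunkl_monomial, smul_mul_assoc, mul_smul_comm, X_mul_monomial,
      map_smul, map_smul, monomial_mul_monomial, monomial_mul_monomial, monomial_mul_monomial]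
    simp only [hm, smul_eq_mul]
    rcases i with _ | i
    · rcases j with _ | j
      · rw [hermInt_X_pow_odd hμ (by decide : Odd (0 + 1 + 0)), hermCoeff_zero]
        ring
      · have := hermInt_X_pow_add_two hμ j
        simp only [hermCoeff_zero, Nat.add_sub_cancel, zero_add]
        rw [show 1 + (j + 1) = j + 2 by ring, this]
        ring
    · rcases j with _ | j
      · have := hermInt_X_pow_add_two hμ i
        simp only [hermCoeff_zero, Nat.add_sub_cancel, add_zero]
        rw [show i + 1 + 1 = i + 2 by ring, this]
        ring
      · have := hermInt_X_pow_add_two hμ (i + j + 1)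
        rw [show i + 1 + 1 + (j + 1) = i + j + 1 + 2 by ring, this,
          show i + 1 - 1 + (j + 1) = i + j + 1 by omega,
          show i + 1 + (j + 1 - 1) = i + j + 1 by omega]
        rcases Nat.even_or_odd (i + j + 1) with h | h
        -- Here `i + 1` and `j + 1` have opposite parity, so exactly one of the two coefficients
        -- carries `2 μ`, as does the one of their odd sum.
        · have hβ : hermCoeff μ (i + j + 1 + 1) = hermCoeff μ (i + 1) + hermCoeff μ (j + 1) := by
            have hij : Even (i + j + 1) := h
            unfold hermCoeff
            rcases Nat.even_or_odd i with hi | hi <;> rcases Nat.even_or_odd j with hj | hj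
            · exact absurd h (by simp [Nat.even_add, hi, hj])
            · rw [if_pos h.add_one, if_pos hi.add_one, if_neg (Nat.not_odd_iff_even.2 hj.add_one)]
              push_cast; ring
            · rw [if_pos h.add_one, if_pos hj.add_one, if_neg (Nat.not_odd_iff_even.2 hi.add_one)]
              push_cast; ring
            · refine absurd h ?_
              have := hi.add_odd hj
              exact Nat.not_even_iff_odd.2 this.add_one
          rw [hβ]
          ring
        · rw [hermInt_X_pow_odd hμ h]
          ring

/-- The monic generalized Hermite polynomials. -/
def hermPoly (μ : ℝ) : ℕ → ℝ[X]
  | 0 => 1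
  | k + 1 => X * hermPoly μ k - (1 / 2 : ℝ) • dunkl μ (hermPoly μ k)

theorem hermPoly_succ (k : ℕ) :
    hermPoly μ (k + 1) = X * hermPoly μ k - (1 / 2 : ℝ) • dunkl μ (hermPoly μ k) := rfl

theorem hermPoly_zero : hermPoly μ 0 = 1 := rfl

theorem dunkl_one : dunkl μ 1 = 0 := by
  rw [← monomial_zero_one, dunkl_monomial, hermCoeff_zero]; simp

theorem dunkl_comp_neg (f : ℝ[X]) : dunkl μ (f.comp (-X)) = -(dunkl μ f).comp (-X) := by
  have hc : ∀ (m : ℕ) (a : ℝ), (monomial m a).comp (-X) = ((-1 : ℝ) ^ m) • monomial m a := by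
    intro m a
    rw [← C_mul_X_pow_eq_monomial]
    simp only [mul_comp, C_comp, pow_comp, X_comp, smul_eq_C_mul]
    rw [neg_pow, C_pow, C_neg, C_1]
    ring
  induction f using Polynomial.induction_on' with
  | add p q hp hq => simp only [add_comp, map_add, hp, hq]; ring
  | monomial m a =>
    rw [hc, map_smul, dunkl_monomial, smul_comp, hc]
    rcases m with _ | m
    · simp [hermCoeff_zero]
    · rw [Nat.add_sub_cancel, pow_succ, smul_comm, ← smul_neg, ← neg_smul]
      ring_nf

theorem hermPoly_comp_neg (k : ℕ) : (hermPoly μ k).comp (-X) = ((-1 : ℝ) ^ k) • hermPoly μ k := by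
  induction k with
  | zero => simp [hermPoly]
  | succ k ih =>
    have h := dunkl_comp_neg (μ := μ) (hermPoly μ k)
    rw [ih, map_smul] at h
    have h' : (dunkl μ (hermPoly μ k)).comp (-X) = -((-1 : ℝ) ^ k • dunkl μ (hermPoly μ k)) := by
      rw [h, neg_neg]
    rw [hermPoly, sub_comp, mul_comp, X_comp, ih, smul_comp, h', pow_succ]
    simp only [smul_eq_C_mul, C_mul, C_neg, C_1]
    ring

/-- The polynomials are built by the raising operator `x - D / 2`, with `D` the Dunkl operator.
Commuting `D` past `x` leaves the identity and a reflection, on which `hermPoly` acts by its parity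
sign; this is exactly the increment in `hermCoeff_succ`. So `D` lowers the degree within the family.
-/
theorem dunkl_hermPoly (k : ℕ) :
    dunkl μ (hermPoly μ (k + 1)) = (2 * hermCoeff μ (k + 1)) • hermPoly μ k := by
  induction k with
  | zero =>
    rw [hermPoly_succ, hermPoly_zero, dunkl_one, smul_zero, sub_zero, mul_one, ← monomial_one_one_eq_X,
      dunkl_monomial]
    simp
  | succ k ih =>
    rw [hermPoly_succ (k + 1), map_sub, map_smul, dunkl_X_mul, hermPoly_comp_neg, ih, map_smul]
    have h : X * hermPoly μ k = hermPoly μ (k + 1) + (1 / 2 : ℝ) • dunkl μ (hermPoly μ k) := by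
      rw [hermPoly_succ]; ring
    rw [mul_smul_comm, h, hermCoeff_succ (k + 1)]
    module

theorem X_mul_hermPoly_zero : X * hermPoly μ 0 = hermPoly μ 1 := by
  simp [hermPoly, dunkl_one]

theorem X_mul_hermPoly_succ (k : ℕ) :
    X * hermPoly μ (k + 1) = hermPoly μ (k + 2) + hermCoeff μ (k + 1) • hermPoly μ k := by
  rw [hermPoly_succ (k + 1), dunkl_hermPoly, smul_smul]
  rw [show (1 / 2 : ℝ) * (2 * hermCoeff μ (k + 1)) = hermCoeff μ (k + 1) by ring]
  ring

theorem hermPoly_monic (k : ℕ) : (hermPoly μ k).Monic ∧ (hermPoly μ k).natDegree = k := by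
  induction k using Nat.strong_induction_on with
  | _ k ih =>
  rcases k with _ | _ | k
  · simp [hermPoly]
  · rw [← X_mul_hermPoly_zero]
    simp [hermPoly, monic_X]
  · obtain ⟨h1, d1⟩ := ih (k + 1) (by omega)
    obtain ⟨h0, d0⟩ := ih k (by omega)
    have e : hermPoly μ (k + 2) = X * hermPoly μ (k + 1) - hermCoeff μ (k + 1) • hermPoly μ k := by
      rw [X_mul_hermPoly_succ]; ring
    have hX : (X * hermPoly μ (k + 1)).Monic := monic_X.mul h1
    have hdX : (X * hermPoly μ (k + 1)).natDegree = k + 2 := by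
      rw [monic_X.natDegree_mul h1, natDegree_X, d1]; ring
    have hlt : (hermCoeff μ (k + 1) • hermPoly μ k).degree < (X * hermPoly μ (k + 1)).degree := by
      rw [degree_eq_natDegree hX.ne_zero, hdX]
      refine (degree_smul_le _ _).trans_lt ?_
      rw [degree_eq_natDegree h0.ne_zero, d0]
      exact_mod_cast (by omega : k < k + 2)
    rw [e]
    refine ⟨hX.sub_of_left hlt, ?_⟩
    rw [← hdX]
    exact natDegree_eq_of_degree_eq (degree_sub_eq_left_of_degree_lt hlt)

/-- The squared norms of the monic polynomials. -/
def hermNormSq (hμ : 0 ≤ μ) (k : ℕ) : ℝ := hermInt hμ (hermPoly μ k * hermPoly μ k)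

/-- The raising operator `x - D / 2` is the adjoint of `D / 2`. Moving it across lowers both indices
at once, which yields orthogonality and the norms. -/
theorem hermInt_hermPoly_succ_mul (hμ : 0 ≤ μ) (k : ℕ) (g : ℝ[X]) :
    hermInt hμ (hermPoly μ (k + 1) * g) = 1 / 2 * hermInt hμ (hermPoly μ k * dunkl μ g) := by
  have h := hermInt_dunkl hμ (hermPoly μ k) g
  rw [hermPoly, sub_mul, map_sub, smul_mul_assoc, map_smul, smul_eq_mul]
  linarith

theorem hermInt_hermPoly_succ_succ (hμ : 0 ≤ μ) (k l : ℕ) :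
    hermInt hμ (hermPoly μ (k + 1) * hermPoly μ (l + 1)) =
      hermCoeff μ (l + 1) * hermInt hμ (hermPoly μ k * hermPoly μ l) := by
  rw [hermInt_hermPoly_succ_mul, dunkl_hermPoly, mul_smul_comm, map_smul, smul_eq_mul]
  ring

theorem hermInt_hermPoly_mul_of_lt (hμ : 0 ≤ μ) {k l : ℕ} (h : l < k) :
    hermInt hμ (hermPoly μ k * hermPoly μ l) = 0 := by
  induction l generalizing k with
  | zero =>
    obtain ⟨k, rfl⟩ := Nat.exists_eq_succ_of_ne_zero h.ne'
    rw [Nat.succ_eq_add_one, hermInt_hermPoly_succ_mul]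
    simp [hermPoly, dunkl_one]
  | succ l ih =>
    obtain ⟨k, rfl⟩ := Nat.exists_eq_succ_of_ne_zero (by omega : k ≠ 0)
    rw [Nat.succ_eq_add_one, hermInt_hermPoly_succ_succ, ih (by omega), mul_zero]

theorem hermInt_hermPoly_mul_of_ne (hμ : 0 ≤ μ) {k l : ℕ} (h : k ≠ l) :
    hermInt hμ (hermPoly μ k * hermPoly μ l) = 0 := by
  rcases lt_or_gt_of_ne h with h | h
  · rw [mul_comm, hermInt_hermPoly_mul_of_lt hμ h]
  · exact hermInt_hermPoly_mul_of_lt hμ h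

theorem hermNormSq_succ (hμ : 0 ≤ μ) (k : ℕ) :
    hermNormSq hμ (k + 1) = hermCoeff μ (k + 1) * hermNormSq hμ k :=
  hermInt_hermPoly_succ_succ hμ k k

theorem hermNormSq_pos (hμ : 0 ≤ μ) (k : ℕ) : 0 < hermNormSq hμ k := by
  induction k with
  | zero =>
    have := hermInt_X_pow_even hμ (Even.zero : Even 0)
    simp only [hermNormSq, hermPoly, mul_one]
    rw [pow_zero] at this
    rw [this]
    exact Real.Gamma_pos_of_pos (by positivity)
  | succ k ih =>
    rw [hermNormSq_succ]
    exact mul_pos (hermCoeff_succ_pos hμ k) ih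

/-- The orthonormal generalized Hermite polynomials. -/
def hermOrth (hμ : 0 ≤ μ) (k : ℕ) : ℝ[X] := (√(hermNormSq hμ k))⁻¹ • hermPoly μ k

theorem hermInt_hermOrth (hμ : 0 ≤ μ) (k l : ℕ) :
    hermInt hμ (hermOrth hμ k * hermOrth hμ l) = if k = l then 1 else 0 := by
  rw [hermOrth, hermOrth, smul_mul_smul_comm, map_smul, smul_eq_mul]
  split_ifs with h
  · subst h
    have := hermNormSq_pos hμ k
    rw [← mul_inv, Real.mul_self_sqrt this.le]
    exact inv_mul_cancel₀ this.ne'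
  · rw [hermInt_hermPoly_mul_of_ne hμ h, mul_zero]

/-- The off-diagonal entries of multiplication by `x ^ 2`. -/
def hermHop (μ : ℝ) (k : ℕ) : ℝ := √(hermCoeff μ (k + 1) * hermCoeff μ (k + 2))

theorem hermHop_pos (hμ : 0 ≤ μ) (k : ℕ) : 0 < hermHop μ k :=
  Real.sqrt_pos.2 (mul_pos (hermCoeff_succ_pos hμ k) (hermCoeff_succ_pos hμ (k + 1)))

theorem hermHop_mul_self (hμ : 0 ≤ μ) (k : ℕ) :
    hermHop μ k * hermHop μ k = hermCoeff μ (k + 1) * hermCoeff μ (k + 2) :=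
  Real.mul_self_sqrt (mul_pos (hermCoeff_succ_pos hμ k) (hermCoeff_succ_pos hμ (k + 1))).le

theorem sqrt_hermNormSq_add_two (hμ : 0 ≤ μ) (k : ℕ) :
    √(hermNormSq hμ (k + 2)) = hermHop μ k * √(hermNormSq hμ k) := by
  rw [hermNormSq_succ, hermNormSq_succ, hermHop, ← Real.sqrt_mul (mul_pos (hermCoeff_succ_pos hμ k)
    (hermCoeff_succ_pos hμ (k + 1))).le]
  congr 1
  ring

theorem hermHop_smul (hμ : 0 ≤ μ) (k : ℕ) :
    hermHop μ k • hermOrth hμ (k + 2) = (√(hermNormSq hμ k))⁻¹ • hermPoly μ (k + 2) := by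
  rw [hermOrth, smul_smul, sqrt_hermNormSq_add_two, mul_inv, ← mul_assoc,
    mul_inv_cancel₀ (hermHop_pos hμ k).ne', one_mul]

theorem hermHop_smul' (hμ : 0 ≤ μ) (k : ℕ) :
    hermHop μ k • hermOrth hμ k = (√(hermNormSq hμ (k + 2)))⁻¹ •
      (hermCoeff μ (k + 1) * hermCoeff μ (k + 2)) • hermPoly μ k := by
  rw [hermOrth, smul_smul, smul_smul, sqrt_hermNormSq_add_two, ← hermHop_mul_self hμ]
  congr 1
  have h := (hermHop_pos hμ k).ne'
  have := (Real.sqrt_pos.2 (hermNormSq_pos hμ k)).ne'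
  field_simp

/-- Of two consecutive indices exactly one is odd, so the parity dependence cancels. This is the
diagonal entry of multiplication by `x ^ 2`, and the reason for working with `x ^ 2` rather than
`x`. -/
theorem hermCoeff_add_succ (k : ℕ) : hermCoeff μ (k + 1) + hermCoeff μ k = k + 1 / 2 + μ := by
  unfold hermCoeff
  rcases Nat.even_or_odd k with h | h
  · rw [if_pos h.add_one, if_neg (Nat.not_odd_iff_even.2 h)]
    push_cast; ring
  · rw [if_neg (Nat.not_odd_iff_even.2 h.add_one), if_pos h]
    push_cast; ring

theorem X_sq_mul_hermOrth_of_lt (hμ : 0 ≤ μ) {k : ℕ} (hk : k < 2) :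
    X ^ 2 * hermOrth hμ k = hermHop μ k • hermOrth hμ (k + 2) +
      ((k : ℝ) + 1 / 2 + μ) • hermOrth hμ k := by
  rw [hermHop_smul, hermOrth, mul_smul_comm, smul_comm _ (√(hermNormSq hμ k))⁻¹, ← smul_add,
    sq, mul_assoc, ← hermCoeff_add_succ]
  congr 1
  interval_cases k
  · rw [X_mul_hermPoly_zero, X_mul_hermPoly_succ, hermCoeff_zero, add_zero]
  · rw [X_mul_hermPoly_succ, mul_add, X_mul_hermPoly_succ, mul_smul_comm, X_mul_hermPoly_zero]
    simp only [zero_add]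
    module

/-- The three-term recurrence applied twice; the normalization makes the coupling of `k` and `k + 2`
symmetric. -/
theorem X_sq_mul_hermOrth (hμ : 0 ≤ μ) (k : ℕ) :
    X ^ 2 * hermOrth hμ (k + 2) = hermHop μ (k + 2) • hermOrth hμ (k + 4) +
      (((k + 2 : ℕ) : ℝ) + 1 / 2 + μ) • hermOrth hμ (k + 2) + hermHop μ k • hermOrth hμ k := by
  rw [hermHop_smul, hermHop_smul', hermOrth, mul_smul_comm,
    smul_comm _ (√(hermNormSq hμ (k + 2)))⁻¹, ← smul_add, ← smul_add,
    sq, mul_assoc, ← hermCoeff_add_succ]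
  congr 1
  rw [X_mul_hermPoly_succ, mul_add, X_mul_hermPoly_succ, mul_smul_comm, X_mul_hermPoly_succ]
  module

end GenHermite

/-! ### The mean density of the eigenvalues -/

section MeanDensity

open Polynomial

variable {n : ℕ} {μ : ℝ} (hμ : 0 ≤ μ)

/-- The determinant of the orthonormal polynomials at the points `y`. -/
def orthDet (y : Fin n → ℝ) : ℝ :=
  (Matrix.of fun i j : Fin n => (hermOrth hμ (i : ℕ)).eval (y j)).det

theorem continuous_orthDet : Continuous (orthDet (n := n) hμ) :=
  Continuous.matrix_det <| continuous_matrix fun i j =>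
    (hermOrth hμ (i : ℕ)).continuous.comp (continuous_apply j)

/-- Replacing powers by monic polynomials of the same degrees leaves the Vandermonde determinant
unchanged, and normalizing them extracts the norms row by row. -/
theorem vandProd_sq_eq (y : Fin n → ℝ) :
    vandProd y ^ 2 = (∏ i : Fin n, hermNormSq hμ i) * orthDet hμ y ^ 2 := by
  have h1 : vandProd y = (Matrix.of fun i j : Fin n => (hermPoly μ (i : ℕ)).eval (y j)).det := by
    rw [← Matrix.det_transpose, vandProd, ← Matrix.det_vandermonde,
      Matrix.det_eval_matrixOfPolynomials_eq_det_vandermonde y (fun i => hermPoly μ i)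
        (fun _ => (hermPoly_monic _).2) (fun _ => (hermPoly_monic _).1)]
    rfl
  have h2 : (Matrix.of fun i j : Fin n => (hermPoly μ (i : ℕ)).eval (y j)) =
      Matrix.of fun i j : Fin n => √(hermNormSq hμ i) *
        (Matrix.of fun i j : Fin n => (hermOrth hμ (i : ℕ)).eval (y j)) i j := by
    ext i j
    have := (Real.sqrt_pos.2 (hermNormSq_pos hμ i)).ne'
    simp [hermOrth, ← mul_assoc, mul_inv_cancel₀ this]
  rw [h1, h2, Matrix.det_mul_column, mul_pow, ← Finset.prod_pow]
  simp only [Real.sq_sqrt (hermNormSq_pos hμ _).le]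
  rfl

/-- The joint density of the eigenvalues, with total mass `n!`. -/
def orthDensity (y : Fin n → ℝ) : ℝ := orthDet hμ y ^ 2 * ∏ i, hermWeight μ (y i)

theorem orthDensity_nonneg (y : Fin n → ℝ) : 0 ≤ orthDensity hμ y :=
  mul_nonneg (sq_nonneg _) (Finset.prod_nonneg fun _ _ => hermWeight_nonneg _ _)

theorem measurable_orthDensity : Measurable (orthDensity (n := n) hμ) :=
  ((continuous_orthDet hμ).measurable.pow_const 2).mul
    (Finset.measurable_prod _ fun i _ => (measurable_hermWeight μ).comp (measurable_pi_apply i))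

theorem prod_rpow_mul_eigWeight (y : Fin n → ℝ) :
    (∏ i, |y i| ^ (2 * μ)) * eigWeight y =
      (∏ i : Fin n, hermNormSq hμ i) * orthDensity hμ y := by
  rw [eigWeight, vandProd_sq_eq hμ, orthDensity]
  simp only [hermWeight, Finset.prod_mul_distrib, ← Real.exp_sum, Finset.sum_neg_distrib]
  ring

theorem orthDensity_eq_sum (y : Fin n → ℝ) :
    orthDensity hμ y = ∑ σ : Equiv.Perm (Fin n), ∑ τ : Equiv.Perm (Fin n),
      ((Equiv.Perm.sign σ : ℤ) : ℝ) * ((Equiv.Perm.sign τ : ℤ) : ℝ) *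
        ∏ j, ((hermOrth hμ (σ j : ℕ) * hermOrth hμ (τ j : ℕ)).eval (y j) * hermWeight μ (y j)) := by
  rw [orthDensity, orthDet, Matrix.det_apply', sq, Finset.sum_mul_sum, Finset.sum_mul]
  refine Finset.sum_congr rfl fun σ _ => ?_
  rw [Finset.sum_mul]
  refine Finset.sum_congr rfl fun τ _ => ?_
  simp only [Matrix.of_apply, eval_mul, Finset.prod_mul_distrib]
  ring

theorem integrable_bdd_mul_hermWeight {μ : ℝ} (hμ : 0 ≤ μ) {f : ℝ → ℝ} (hf : Measurable f) (hb : ∀ x, ‖f x‖ ≤ 1)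
    (p : ℝ[X]) : Integrable fun x => f x * (p.eval x * hermWeight μ x) :=
  (integrable_eval_mul_hermWeight hμ p).bdd_mul hf.aestronglyMeasurable
    (Eventually.of_forall hb)

theorem prod_mul_orthDensity_eq_sum (f : Fin n → ℝ → ℝ) (y : Fin n → ℝ) :
    (∏ j, f j (y j)) * orthDensity hμ y =
      ∑ σ : Equiv.Perm (Fin n), ∑ τ : Equiv.Perm (Fin n),
        ((Equiv.Perm.sign σ : ℤ) : ℝ) * ((Equiv.Perm.sign τ : ℤ) : ℝ) *
          ∏ j, (f j (y j) * ((hermOrth hμ (σ j : ℕ) * hermOrth hμ (τ j : ℕ)).eval (y j) *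
            hermWeight μ (y j))) := by
  rw [orthDensity_eq_sum, Finset.mul_sum]
  refine Finset.sum_congr rfl fun σ _ => ?_
  rw [Finset.mul_sum]
  refine Finset.sum_congr rfl fun τ _ => ?_
  rw [Finset.prod_mul_distrib (f := fun j => f j (y j))]
  ring

theorem integrable_prod_mul_orthDensity {f : Fin n → ℝ → ℝ} (hf : ∀ j, Measurable (f j))
    (hb : ∀ j x, ‖f j x‖ ≤ 1) : Integrable fun y => (∏ j, f j (y j)) * orthDensity hμ y := by
  simp_rw [prod_mul_orthDensity_eq_sum]
  refine integrable_finsetSum _ fun σ _ => integrable_finsetSum _ fun τ _ => Integrable.const_mul ?_ _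
  exact Integrable.fintype_prod fun j => integrable_bdd_mul_hermWeight hμ (hf j) (hb j) _

/-- Andréief's identity for products of bounded functions. -/
theorem integral_prod_mul_orthDensity {f : Fin n → ℝ → ℝ} (hf : ∀ j, Measurable (f j))
    (hb : ∀ j x, ‖f j x‖ ≤ 1) :
    ∫ y, (∏ j, f j (y j)) * orthDensity hμ y =
      ∑ σ : Equiv.Perm (Fin n), ∑ τ : Equiv.Perm (Fin n),
        ((Equiv.Perm.sign σ : ℤ) : ℝ) * ((Equiv.Perm.sign τ : ℤ) : ℝ) *
          ∏ j, ∫ x, f j x * ((hermOrth hμ (σ j : ℕ) * hermOrth hμ (τ j : ℕ)).eval x *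
            hermWeight μ x) := by
  have hi : ∀ σ τ : Equiv.Perm (Fin n), Integrable fun y : Fin n → ℝ =>
      ((Equiv.Perm.sign σ : ℤ) : ℝ) * ((Equiv.Perm.sign τ : ℤ) : ℝ) *
          ∏ j, (f j (y j) * ((hermOrth hμ (σ j : ℕ) * hermOrth hμ (τ j : ℕ)).eval (y j) *
            hermWeight μ (y j))) := fun σ τ =>
    Integrable.const_mul (Integrable.fintype_prod fun j =>
      integrable_bdd_mul_hermWeight hμ (hf j) (hb j) _) _
  simp_rw [prod_mul_orthDensity_eq_sum]
  rw [integral_finsetSum _ fun σ _ => integrable_finsetSum _ fun τ _ => hi σ τ]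
  refine Finset.sum_congr rfl fun σ _ => ?_
  rw [integral_finsetSum _ fun τ _ => hi σ τ]
  refine Finset.sum_congr rfl fun τ _ => ?_
  rw [integral_const_mul, integral_fintype_prod_volume_eq_prod (fun (j : Fin n) (x : ℝ) =>
    f j x * ((hermOrth hμ (σ j : ℕ) * hermOrth hμ (τ j : ℕ)).eval x * hermWeight μ x))]

theorem integral_orthDensity : ∫ y : Fin n → ℝ, orthDensity hμ y = n.factorial := by
  have h := integral_prod_mul_orthDensity (n := n) hμ (f := fun _ _ => 1)
    (fun _ => measurable_const) (by simp)
  simp only [Finset.prod_const_one, one_mul, ← hermInt_apply hμ, hermInt_hermOrth] at h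
  rw [h]
  have : ∀ σ τ : Equiv.Perm (Fin n), ((Equiv.Perm.sign σ : ℤ) : ℝ) * ((Equiv.Perm.sign τ : ℤ) : ℝ) *
      ∏ j, (if (σ j : ℕ) = (τ j : ℕ) then (1 : ℝ) else 0) = if σ = τ then 1 else 0 := by
    intro σ τ
    split_ifs with hst
    · subst hst
      simp [← Int.cast_mul, ← Units.val_mul]
    · obtain ⟨j, hj⟩ := not_forall.1 (fun h => hst (Equiv.ext h))
      rw [Finset.prod_eq_zero (Finset.mem_univ j) (if_neg fun h => hj (Fin.ext h)), mul_zero]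
  simp only [this]
  simp [Fintype.card_perm]

/-- In Andréief's double sum, orthonormality in the variables other than `i` kills every pair of
permutations that differ somewhere off `i`, and two permutations agreeing off one point are equal.
-/
theorem integral_mul_orthDensity {f : ℝ → ℝ} (hf : Measurable f) (hb : ∀ x, ‖f x‖ ≤ 1)
    (i : Fin n) :
    ∫ y, f (y i) * orthDensity hμ y =
      ∑ σ : Equiv.Perm (Fin n), ∫ x, f x * ((hermOrth hμ (σ i : ℕ) * hermOrth hμ (σ i : ℕ)).eval x *
            hermWeight μ x) := by
  have hF : ∀ j, Measurable (fun x => if j = i then f x else 1) := by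
    intro j; split_ifs
    · exact hf
    · exact measurable_const
  have h := integral_prod_mul_orthDensity (n := n) hμ (f := fun j x => if j = i then f x else 1)
    hF (by intro j x; split_ifs; exacts [hb x, by simp])
  simp only [Finset.prod_ite_eq', Finset.mem_univ, if_true] at h
  rw [h]
  refine Finset.sum_congr rfl fun σ _ => ?_
  have hother : ∀ τ : Equiv.Perm (Fin n), ∀ j, j ≠ i →
      ∫ x, (if j = i then f x else 1) * ((hermOrth hμ (σ j : ℕ) * hermOrth hμ (τ j : ℕ)).eval x *
            hermWeight μ x) = if σ j = τ j then 1 else 0 := by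
    intro τ j hj
    simp only [hj, if_false, one_mul, ← hermInt_apply hμ, hermInt_hermOrth, Fin.ext_iff]
  rw [Finset.sum_eq_single σ]
  · rw [← Finset.mul_prod_erase _ _ (Finset.mem_univ i), Finset.prod_eq_one]
    · simp [← Int.cast_mul, ← Units.val_mul]
    · intro j hj
      rw [hother σ j (Finset.ne_of_mem_erase hj), if_pos rfl]
  · intro τ _ hτ
    obtain ⟨j, hji, hj⟩ : ∃ j, j ≠ i ∧ σ j ≠ τ j := by
      by_contra! hcon
      apply hτ
      refine Equiv.ext fun j => ?_
      by_cases hj : j = i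
      · subst hj
        by_contra hne
        -- Otherwise the point that `τ` sends to `σ j` would be a different one, at which `σ` and
        -- `τ` agree, contradicting injectivity of `σ`.
        have h1 : τ.symm (σ j) ≠ j := fun h => hne (by rw [← h, Equiv.apply_symm_apply, h])
        have h2 := hcon _ h1
        rw [Equiv.apply_symm_apply] at h2
        exact h1 (σ.injective h2)
      · exact (hcon j hj).symm
    rw [Finset.prod_eq_zero (Finset.mem_univ j), mul_zero]
    rw [hother τ j hji, if_neg hj]
  · simp

theorem sum_integral_mul_orthDensity {f : ℝ → ℝ} (hf : Measurable f) (hb : ∀ x, ‖f x‖ ≤ 1) :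
    ∑ i : Fin n, ∫ y, f (y i) * orthDensity hμ y =
      n.factorial * ∑ k : Fin n, ∫ x, f x * ((hermOrth hμ (k : ℕ) * hermOrth hμ (k : ℕ)).eval x *
            hermWeight μ x) := by
  simp_rw [integral_mul_orthDensity hμ hf hb]
  rw [Finset.sum_comm]
  simp_rw [fun σ : Equiv.Perm (Fin n) => Equiv.sum_comp σ fun k : Fin n =>
    ∫ x, f x * ((hermOrth hμ (k : ℕ) * hermOrth hμ (k : ℕ)).eval x * hermWeight μ x)]
  simp [Fintype.card_perm]

/-! ### The ensemble -/

theorem weight_eq (x : Herm n) :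
    weight n μ x = (∏ i, |eig x i| ^ (2 * μ)) * Real.exp (-‖x‖ ^ 2) := by
  rw [weight, norm_det_eq_prod_eig, Herm.norm_sq,
    Real.finsetProd_rpow _ _ (fun i _ => abs_nonneg _)]

theorem measurable_weight : Measurable (weight n μ) := by
  have : weight n μ = fun x => (∏ i, |eig x i| ^ (2 * μ)) * Real.exp (-‖x‖ ^ 2) :=
    funext weight_eq
  rw [this]
  refine Measurable.mul (Finset.measurable_prod _ fun i _ => ?_) (by fun_prop)
  exact (((measurable_pi_apply i).comp measurable_eig).abs).pow_const _

/-- The normalization constant of the ensemble, divided by `n!`. -/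
def ensembleConst (n : ℕ) {μ : ℝ} (hμ : 0 ≤ μ) : ℝ := weylConst n * ∏ i : Fin n, hermNormSq hμ i

theorem ensembleConst_pos : 0 < ensembleConst n hμ :=
  mul_pos weylConst_pos (Finset.prod_pos fun i _ => hermNormSq_pos hμ i)

/-- The determinant factor is `∏ |λᵢ| ^ (2 μ)`, a symmetric function of the eigenvalues, so it joins
`g` in the Weyl formula for the Gaussian ensemble. -/
theorem lintegral_symm_mul_weight {g : (Fin n → ℝ) → ℝ≥0∞} (hg : Measurable g)
    (hsymm : ∀ (σ : Equiv.Perm (Fin n)) y, g (y ∘ σ) = g y) :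
    ∫⁻ x, g (eig x) * ENNReal.ofReal (weight n μ x) =
      ENNReal.ofReal (ensembleConst n hμ) * ∫⁻ y, g y * ENNReal.ofReal (orthDensity hμ y) := by
  have hm : Measurable fun y : Fin n → ℝ => ENNReal.ofReal (∏ i, |y i| ^ (2 * μ)) := by
    refine (Finset.measurable_prod _ fun i _ => ?_).ennreal_ofReal
    exact (measurable_pi_apply i).abs.pow_const _
  have h := lintegral_eig_gue (n := n) (g := fun y => g y * ENNReal.ofReal (∏ i, |y i| ^ (2 * μ)))
    (hg.mul hm) (fun σ y => by
      rw [hsymm]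
      congr 2
      exact Equiv.prod_comp σ fun i => |y i| ^ (2 * μ))
  have hp : ∀ y : Fin n → ℝ, 0 ≤ ∏ i, |y i| ^ (2 * μ) := fun y =>
    Finset.prod_nonneg fun i _ => by positivity
  have hm1 : Measurable fun y : Fin n → ℝ => g y * ENNReal.ofReal (∏ i, |y i| ^ (2 * μ)) :=
    hg.mul hm
  have hm2 : Measurable fun x : Herm n =>
      g (eig x) * ENNReal.ofReal (∏ i, |eig x i| ^ (2 * μ)) := hm1.comp measurable_eig
  rw [gue, lintegral_withDensity_eq_lintegral_mul _ (by fun_prop) hm2, eigLaw,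
    lintegral_withDensity_eq_lintegral_mul _ continuous_eigWeight.measurable.ennreal_ofReal
      hm1] at h
  simp only [Pi.mul_apply] at h
  have hm3 : Measurable fun y : Fin n → ℝ => g y * ENNReal.ofReal (orthDensity hμ y) :=
    hg.mul (measurable_orthDensity hμ).ennreal_ofReal
  refine Eq.trans (lintegral_congr fun x => ?_) (h.trans ?_)
  · rw [weight_eq, ENNReal.ofReal_mul (hp _)]
    ring
  · rw [ensembleConst, ENNReal.ofReal_mul weylConst_pos.le, mul_assoc,
      ← lintegral_const_mul (ENNReal.ofReal (∏ i : Fin n, hermNormSq hμ i)) hm3]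
    congr 1
    refine lintegral_congr fun y => ?_
    have := prod_rpow_mul_eigWeight hμ y
    rw [mul_left_comm (ENNReal.ofReal (∏ i : Fin n, hermNormSq hμ i)),
      ← ENNReal.ofReal_mul (Finset.prod_nonneg fun (i : Fin n) _ => (hermNormSq_pos hμ i).le), ← this,
      ENNReal.ofReal_mul (hp _)]
    ring

theorem integrable_orthDensity : Integrable (orthDensity (n := n) hμ) := by
  have := integrable_prod_mul_orthDensity (n := n) hμ (f := fun _ _ => 1)
    (fun _ => measurable_const) (by simp)
  simpa using this

theorem lintegral_weight : ∫⁻ x, ENNReal.ofReal (weight n μ x) =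
    ENNReal.ofReal (ensembleConst n hμ * n.factorial) := by
  have h := lintegral_symm_mul_weight (n := n) hμ (g := fun _ => 1) measurable_const (fun _ _ => rfl)
  simp only [one_mul] at h
  rw [h, ← ofReal_integral_eq_lintegral_ofReal (integrable_orthDensity hμ)
    (Eventually.of_forall (orthDensity_nonneg hμ)), integral_orthDensity,
    ENNReal.ofReal_mul (ensembleConst_pos hμ).le]

theorem lintegral_weight_pos : 0 < ensembleConst n hμ * n.factorial :=
  mul_pos (ensembleConst_pos hμ) (by positivity)

theorem isProbabilityMeasure_ensemble (n : ℕ) {μ : ℝ} (hμ : 0 ≤ μ) :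
    IsProbabilityMeasure (ensemble n μ) := by
  refine ⟨?_⟩
  rw [ensemble, Measure.smul_apply, withDensity_apply _ MeasurableSet.univ, Measure.restrict_univ,
    lintegral_weight hμ, smul_eq_mul]
  refine ENNReal.inv_mul_cancel ?_ ENNReal.ofReal_ne_top
  exact (ENNReal.ofReal_pos.2 (lintegral_weight_pos hμ)).ne'

/-- The probability measure with density `φₖ ^ 2 w`, for the orthonormal polynomial `φₖ`. -/
def orthMeasure (k : ℕ) : Measure ℝ :=
  volume.withDensity fun x =>
    ENNReal.ofReal ((hermOrth hμ k * hermOrth hμ k).eval x * hermWeight μ x)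

theorem orth_density_nonneg (k : ℕ) (x : ℝ) :
    0 ≤ (hermOrth hμ k * hermOrth hμ k).eval x * hermWeight μ x := by
  rw [eval_mul]
  exact mul_nonneg (mul_self_nonneg _) (hermWeight_nonneg _ _)

theorem measurable_orth_density (k : ℕ) :
    Measurable fun x => (hermOrth hμ k * hermOrth hμ k).eval x * hermWeight μ x :=
  (hermOrth hμ k * hermOrth hμ k).continuous.measurable.mul (measurable_hermWeight μ)

instance (k : ℕ) : IsProbabilityMeasure (orthMeasure hμ k) := by
  refine ⟨?_⟩
  rw [orthMeasure, withDensity_apply _ MeasurableSet.univ, Measure.restrict_univ,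
    ← ofReal_integral_eq_lintegral_ofReal (integrable_eval_mul_hermWeight hμ _)
      (Eventually.of_forall (orth_density_nonneg hμ k)), ← hermInt_apply hμ, hermInt_hermOrth,
    if_pos rfl, ENNReal.ofReal_one]

theorem orthMeasure_apply (k : ℕ) {s : Set ℝ} (hs : MeasurableSet s) :
    orthMeasure hμ k s = ENNReal.ofReal (∫ x, s.indicator 1 x *
      ((hermOrth hμ k * hermOrth hμ k).eval x * hermWeight μ x)) := by
  rw [orthMeasure, withDensity_apply _ hs, ← ofReal_integral_eq_lintegral_ofReal
    (integrable_eval_mul_hermWeight hμ _).integrableOn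
      (Eventually.of_forall (orth_density_nonneg hμ k)), ← integral_indicator hs]
  congr 2 with x
  by_cases hx : x ∈ s <;> simp [hx]

/-- The mean eigenvalue distribution is the average of the measures `orthMeasure`. -/
theorem meanEigenvalueDist_eq :
    meanEigenvalueDist n μ = (n : ℝ≥0∞)⁻¹ • ∑ k : Fin n, orthMeasure hμ k := by
  rw [meanEigenvalueDist]
  congr 1
  ext s hs
  have hm : ∀ i : Fin n, Measurable fun x : Herm n => (Herm.isHermitian x).eigenvalues i := fun i =>
    (measurable_pi_apply i).comp measurable_eig
  have hf : Measurable (s.indicator (1 : ℝ → ℝ)) := measurable_one.indicator hs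
  have hb : ∀ x, ‖s.indicator (1 : ℝ → ℝ) x‖ ≤ 1 := by
    intro x; by_cases hx : x ∈ s <;> simp [hx]
  have hf0 : ∀ x, 0 ≤ s.indicator (1 : ℝ → ℝ) x := by
    intro x; by_cases hx : x ∈ s <;> simp [hx]
  have hZ : ENNReal.ofReal (ensembleConst n hμ * n.factorial) ≠ 0 :=
    (ENNReal.ofReal_pos.2 (lintegral_weight_pos hμ)).ne'
  -- The number of coordinates in `s`. The sum over `i` is symmetric, as the Weyl formula requires;
  -- a single summand is not.
  let g : (Fin n → ℝ) → ℝ≥0∞ := fun y => ∑ i, ENNReal.ofReal (s.indicator 1 (y i))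
  have hgm : Measurable g := Finset.measurable_sum _ fun i _ =>
    (hf.comp (measurable_pi_apply i)).ennreal_ofReal
  have hW := lintegral_symm_mul_weight (n := n) hμ (g := g) hgm
    (fun σ y => Equiv.sum_comp σ fun i => ENNReal.ofReal (s.indicator 1 (y i)))
  have hfint : ∀ i : Fin n, Integrable fun y : Fin n → ℝ =>
      s.indicator 1 (y i) * orthDensity hμ y := fun i =>
    (integrable_orthDensity hμ).bdd_mul (hf.comp (measurable_pi_apply i)).aestronglyMeasurable
      (Eventually.of_forall fun y => hb (y i))
  have hR : ∫⁻ y, g y * ENNReal.ofReal (orthDensity hμ y) =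
      ENNReal.ofReal (n.factorial) * ∑ k : Fin n, orthMeasure hμ k s := by
    simp only [g, Finset.sum_mul, ← ENNReal.ofReal_mul (hf0 _)]
    have hm3 : ∀ i : Fin n, Measurable fun y : Fin n → ℝ =>
        ENNReal.ofReal (s.indicator 1 (y i) * orthDensity hμ y) := fun i =>
      (Measurable.mul (hf.comp (measurable_pi_apply i)) (measurable_orthDensity hμ)).ennreal_ofReal
    rw [lintegral_finsetSum _ fun i _ => hm3 i]
    simp only [orthMeasure_apply hμ _ hs]
    have hk0 : ∀ k : Fin n, 0 ≤ ∫ x, s.indicator 1 x *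
        ((hermOrth hμ (k : ℕ) * hermOrth hμ (k : ℕ)).eval x * hermWeight μ x) := fun k =>
      integral_nonneg fun x => mul_nonneg (hf0 x) (orth_density_nonneg hμ k x)
    rw [← ENNReal.ofReal_sum_of_nonneg fun k _ => hk0 k, ← ENNReal.ofReal_mul (by positivity),
      ← sum_integral_mul_orthDensity hμ hf hb, ENNReal.ofReal_sum_of_nonneg fun k _ => integral_nonneg fun y =>
        mul_nonneg (hf0 _) (orthDensity_nonneg hμ y)]
    refine Finset.sum_congr rfl fun i _ => ?_
    exact (ofReal_integral_eq_lintegral_ofReal (hfint i) (Eventually.of_forall fun y =>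
      mul_nonneg (hf0 _) (orthDensity_nonneg hμ y))).symm
  have hL : ∑ i : Fin n, ((ensemble n μ).map fun x => (Herm.isHermitian x).eigenvalues i) s =
      (ENNReal.ofReal (ensembleConst n hμ * n.factorial))⁻¹ *
        ∫⁻ x, g (eig x) * ENNReal.ofReal (weight n μ x) := by
    simp only [g, Finset.sum_mul]
    have hm4 : ∀ i : Fin n, Measurable fun x : Herm n =>
        ENNReal.ofReal (s.indicator 1 (eig x i)) * ENNReal.ofReal (weight n μ x) := fun i =>
      Measurable.mul ((hf.comp ((measurable_pi_apply i).comp measurable_eig)).ennreal_ofReal)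
        measurable_weight.ennreal_ofReal
    rw [lintegral_finsetSum _ fun i _ => hm4 i, Finset.mul_sum]
    refine Finset.sum_congr rfl fun i _ => ?_
    rw [Measure.map_apply (hm i) hs, ensemble, Measure.smul_apply, lintegral_weight hμ, smul_eq_mul,
      withDensity_apply _ (hm i hs), ← lintegral_indicator (hm i hs)]
    congr 2 with x
    by_cases hx : (Herm.isHermitian x).eigenvalues i ∈ s
    · have hx' : eig x i ∈ s := hx
      simp [hx, hx']
    · have hx' : eig x i ∉ s := hx
      simp [hx, hx']
  rw [Measure.finsetSum_apply, Measure.finsetSum_apply, hL, hW, hR,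
    ← mul_assoc (ENNReal.ofReal (ensembleConst n hμ)),
    ← ENNReal.ofReal_mul (ensembleConst_pos hμ).le, ← mul_assoc,
    ENNReal.inv_mul_cancel hZ ENNReal.ofReal_ne_top, one_mul]

theorem isProbabilityMeasure_meanEigenvalueDist {μ : ℝ} (hμ : 0 ≤ μ) (hn : 1 ≤ n) :
    IsProbabilityMeasure (meanEigenvalueDist n μ) := by
  refine ⟨?_⟩
  rw [meanEigenvalueDist_eq hμ, Measure.smul_apply, Measure.finsetSum_apply]
  simp only [measure_univ, Finset.sum_const, Finset.card_univ, Fintype.card_fin, nsmul_eq_mul,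
    mul_one, smul_eq_mul]
  exact ENNReal.inv_mul_cancel (by exact_mod_cast (by omega : n ≠ 0)) (ENNReal.natCast_ne_top n)

end MeanDensity

/-! ### Asymptotics of the even moments -/

section Moments

open Polynomial

/-! ### Matrix entries of multiplication by even powers -/

section Entries

variable {μ : ℝ} (hμ : 0 ≤ μ)

/-- The matrix entries of multiplication by `x ^ (2 m)` in the orthonormal basis. -/
def momentEntry (m k l : ℕ) : ℝ := hermInt hμ (X ^ (2 * m) * hermOrth hμ k * hermOrth hμ l)

theorem momentEntry_zero (k l : ℕ) : momentEntry hμ 0 k l = if k = l then 1 else 0 := by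
  rw [momentEntry, mul_zero, pow_zero, one_mul, hermInt_hermOrth]

theorem momentEntry_succ_of_lt (m k : ℕ) {l : ℕ} (hl : l < 2) :
    momentEntry hμ (m + 1) k l = hermHop μ l * momentEntry hμ m k (l + 2) +
      ((l : ℝ) + 1 / 2 + μ) * momentEntry hμ m k l := by
  have : X ^ (2 * (m + 1)) * hermOrth hμ k * hermOrth hμ l =
      X ^ (2 * m) * hermOrth hμ k * (X ^ 2 * hermOrth hμ l) := by ring
  rw [momentEntry, this, X_sq_mul_hermOrth_of_lt hμ hl, mul_add, mul_smul_comm, mul_smul_comm,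
    map_add, map_smul, map_smul]
  rfl

theorem momentEntry_succ (m k l : ℕ) :
    momentEntry hμ (m + 1) k (l + 2) = hermHop μ (l + 2) * momentEntry hμ m k (l + 4) +
      (((l + 2 : ℕ) : ℝ) + 1 / 2 + μ) * momentEntry hμ m k (l + 2) +
      hermHop μ l * momentEntry hμ m k l := by
  have : X ^ (2 * (m + 1)) * hermOrth hμ k * hermOrth hμ (l + 2) =
      X ^ (2 * m) * hermOrth hμ k * (X ^ 2 * hermOrth hμ (l + 2)) := by ring
  rw [momentEntry, this, X_sq_mul_hermOrth hμ, mul_add, mul_add, mul_smul_comm, mul_smul_comm,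
    mul_smul_comm, map_add, map_add, map_smul, map_smul, map_smul]
  rfl

/-- Parity enters only through `r`, which is `2` or `1`. Its contribution `μ r / 2` is negligible
against `n ^ 2` when `μ / n` stays bounded. -/
theorem hermCoeff_mul_succ (l : ℕ) : ∃ r : ℝ, 0 ≤ r ∧ r ≤ 2 ∧
    hermCoeff μ (l + 1) * hermCoeff μ (l + 2) =
      (((l : ℝ) + 1) * (l + 2) + 2 * μ * (l + r)) / 4 := by
  rcases Nat.even_or_odd l with h | h
  · have h2 : Even (l + 2) := h.add_one.add_one
    refine ⟨2, by norm_num, le_rfl, ?_⟩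
    rw [hermCoeff, hermCoeff, if_pos h.add_one, if_neg (Nat.not_odd_iff_even.2 h2)]
    push_cast; ring
  · have h2 : Odd (l + 2) := h.add_one.add_one
    refine ⟨1, by norm_num, by norm_num, ?_⟩
    rw [hermCoeff, hermCoeff, if_neg (Nat.not_odd_iff_even.2 h.add_one), if_pos h2]
    push_cast; ring

theorem hermHop_le {μ : ℝ} (hμ : 0 ≤ μ) (l : ℕ) : hermHop μ l ≤ l + 2 + 2 * μ := by
  rw [hermHop, Real.sqrt_le_left (by positivity)]
  obtain ⟨r, h0, h2, h⟩ := hermCoeff_mul_succ (μ := μ) l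
  rw [h]
  have : 0 ≤ (l : ℝ) := Nat.cast_nonneg l
  nlinarith [mul_nonneg hμ this, mul_nonneg hμ h0, mul_nonneg hμ (sub_nonneg.2 h2)]

/-- Each factor `x ^ 2` contributes at most three terms and raises the index by at most two, so
every coefficient met along the way is at most `l + 2 m + 2 μ + 2`. -/
theorem abs_momentEntry_le (m k l : ℕ) :
    |momentEntry hμ m k l| ≤ (3 * (l + 2 * m + 2 * μ + 2)) ^ m := by
  induction m generalizing l with
  | zero =>
    rw [momentEntry_zero]
    split_ifs <;> simp
  | succ m ih =>
    have hl0 : 0 ≤ (l : ℝ) := Nat.cast_nonneg l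
    set B : ℝ := l + 2 * ((m + 1 : ℕ) : ℝ) + 2 * μ + 2 with hB
    have hm0 : 0 ≤ (m : ℝ) := Nat.cast_nonneg m
    have hB0 : 0 ≤ B := by positivity
    have ih' : ∀ l' : ℕ, l' ≤ l + 2 → |momentEntry hμ m k l'| ≤ (3 * B) ^ m := by
      intro l' hl'
      refine (ih l').trans (pow_le_pow_left₀ (by positivity) ?_ _)
      have : (l' : ℝ) ≤ l + 2 := by exact_mod_cast hl'
      rw [hB]
      push_cast
      linarith
    have hhop : ∀ l' : ℕ, l' ≤ l → |hermHop μ l'| ≤ B := by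
      intro l' hl'
      rw [abs_of_pos (hermHop_pos hμ l')]
      have : (l' : ℝ) ≤ l := by exact_mod_cast hl'
      refine (hermHop_le hμ l').trans ?_
      rw [hB]; push_cast; linarith
    have hd : |(l : ℝ) + 1 / 2 + μ| ≤ B := by
      rw [abs_of_nonneg (by positivity), hB]
      push_cast; linarith
    have hP0 : 0 ≤ (3 * B) ^ m := by positivity
    rcases lt_or_ge l 2 with hl | hl
    · rw [momentEntry_succ_of_lt hμ m k hl]
      calc _ ≤ |hermHop μ l| * |momentEntry hμ m k (l + 2)| +
            |(l : ℝ) + 1 / 2 + μ| * |momentEntry hμ m k l| := by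
              rw [← abs_mul, ← abs_mul]; exact abs_add_le _ _
        _ ≤ B * (3 * B) ^ m + B * (3 * B) ^ m := by
              gcongr
              exacts [hhop l le_rfl, ih' _ le_rfl, ih' _ (by omega)]
        _ ≤ _ := by rw [pow_succ]; nlinarith [mul_nonneg hB0 hP0]
    · obtain ⟨l, rfl⟩ := Nat.exists_eq_add_of_le' hl
      rw [momentEntry_succ hμ m k]
      calc _ ≤ |hermHop μ (l + 2)| * |momentEntry hμ m k (l + 4)| +
            |((l + 2 : ℕ) : ℝ) + 1 / 2 + μ| * |momentEntry hμ m k (l + 2)| +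
            |hermHop μ l| * |momentEntry hμ m k l| := by
              rw [← abs_mul, ← abs_mul, ← abs_mul]; exact abs_add_three _ _ _
        _ ≤ B * (3 * B) ^ m + B * (3 * B) ^ m + B * (3 * B) ^ m := by
              gcongr
              exacts [hhop _ le_rfl, ih' _ le_rfl, ih' _ (by omega), hhop _ (by omega),
                ih' _ (by omega)]
        _ = _ := by rw [pow_succ]; ring

end Entries

/-- The Fourier coefficients of `(d + e cos θ) ^ m`. -/
def arcsineCoeff (d e : ℝ) (m : ℕ) (j : ℤ) : ℝ :=
  1 / Real.pi * ∫ θ in (0 : ℝ)..Real.pi, (d + e * Real.cos θ) ^ m * Real.cos (j * θ)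

theorem arcsineCoeff_zero (d e : ℝ) (j : ℤ) : arcsineCoeff d e 0 j = if j = 0 then 1 else 0 := by
  rw [arcsineCoeff]
  simp only [pow_zero, one_mul]
  split_ifs with h
  · subst h
    simp [Real.pi_ne_zero]
  · have hj : (j : ℝ) ≠ 0 := by exact_mod_cast h
    rw [intervalIntegral.integral_comp_mul_left _ hj, integral_cos]
    simp [Real.sin_int_mul_pi]

/-- Multiplication by `d + e cos θ` acts on Fourier coefficients as a Toeplitz tridiagonal matrix:
the recursion of `momentEntry` with constant coefficients. -/
theorem arcsineCoeff_succ (d e : ℝ) (m : ℕ) (j : ℤ) :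
    arcsineCoeff d e (m + 1) j = e / 2 * arcsineCoeff d e m (j + 1) + d * arcsineCoeff d e m j +
      e / 2 * arcsineCoeff d e m (j - 1) := by
  simp only [arcsineCoeff]
  have hc : ∀ i : ℤ, IntervalIntegrable
      (fun θ => (d + e * Real.cos θ) ^ m * Real.cos (i * θ)) volume 0 Real.pi := fun i =>
    Continuous.intervalIntegrable (by fun_prop) _ _
  have h : ∫ θ in (0 : ℝ)..Real.pi, (d + e * Real.cos θ) ^ (m + 1) * Real.cos (j * θ) =
      ∫ θ in (0 : ℝ)..Real.pi,
        (e / 2 * ((d + e * Real.cos θ) ^ m * Real.cos ((j + 1 : ℤ) * θ)) +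
          d * ((d + e * Real.cos θ) ^ m * Real.cos (j * θ)) +
          e / 2 * ((d + e * Real.cos θ) ^ m * Real.cos ((j - 1 : ℤ) * θ))) := by
    congr 1 with θ
    have : Real.cos ((j + 1 : ℤ) * θ) + Real.cos ((j - 1 : ℤ) * θ) =
        2 * Real.cos θ * Real.cos (j * θ) := by
      push_cast
      rw [add_mul, sub_mul, one_mul, Real.cos_add, Real.cos_sub]
      ring
    rw [pow_succ]
    linear_combination (-(e / 2) * (d + e * Real.cos θ) ^ m) * this
  rw [h, intervalIntegral.integral_add (((hc _).const_mul _).add ((hc _).const_mul _))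
    ((hc _).const_mul _), intervalIntegral.integral_add ((hc _).const_mul _) ((hc _).const_mul _),
    intervalIntegral.integral_const_mul, intervalIntegral.integral_const_mul,
    intervalIntegral.integral_const_mul]
  ring

/-! ### Scaling limit of the entries and of their averages -/

section Limit

variable {μ : ℕ → ℝ} (hμ : ∀ n, 0 ≤ μ n) {c : ℝ}

theorem tendsto_hermHop {μ : ℕ → ℝ} {c τ : ℝ}
    (hlim : Tendsto (fun n : ℕ => μ n / (n : ℝ)) atTop (𝓝 c)) {l : ℕ → ℕ}
    (hl : Tendsto (fun n => (l n : ℝ) / n) atTop (𝓝 τ)) :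
    Tendsto (fun n => hermHop (μ n) (l n) / n) atTop (𝓝 (√(τ * (τ + 2 * c)) / 2)) := by
  choose r hr0 hr2 hr using fun n => hermCoeff_mul_succ (μ := μ n) (l n)
  have hinv : Tendsto (fun n : ℕ => 1 / (n : ℝ)) atTop (𝓝 0) := tendsto_one_div_atTop_nhds_zero_nat
  have hrn : Tendsto (fun n : ℕ => r n / (n : ℝ)) atTop (𝓝 0) := by
    refine squeeze_zero (fun n => div_nonneg (hr0 n) (Nat.cast_nonneg n))
      (fun n => div_le_div_of_nonneg_right (hr2 n) (Nat.cast_nonneg n))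
      (tendsto_const_div_atTop_nhds_zero_nat 2)
  have h1 : Tendsto (fun n : ℕ => ((l n : ℝ) / n + 1 / n) * ((l n : ℝ) / n + 2 * (1 / n)) +
      2 * (μ n / n) * ((l n : ℝ) / n + r n / n)) atTop
      (𝓝 ((τ + 0) * (τ + 2 * 0) + 2 * c * (τ + 0))) :=
    ((hl.add hinv).mul (hl.add (hinv.const_mul 2))).add
      ((hlim.const_mul 2).mul (hl.add hrn))
  have h2 := (h1.sqrt).div_const 2
  have e : (τ + 0) * (τ + 2 * 0) + 2 * c * (τ + 0) = τ * (τ + 2 * c) := by ring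
  rw [e] at h2
  refine h2.congr' ?_
  filter_upwards [eventually_gt_atTop 0] with n hn
  have hn' : (0 : ℝ) < n := by exact_mod_cast hn
  rw [hermHop, hr, div_eq_div_iff (by norm_num) hn'.ne', ← Real.sqrt_sq hn'.le,
    ← Real.sqrt_sq (by norm_num : (0 : ℝ) ≤ 2), ← Real.sqrt_mul', ← Real.sqrt_mul']
  · congr 1
    rw [Real.sqrt_sq hn'.le]
    field_simp
    ring
  · positivity
  · positivity

/-- Near the diagonal position `k n`, the recursion coefficients divided by `n` converge to
constants, and the recursion in `m` becomes `arcsineCoeff_succ`. The integer `j` is half the offset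
from the diagonal; the induction must treat all offsets together. -/
theorem tendsto_momentEntry (hlim : Tendsto (fun n : ℕ => μ n / (n : ℝ)) atTop (𝓝 c)) {τ : ℝ}
    (hτ : 0 < τ) {k : ℕ → ℕ} (hk : Tendsto (fun n => (k n : ℝ) / n) atTop (𝓝 τ)) (m : ℕ) (j : ℤ)
    (l : ℕ → ℕ) (hl : ∀ᶠ n in atTop, (l n : ℤ) = k n + 2 * j) :
    Tendsto (fun n => momentEntry (hμ n) m (k n) (l n) / (n : ℝ) ^ m) atTop
      (𝓝 (arcsineCoeff (τ + c) (√(τ * (τ + 2 * c))) m j)) := by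
  induction m generalizing j l with
  | zero =>
    rw [arcsineCoeff_zero]
    refine tendsto_const_nhds.congr' ?_
    filter_upwards [hl] with n hn
    rw [momentEntry_zero, pow_zero, div_one]
    exact if_congr (by omega) rfl rfl
  | succ m ih =>
    have hinv : Tendsto (fun n : ℕ => 1 / (n : ℝ)) atTop (𝓝 0) :=
      tendsto_one_div_atTop_nhds_zero_nat
    have hshift : ∀ (l : ℕ → ℕ) (j : ℤ), (∀ᶠ n in atTop, (l n : ℤ) = k n + 2 * j) →
        Tendsto (fun n => (l n : ℝ) / n) atTop (𝓝 τ) := by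
      intro l j hl
      have : Tendsto (fun n : ℕ => (k n : ℝ) / n + 2 * j * (1 / n)) atTop (𝓝 (τ + 2 * j * 0)) :=
        hk.add (hinv.const_mul _)
      rw [mul_zero, add_zero] at this
      refine this.congr' ?_
      filter_upwards [hl] with n hn
      have : (l n : ℝ) = k n + 2 * j := by exact_mod_cast hn
      rw [this]; ring
    have hlτ := hshift l j hl
    -- As `τ > 0`, the index eventually leaves the boundary rows `0` and `1`, where the lowering
    -- term is missing.
    have hl2 : ∀ᶠ n in atTop, 2 ≤ l n := by
      have h1 := hlτ.eventually_const_lt (half_lt_self hτ)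
      have h2 := (tendsto_natCast_atTop_atTop (R := ℝ)).eventually_ge_atTop (4 / τ)
      filter_upwards [h1, h2, eventually_gt_atTop 0] with n h1 h2 hn
      have hn' : (0 : ℝ) < n := by exact_mod_cast hn
      rw [lt_div_iff₀ hn'] at h1
      rw [div_le_iff₀ hτ] at h2
      have : (2 : ℝ) ≤ l n := by nlinarith
      exact_mod_cast this
    have hup : ∀ᶠ n in atTop, ((l n + 2 : ℕ) : ℤ) = k n + 2 * (j + 1) := by
      filter_upwards [hl] with n hn; push_cast; omega
    have hdown : ∀ᶠ n in atTop, ((l n - 2 : ℕ) : ℤ) = k n + 2 * (j - 1) := by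
      filter_upwards [hl, hl2] with n hn h2; omega
    have t1 := ih (j + 1) (fun n => l n + 2) hup
    have t2 := ih j l hl
    have t3 := ih (j - 1) (fun n => l n - 2) hdown
    have hd : Tendsto (fun n => ((l n : ℝ) + 1 / 2 + μ n) / n) atTop (𝓝 (τ + c)) := by
      have : Tendsto (fun n : ℕ => (l n : ℝ) / n + 1 / 2 * (1 / n) + μ n / n) atTop
          (𝓝 (τ + 1 / 2 * 0 + c)) := (hlτ.add (hinv.const_mul _)).add hlim
      rw [mul_zero, add_zero] at this
      exact this.congr fun n => by ring
    have h := (((tendsto_hermHop hlim hlτ).mul t1).add (hd.mul t2)).add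
      ((tendsto_hermHop hlim (hshift _ _ hdown)).mul t3)
    rw [arcsineCoeff_succ]
    refine h.congr' ?_
    filter_upwards [hl2, eventually_gt_atTop 0] with n h2 hn
    have hn' : (n : ℝ) ≠ 0 := by exact_mod_cast hn.ne'
    obtain ⟨p, hp⟩ := Nat.exists_eq_add_of_le' h2
    rw [hp, momentEntry_succ, Nat.add_sub_cancel]
    field_simp
    ring

theorem integral_floor_mul {n : ℕ} (hn : 0 < n) (f : ℕ → ℝ) :
    ∫ t in (0 : ℝ)..1, f ⌊(n : ℝ) * t⌋₊ = 1 / (n : ℝ) * ∑ k ∈ Finset.range n, f k := by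
  have hn' : (n : ℝ) ≠ 0 := by exact_mod_cast hn.ne'
  rw [intervalIntegral.integral_comp_mul_left (fun x => f ⌊x⌋₊) hn', mul_zero, mul_one,
    smul_eq_mul, one_div]
  congr 1
  have hE : ∀ k : ℕ, Set.EqOn (fun _ => f k) (fun x : ℝ => f ⌊x⌋₊) (Set.Ioo (k : ℝ) (k + 1 : ℕ)) := by
    intro k x hx
    have : ⌊x⌋₊ = k := by
      rw [Nat.floor_eq_iff ((Nat.cast_nonneg k).trans hx.1.le)]
      exact ⟨hx.1.le, by simpa using hx.2⟩
    simp only [this]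
  have hle : ∀ k : ℕ, (k : ℝ) ≤ (k + 1 : ℕ) := fun k => by simp
  have hfint : ∀ k : ℕ, IntervalIntegrable (fun x : ℝ => f ⌊x⌋₊) volume (k : ℝ) (k + 1 : ℕ) := by
    intro k
    rw [intervalIntegrable_iff_integrableOn_Ioo_of_le (hle k)]
    exact (integrableOn_const (by simp)).congr_fun (hE k) measurableSet_Ioo
  have := intervalIntegral.sum_integral_adjacent_intervals (n := n)
    (a := fun k : ℕ => (k : ℝ)) (f := fun x : ℝ => f ⌊x⌋₊) (μ := volume) fun k _ => hfint k
  rw [Nat.cast_zero] at this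
  rw [← this]
  refine Finset.sum_congr rfl fun k _ => ?_
  rw [intervalIntegral.integral_of_le (hle k), integral_Ioc_eq_integral_Ioo,
    ← setIntegral_congr_fun measurableSet_Ioo (hE k)]
  simp

/-- The limits of the even moments of the rescaled mean eigenvalue distribution. -/
def limitMoment (c : ℝ) (m : ℕ) : ℝ :=
  ∫ τ in (0 : ℝ)..1, arcsineCoeff (τ + c) (√(τ * (τ + 2 * c))) m 0

theorem tendsto_average_momentEntry
    (hlim : Tendsto (fun n : ℕ => μ n / (n : ℝ)) atTop (𝓝 c)) (m : ℕ) :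
    Tendsto (fun n : ℕ => 1 / (n : ℝ) *
      ∑ k ∈ Finset.range n, momentEntry (hμ n) m k k / (n : ℝ) ^ m) atTop (𝓝 (limitMoment c m)) := by
  have h : Tendsto (fun n : ℕ => ∫ t in (0 : ℝ)..1,
      momentEntry (hμ n) m ⌊(n : ℝ) * t⌋₊ ⌊(n : ℝ) * t⌋₊ / (n : ℝ) ^ m) atTop
      (𝓝 (limitMoment c m)) := by
    -- The average over `k` is an integral in `t` with `k = ⌊n t⌋`. The dominating constant comes
    -- from `abs_momentEntry_le` with `k ≤ n`, eventually `μ n < (c + 1) n`, and `1 ≤ n` for the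
    -- terms free of `n`.
    refine intervalIntegral.tendsto_integral_filter_of_dominated_convergence
      (fun _ => (3 * (1 + 2 * m + 2 * (c + 1) + 2)) ^ m) ?_ ?_ ?_ ?_
    · refine Eventually.of_forall fun n => Measurable.aestronglyMeasurable ?_
      exact (measurable_from_nat (f := fun k => momentEntry (hμ n) m k k / (n : ℝ) ^ m)).comp
        (Nat.measurable_floor.comp (measurable_const.mul measurable_id))
    · filter_upwards [eventually_gt_atTop 0, hlim.eventually_lt_const (lt_add_one c)] with n hn hc
      refine Eventually.of_forall fun t ht => ?_
      rw [Set.uIoc_of_le zero_le_one] at ht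
      have hn' : (0 : ℝ) < n := by exact_mod_cast hn
      have hn1 : (1 : ℝ) ≤ n := by exact_mod_cast hn
      rw [div_lt_iff₀ hn'] at hc
      rw [Real.norm_eq_abs, abs_div, abs_of_pos (pow_pos hn' m), div_le_iff₀ (pow_pos hn' m),
        ← mul_pow]
      refine (abs_momentEntry_le (hμ n) m _ _).trans (pow_le_pow_left₀ ?_ ?_ m)
      · have := hμ n
        positivity
      · have hfl : ((⌊(n : ℝ) * t⌋₊ : ℕ) : ℝ) ≤ n :=
          (Nat.floor_le (mul_nonneg hn'.le ht.1.le)).trans (by nlinarith [ht.2])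
        have hm0 : 0 ≤ (m : ℝ) := Nat.cast_nonneg m
        nlinarith [mul_nonneg hm0 (sub_nonneg.2 hn1)]
    · simp
    · refine Eventually.of_forall fun t ht => ?_
      rw [Set.uIoc_of_le zero_le_one] at ht
      refine tendsto_momentEntry hμ hlim ht.1 ?_ m 0 _ (by simp)
      have := (tendsto_nat_floor_mul_div_atTop (R := ℝ) ht.1.le).comp tendsto_natCast_atTop_atTop
      refine this.congr fun n => ?_
      simp [mul_comm]
  refine h.congr' ?_
  filter_upwards [eventually_gt_atTop 0] with n hn
  exact integral_floor_mul hn fun k => momentEntry (hμ n) m k k / (n : ℝ) ^ m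

end Limit

end Moments

/-! ### The limit measure as a mixture of arcsine laws -/

/-- The radicand is linear in `τ` with root `τ₀`, and above `τ₀` the integrand is the derivative of
its square root. Below `τ₀` the conventions for square roots of negative numbers and division by
zero make the integrand vanish; if `τ₀ > 1` the right side is zero for the same reason. -/
theorem lintegral_div_sqrt_linear {s : ℝ} (c : ℝ) (hs : 0 < s) :
    ∫⁻ τ in Set.Ioo (0 : ℝ) 1, ENNReal.ofReal (s / √(2 * τ * s - (s - c) ^ 2)) =
      ENNReal.ofReal √(2 * s - (s - c) ^ 2) := by
  set τ₀ : ℝ := (s - c) ^ 2 / (2 * s) with hτ₀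
  have h0 : 0 ≤ τ₀ := by positivity
  have hQ : ∀ τ, 2 * τ * s - (s - c) ^ 2 = 2 * s * (τ - τ₀) := fun τ => by
    rw [hτ₀]; field_simp
  have hQ1 : 2 * s - (s - c) ^ 2 = 2 * s * (1 - τ₀) := by rw [← hQ]; ring
  simp only [hQ, hQ1]
  have hzero : ∀ τ, τ ≤ τ₀ → s / √(2 * s * (τ - τ₀)) = 0 := fun τ hτ => by
    rw [Real.sqrt_eq_zero_of_nonpos, div_zero]
    exact mul_nonpos_of_nonneg_of_nonpos (by positivity) (by linarith)
  rcases le_or_gt 1 τ₀ with h1 | h1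
  · rw [Real.sqrt_eq_zero_of_nonpos (mul_nonpos_of_nonneg_of_nonpos (by positivity)
      (by linarith)), ENNReal.ofReal_zero]
    rw [setLIntegral_congr_fun (g := fun _ => 0) measurableSet_Ioo, lintegral_zero]
    intro τ hτ
    simp only
    rw [hzero τ (by linarith [hτ.2]), ENNReal.ofReal_zero]
  · have hres : ∫⁻ τ in Set.Ioo (0 : ℝ) 1, ENNReal.ofReal (s / √(2 * s * (τ - τ₀))) =
        ∫⁻ τ in Set.Ioo τ₀ 1, ENNReal.ofReal (s / √(2 * s * (τ - τ₀))) := by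
      rw [← lintegral_indicator measurableSet_Ioo, ← lintegral_indicator measurableSet_Ioo]
      congr 1
      funext τ
      by_cases h : τ₀ < τ
      · have : τ ∈ Set.Ioo (0 : ℝ) 1 ↔ τ ∈ Set.Ioo τ₀ 1 := by
          simp only [Set.mem_Ioo]
          constructor
          · exact fun h' => ⟨h, h'.2⟩
          · exact fun h' => ⟨by linarith, h'.2⟩
        by_cases h2 : τ ∈ Set.Ioo (0 : ℝ) 1
        · rw [Set.indicator_of_mem h2, Set.indicator_of_mem (this.1 h2)]
        · rw [Set.indicator_of_notMem h2, Set.indicator_of_notMem (fun h3 => h2 (this.2 h3))]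
      · have hz := hzero τ (not_lt.1 h)
        simp [Set.indicator_apply, hz]
    rw [hres]
    have hcont : ContinuousOn (fun τ : ℝ => √(2 * s * (τ - τ₀))) (Set.Icc τ₀ 1) := by fun_prop
    have hder : ∀ τ ∈ Set.Ioo τ₀ 1,
        HasDerivAt (fun τ : ℝ => √(2 * s * (τ - τ₀))) (s / √(2 * s * (τ - τ₀))) τ := by
      intro τ hτ
      have hpos : 0 < 2 * s * (τ - τ₀) := mul_pos (by positivity) (by linarith [hτ.1])
      have h := (((hasDerivAt_id τ).sub_const τ₀).const_mul (2 * s)).sqrt hpos.ne'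
      refine h.congr_deriv ?_
      simp only [id_eq, mul_one]
      rw [mul_div_mul_left _ _ two_ne_zero]
    have hnn : ∀ τ ∈ Set.Ioo τ₀ 1, 0 ≤ s / √(2 * s * (τ - τ₀)) := fun τ _ => by positivity
    have hfint := intervalIntegral.integrableOn_deriv_of_nonneg hcont hder hnn
    have hI := intervalIntegral.integral_eq_sub_of_hasDerivAt_of_le h1.le hcont hder
      ((intervalIntegrable_iff_integrableOn_Ioc_of_le h1.le).2 hfint)
    rw [← ofReal_integral_eq_lintegral_ofReal
      ((integrableOn_Ioc_iff_integrableOn_Ioo).1 hfint)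
      (Eventually.of_forall fun τ => by positivity), ← integral_Ioc_eq_integral_Ioo,
      ← intervalIntegral.integral_of_le h1.le, hI]
    simp

theorem lintegral_even {g : ℝ → ℝ≥0∞} (hg : ∀ t, g (-t) = g t) :
    ∫⁻ t, g t = 2 * ∫⁻ t in Set.Ioi 0, g t := by
  rw [← lintegral_add_compl g (measurableSet_Ioi (a := (0 : ℝ))), two_mul, Set.compl_Ioi]
  congr 1
  rw [setLIntegral_congr (Iio_ae_eq_Iic (a := (0 : ℝ))).symm]
  have h := (Measure.measurePreserving_neg (volume : Measure ℝ)).setLIntegral_comp_preimage_emb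
    (MeasurableEquiv.neg ℝ).measurableEmbedding g (Set.Iio 0)
  rw [← h]
  simp only [hg]
  congr 2
  ext t
  simp

/-- Substitute `t = √(τ + c + e cos θ)` on the positive half-line. The radicand becomes `(e sin θ) ^
2`, which cancels the Jacobian up to a factor `1 / 2`, and the two signs of `t` supply the missing
factor `2`. -/
theorem lintegral_arcsine_sq {c τ : ℝ} (hc : 0 ≤ c) (hτ : 0 < τ) (f : ℝ → ℝ≥0∞) :
    ∫⁻ t : ℝ, f (t ^ 2) * ENNReal.ofReal (|t| / √(2 * τ * t ^ 2 - (t ^ 2 - c) ^ 2)) =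
      ∫⁻ θ in Set.Ioo 0 Real.pi, f (τ + c + √(τ * (τ + 2 * c)) * Real.cos θ) := by
  set e : ℝ := √(τ * (τ + 2 * c)) with he
  have hepos : 0 < e := Real.sqrt_pos.2 (by positivity)
  have hesq : e ^ 2 = τ * (τ + 2 * c) := Real.sq_sqrt (by positivity)
  have hele : e ≤ τ + c := by
    apply Real.sqrt_le_iff.2 ⟨by positivity, by nlinarith⟩
  have hQ : ∀ s : ℝ, 2 * τ * s - (s - c) ^ 2 = e ^ 2 - (s - (τ + c)) ^ 2 := fun s => by
    rw [hesq]; ring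
  rw [lintegral_even (fun t => by simp)]
  simp only [hQ]
  set g : ℝ → ℝ := fun θ => √(τ + c + e * Real.cos θ) with hg
  have hpos : ∀ θ ∈ Set.Ioo 0 Real.pi, 0 < τ + c + e * Real.cos θ := by
    intro θ hθ
    have h1 : -1 < Real.cos θ := by
      rw [← Real.cos_pi]
      exact Real.cos_lt_cos_of_nonneg_of_le_pi hθ.1.le le_rfl hθ.2
    nlinarith
  have hsq : ∀ θ ∈ Set.Ioo 0 Real.pi, g θ ^ 2 = τ + c + e * Real.cos θ := fun θ hθ =>
    Real.sq_sqrt (hpos θ hθ).le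
  have hgpos : ∀ θ ∈ Set.Ioo 0 Real.pi, 0 < g θ := fun θ hθ => Real.sqrt_pos.2 (hpos θ hθ)
  have hder : ∀ θ ∈ Set.Ioo 0 Real.pi,
      HasDerivWithinAt g (e * -Real.sin θ / (2 * g θ)) (Set.Ioo 0 Real.pi) θ := fun θ hθ =>
    ((((Real.hasDerivAt_cos θ).const_mul e).const_add (τ + c)).sqrt
      (hpos θ hθ).ne').hasDerivWithinAt
  have hinj : Set.InjOn g (Set.Ioo 0 Real.pi) := by
    intro x hx y hy hxy
    have h1 := hsq x hx
    rw [hxy, hsq y hy] at h1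
    have h2 : Real.cos x = Real.cos y := by
      have := mul_left_cancel₀ hepos.ne' (add_left_cancel h1)
      exact this.symm
    exact Real.injOn_cos ⟨hx.1.le, hx.2.le⟩ ⟨hy.1.le, hy.2.le⟩ h2
  set T : Set ℝ := g '' Set.Ioo 0 Real.pi with hT
  have hTmeas : MeasurableSet T :=
    (measurableSet_Ioo.image_of_continuousOn_injOn (by fun_prop) hinj)
  -- Off the image of the substitution the radicand is not positive, so the integrand is zero there
  -- by convention.
  have hTmem : ∀ t : ℝ, 0 < t → 0 < e ^ 2 - (t ^ 2 - (τ + c)) ^ 2 → t ∈ T := by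
    intro t ht hq
    have habs : |t ^ 2 - (τ + c)| < e := abs_lt_of_sq_lt_sq (by linarith) hepos.le
    rw [abs_lt] at habs
    have hl : -1 < (t ^ 2 - (τ + c)) / e := by rw [lt_div_iff₀ hepos]; linarith
    have hr : (t ^ 2 - (τ + c)) / e < 1 := by rw [div_lt_iff₀ hepos]; linarith
    refine ⟨Real.arccos ((t ^ 2 - (τ + c)) / e), ⟨Real.arccos_pos.2 hr, ?_⟩, ?_⟩
    · refine lt_of_le_of_ne (Real.arccos_le_pi _) fun h => ?_
      rw [Real.arccos_eq_pi] at h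
      linarith
    · simp only [hg]
      rw [Real.cos_arccos hl.le hr.le, mul_div_cancel₀ _ hepos.ne', add_sub_cancel,
        Real.sqrt_sq ht.le]
  have hTsub : T ⊆ Set.Ioi 0 := by
    rintro _ ⟨θ, hθ, rfl⟩
    exact hgpos θ hθ
  have hres : ∫⁻ t in Set.Ioi 0, f (t ^ 2) *
      ENNReal.ofReal (|t| / √(e ^ 2 - (t ^ 2 - (τ + c)) ^ 2)) =
      ∫⁻ t in T, f (t ^ 2) * ENNReal.ofReal (|t| / √(e ^ 2 - (t ^ 2 - (τ + c)) ^ 2)) := by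
    rw [← lintegral_indicator measurableSet_Ioi, ← lintegral_indicator hTmeas]
    congr 1
    funext t
    by_cases ht : t ∈ T
    · rw [Set.indicator_of_mem ht, Set.indicator_of_mem (hTsub ht)]
    · rw [Set.indicator_of_notMem ht]
      by_cases h0 : t ∈ Set.Ioi (0 : ℝ)
      · rw [Set.indicator_of_mem h0, Real.sqrt_eq_zero_of_nonpos
          (not_lt.1 fun h => ht (hTmem t h0 h)), div_zero, ENNReal.ofReal_zero, mul_zero]
      · rw [Set.indicator_of_notMem h0]
  rw [hres, lintegral_image_eq_lintegral_abs_deriv_mul measurableSet_Ioo hder hinj]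
  rw [← lintegral_const_mul' _ _ ENNReal.ofNat_ne_top]
  refine setLIntegral_congr_fun measurableSet_Ioo fun θ hθ => ?_
  have hsin : 0 < Real.sin θ := Real.sin_pos_of_pos_of_lt_pi hθ.1 hθ.2
  have hg0 := hgpos θ hθ
  rw [hsq θ hθ]
  have h1 : e ^ 2 - (τ + c + e * Real.cos θ - (τ + c)) ^ 2 = (e * Real.sin θ) ^ 2 := by
    rw [mul_pow, Real.sin_sq]; ring
  have h2 : |e * -Real.sin θ / (2 * g θ)| = e * Real.sin θ / (2 * g θ) := by
    rw [mul_neg, neg_div, abs_neg, abs_of_pos (by positivity)]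
  rw [h1, Real.sqrt_sq (by positivity), h2, abs_of_pos hg0]
  rw [mul_left_comm (ENNReal.ofReal _) (f _), mul_left_comm 2 (f _),
    ← ENNReal.ofReal_mul (by positivity)]
  have h3 : e * Real.sin θ / (2 * g θ) * (g θ / (e * Real.sin θ)) = 1 / 2 := by
    field_simp
  rw [h3]
  have h4 : (2 : ℝ≥0∞) * ENNReal.ofReal (1 / 2) = 1 := by
    rw [← ENNReal.ofReal_ofNat 2, ← ENNReal.ofReal_mul (by norm_num)]; norm_num
  rw [h4, mul_one]

section LimitMeasure

variable {c : ℝ}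

theorem endA_sq (hc : 0 ≤ c) : endA c ^ 2 = 1 + c - √(1 + 2 * c) := by
  apply Real.sq_sqrt
  rw [sub_nonneg, Real.sqrt_le_iff]
  exact ⟨by positivity, by nlinarith⟩

theorem endB_sq (hc : 0 ≤ c) : endB c ^ 2 = 1 + c + √(1 + 2 * c) :=
  Real.sq_sqrt (by positivity)

/-- The squares of the endpoints are the two roots of `2 s - (s - c) ^ 2` in `s = t ^ 2`. -/
theorem limitDensity_radicand (hc : 0 ≤ c) (t : ℝ) :
    (t ^ 2 - endA c ^ 2) * (endB c ^ 2 - t ^ 2) = 2 * t ^ 2 - (t ^ 2 - c) ^ 2 := by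
  rw [endA_sq hc, endB_sq hc]
  have h : √(1 + 2 * c) ^ 2 = 1 + 2 * c := Real.sq_sqrt (by positivity)
  linear_combination h

theorem limitDensity_nonneg (c t : ℝ) : 0 ≤ limitDensity c t := by
  unfold limitDensity
  have := Real.pi_pos
  positivity

theorem measurable_limitDensity (c : ℝ) : Measurable (limitDensity c) := by
  unfold limitDensity
  fun_prop

theorem measurableSet_limitSupport (c : ℝ) : MeasurableSet (limitSupport c) :=
  measurableSet_Icc.union measurableSet_Icc

theorem limitDensity_eq_zero_of_notMem {t : ℝ} (ht : t ∉ limitSupport c) :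
    limitDensity c t = 0 := by
  have hA : 0 ≤ endA c := Real.sqrt_nonneg _
  have hB : 0 ≤ endB c := Real.sqrt_nonneg _
  unfold limitDensity
  rw [Real.sqrt_eq_zero_of_nonpos, mul_zero]
  have h : |t| < endA c ∨ endB c < |t| := by
    by_contra! h
    apply ht
    rcases abs_cases t with ⟨h1, h2⟩ | ⟨h1, h2⟩
    · exact Or.inr ⟨by linarith, by linarith⟩
    · exact Or.inl ⟨by linarith, by linarith⟩
  have hAB : endA c ≤ endB c := by
    unfold endA endB
    apply Real.sqrt_le_sqrt
    linarith [Real.sqrt_nonneg (1 + 2 * c)]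
  have ht0 := abs_nonneg t
  rw [← sq_abs t]
  rcases h with h | h
  · exact mul_nonpos_of_nonpos_of_nonneg (by nlinarith) (by nlinarith)
  · exact mul_nonpos_of_nonneg_of_nonpos (by nlinarith) (by nlinarith)

/-- Outside the support the radicand is not positive and its real square root is zero, so the
restriction is redundant. -/
theorem limitMeasure_eq (c : ℝ) :
    limitMeasure c = volume.withDensity fun t => ENNReal.ofReal (limitDensity c t) := by
  rw [limitMeasure, ← withDensity_indicator (measurableSet_limitSupport c)]
  congr 1
  funext t
  by_cases ht : t ∈ limitSupport c
  · rw [Set.indicator_of_mem ht]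
  · rw [Set.indicator_of_notMem ht, limitDensity_eq_zero_of_notMem ht, ENNReal.ofReal_zero]

theorem limitMeasure_compl_limitSupport (c : ℝ) : limitMeasure c (limitSupport c)ᶜ = 0 := by
  rw [limitMeasure, withDensity_apply _ (measurableSet_limitSupport c).compl,
    Measure.restrict_restrict (measurableSet_limitSupport c).compl, Set.compl_inter_self,
    Measure.restrict_empty, lintegral_zero_measure]

/-- By `lintegral_div_sqrt_linear` at `s = t ^ 2`, the density is an average over `τ` of densities
whose images under squaring are arcsine laws. -/
theorem ofReal_limitDensity (hc : 0 ≤ c) {t : ℝ} (ht : t ≠ 0) :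
    ENNReal.ofReal (limitDensity c t) = ENNReal.ofReal (1 / Real.pi) *
      ∫⁻ τ in Set.Ioo (0 : ℝ) 1,
        ENNReal.ofReal (|t| / √(2 * τ * t ^ 2 - (t ^ 2 - c) ^ 2)) := by
  have hpi := Real.pi_pos
  have ht' : 0 < |t| := abs_pos.2 ht
  have h1 : ∀ τ : ℝ, ENNReal.ofReal (|t| / √(2 * τ * t ^ 2 - (t ^ 2 - c) ^ 2)) =
      ENNReal.ofReal (1 / |t|) *
        ENNReal.ofReal (t ^ 2 / √(2 * τ * t ^ 2 - (t ^ 2 - c) ^ 2)) := fun τ => by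
    rw [← ENNReal.ofReal_mul (by positivity)]
    congr 1
    rw [← mul_div_assoc]
    congr 1
    rw [← sq_abs t]
    field_simp
  simp only [h1]
  rw [lintegral_const_mul' _ _ ENNReal.ofReal_ne_top,
    lintegral_div_sqrt_linear c (by positivity), ← ENNReal.ofReal_mul (by positivity),
    ← ENNReal.ofReal_mul (by positivity), limitDensity, limitDensity_radicand hc]
  congr 1
  field_simp

/-- The image of the limit measure under squaring is a mixture of arcsine laws. -/
theorem lintegral_sq_limitMeasure (hc : 0 ≤ c) {f : ℝ → ℝ≥0∞} (hf : Measurable f) :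
    ∫⁻ t, f (t ^ 2) ∂(limitMeasure c) = ∫⁻ τ in Set.Ioo (0 : ℝ) 1, ENNReal.ofReal (1 / Real.pi) *
      ∫⁻ θ in Set.Ioo 0 Real.pi, f (τ + c + √(τ * (τ + 2 * c)) * Real.cos θ) := by
  have hmeas : Measurable fun p : ℝ × ℝ =>
      f (p.1 ^ 2) * ENNReal.ofReal (|p.1| / √(2 * p.2 * p.1 ^ 2 - (p.1 ^ 2 - c) ^ 2)) := by
    fun_prop
  rw [limitMeasure_eq, lintegral_withDensity_eq_lintegral_mul _
    (measurable_limitDensity c).ennreal_ofReal (by fun_prop)]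
  have h1 : ∫⁻ t : ℝ, ((fun t => ENNReal.ofReal (limitDensity c t)) * fun t => f (t ^ 2)) t =
      ∫⁻ t : ℝ, ENNReal.ofReal (1 / Real.pi) * ∫⁻ τ in Set.Ioo (0 : ℝ) 1,
        f (t ^ 2) * ENNReal.ofReal (|t| / √(2 * τ * t ^ 2 - (t ^ 2 - c) ^ 2)) := by
    apply lintegral_congr_ae
    filter_upwards [Measure.ae_ne volume (0 : ℝ)] with t ht
    rw [Pi.mul_apply, ofReal_limitDensity hc ht, lintegral_const_mul _ (by fun_prop)]
    ring
  rw [h1, lintegral_const_mul' _ _ ENNReal.ofReal_ne_top,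
    lintegral_lintegral_swap hmeas.aemeasurable,
    ← lintegral_const_mul' _ _ ENNReal.ofReal_ne_top]
  refine setLIntegral_congr_fun measurableSet_Ioo fun τ hτ => ?_
  rw [lintegral_arcsine_sq hc hτ.1]

theorem isProbabilityMeasure_limitMeasure (hc : 0 ≤ c) :
    IsProbabilityMeasure (limitMeasure c) := by
  constructor
  have h := lintegral_sq_limitMeasure hc (f := fun _ => 1) measurable_const
  have hpi := Real.pi_pos
  have h1 : ENNReal.ofReal (1 / Real.pi) * ENNReal.ofReal Real.pi = 1 := by
    rw [← ENNReal.ofReal_mul (by positivity), one_div_mul_cancel hpi.ne', ENNReal.ofReal_one]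
  simpa [← one_div, h1] using h

theorem arcsine_base_nonneg {τ : ℝ} (hc : 0 ≤ c) (hτ : 0 ≤ τ) (θ : ℝ) :
    0 ≤ τ + c + √(τ * (τ + 2 * c)) * Real.cos θ := by
  have hele : √(τ * (τ + 2 * c)) ≤ τ + c :=
    Real.sqrt_le_iff.2 ⟨by positivity, by nlinarith⟩
  have h0 := Real.sqrt_nonneg (τ * (τ + 2 * c))
  have h1 := Real.neg_one_le_cos θ
  nlinarith

theorem integral_even_pow_limitMeasure (hc : 0 ≤ c) (m : ℕ) :
    ∫ t, t ^ (2 * m) ∂(limitMeasure c) = limitMoment c m := by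
  have hpi := Real.pi_pos
  have hinner : ∀ τ ∈ Set.Ioo (0 : ℝ) 1, ENNReal.ofReal (1 / Real.pi) *
      ∫⁻ θ in Set.Ioo 0 Real.pi,
        ENNReal.ofReal ((τ + c + √(τ * (τ + 2 * c)) * Real.cos θ) ^ m) =
      ENNReal.ofReal (arcsineCoeff (τ + c) (√(τ * (τ + 2 * c))) m 0) := by
    intro τ hτ
    have hcont : Continuous fun θ : ℝ => (τ + c + √(τ * (τ + 2 * c)) * Real.cos θ) ^ m := by
      fun_prop
    rw [← ofReal_integral_eq_lintegral_ofReal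
      ((hcont.integrableOn_Icc (a := 0) (b := Real.pi)).mono_set Set.Ioo_subset_Icc_self)
      (Eventually.of_forall fun θ => pow_nonneg (arcsine_base_nonneg hc hτ.1.le θ) m),
      ← ENNReal.ofReal_mul (by positivity), ← integral_Ioc_eq_integral_Ioo,
      ← intervalIntegral.integral_of_le hpi.le]
    simp [arcsineCoeff]
  have hcont : Continuous fun τ : ℝ => arcsineCoeff (τ + c) (√(τ * (τ + 2 * c))) m 0 := by
    unfold arcsineCoeff
    refine continuous_const.mul ?_
    apply intervalIntegral.continuous_parametric_intervalIntegral_of_continuous'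
    fun_prop
  have hnn : ∀ τ ∈ Set.Ioo (0 : ℝ) 1, 0 ≤ arcsineCoeff (τ + c) (√(τ * (τ + 2 * c))) m 0 := by
    intro τ hτ
    refine mul_nonneg (by positivity) (intervalIntegral.integral_nonneg hpi.le fun θ _ => ?_)
    simpa using pow_nonneg (arcsine_base_nonneg hc hτ.1.le θ) m
  rw [integral_eq_lintegral_of_nonneg_ae
    (Eventually.of_forall fun t => by simpa [pow_mul] using pow_nonneg (sq_nonneg t) m)
    (by fun_prop)]
  simp only [pow_mul]
  rw [lintegral_sq_limitMeasure hc (f := fun s => ENNReal.ofReal (s ^ m)) (by fun_prop),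
    setLIntegral_congr_fun measurableSet_Ioo hinner,
    ← ofReal_integral_eq_lintegral_ofReal
      ((hcont.integrableOn_Icc (a := 0) (b := 1)).mono_set Set.Ioo_subset_Icc_self)
      ((ae_restrict_iff' measurableSet_Ioo).2 (Eventually.of_forall hnn)),
    ENNReal.toReal_ofReal (setIntegral_nonneg measurableSet_Ioo hnn),
    ← integral_Ioc_eq_integral_Ioo, ← intervalIntegral.integral_of_le zero_le_one]
  rfl

theorem integral_odd_pow_limitMeasure (c : ℝ) (m : ℕ) :
    ∫ t, t ^ (2 * m + 1) ∂(limitMeasure c) = 0 := by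
  rw [limitMeasure_eq, integral_withDensity_ofReal (measurable_limitDensity c)
    (limitDensity_nonneg c)]
  have h := integral_neg_eq_self (fun t : ℝ => limitDensity c t • t ^ (2 * m + 1)) volume
  have h2 : ∀ t : ℝ, limitDensity c (-t) • (-t) ^ (2 * m + 1) =
      -(limitDensity c t • t ^ (2 * m + 1)) := fun t => by
    rw [Odd.neg_pow ⟨m, rfl⟩, smul_neg]
    simp [limitDensity]
  simp only [h2, integral_neg] at h
  linarith

theorem ae_abs_le_limitMeasure (c : ℝ) : ∀ᵐ t ∂(limitMeasure c), |t| ≤ endB c := by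
  have hA : 0 ≤ endA c := Real.sqrt_nonneg _
  have hB : 0 ≤ endB c := Real.sqrt_nonneg _
  have h : ∀ᵐ t ∂(limitMeasure c), t ∈ limitSupport c := limitMeasure_compl_limitSupport c
  filter_upwards [h] with t ht
  rw [abs_le]
  rcases ht with ht | ht
  · exact ⟨ht.1, by linarith [ht.2]⟩
  · exact ⟨by linarith [ht.1], ht.2⟩

/-- For `c = 0` the inner endpoint is `0`, and the factor `t ^ 2` leaves the root to cancel `|t|`.
The densities differ at `t = 0`, where division by zero gives `0`; this is a null set. -/
theorem limitMeasure_zero : limitMeasure 0 = semicircleLaw := by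
  have hA : endA 0 = 0 := by simp [endA]
  have hB : endB 0 = √2 := by
    unfold endB
    norm_num
  have hS : limitSupport 0 = Set.Icc (-√2) √2 := by
    rw [limitSupport, hA, hB, neg_zero, Set.Icc_union_Icc_eq_Icc (by simp) (by simp)]
  rw [limitMeasure, semicircleLaw, hS]
  apply withDensity_congr_ae
  filter_upwards [ae_restrict_of_ae (Measure.ae_ne volume (0 : ℝ))] with t ht
  have ht' : 0 < |t| := abs_pos.2 ht
  have hpi := Real.pi_pos
  congr 1
  unfold limitDensity
  rw [hA, hB, Real.sq_sqrt (by norm_num), ← sq_abs t,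
    show |t| ^ 2 - 0 ^ 2 = |t| ^ 2 by ring, Real.sqrt_mul (by positivity),
    Real.sqrt_sq ht'.le]
  field_simp

end LimitMeasure

/-! ### Convergence of moments implies weak convergence -/

theorem abs_polynomial_eval_le (p : Polynomial ℝ) {x : ℝ} (hx : 1 ≤ |x|) :
    |p.eval x| ≤ (∑ i ∈ Finset.range (p.natDegree + 1), |p.coeff i|) * x ^ (2 * p.natDegree) := by
  rw [Polynomial.eval_eq_sum_range, Finset.sum_mul, ← (even_two_mul p.natDegree).pow_abs x]
  refine (Finset.abs_sum_le_sum_abs _ _).trans (Finset.sum_le_sum fun i hi => ?_)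
  rw [abs_mul, abs_pow]
  have : i ≤ 2 * p.natDegree := by
    have := Finset.mem_range.1 hi
    lia
  gcongr

theorem integrable_polynomial_eval {ρ : Measure ℝ} (h : ∀ k : ℕ, Integrable (fun x => x ^ k) ρ)
    (p : Polynomial ℝ) : Integrable (fun x => p.eval x) ρ := by
  simp only [Polynomial.eval_eq_sum_range]
  exact integrable_finsetSum _ fun i _ => (h i).const_mul _

theorem integral_polynomial_eval {ρ : Measure ℝ} (h : ∀ k : ℕ, Integrable (fun x => x ^ k) ρ)
    (p : Polynomial ℝ) : ∫ x, p.eval x ∂ρ =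
      ∑ i ∈ Finset.range (p.natDegree + 1), p.coeff i * ∫ x, x ^ i ∂ρ := by
  simp only [Polynomial.eval_eq_sum_range]
  rw [integral_finsetSum _ fun i _ => (h i).const_mul _]
  simp only [integral_const_mul]

theorem integrable_pow_of_ae_abs_le {ν : Measure ℝ} [IsProbabilityMeasure ν] {B : ℝ}
    (hB : ∀ᵐ t ∂ν, |t| ≤ B) (k : ℕ) : Integrable (fun x => x ^ k) ν := by
  refine Integrable.of_bound (by fun_prop) (B ^ k) ?_
  filter_upwards [hB] with t ht
  rw [Real.norm_eq_abs, abs_pow]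
  gcongr

/-- If the moments of probability measures converge to those of a compactly supported
probability measure, then the measures converge weakly. -/
theorem tendsto_integral_of_tendsto_moments {ρ : ℕ → Measure ℝ} {ν : Measure ℝ}
    [∀ n, IsProbabilityMeasure (ρ n)] [IsProbabilityMeasure ν] {B : ℝ} (hB0 : 0 ≤ B)
    (hB : ∀ᵐ t ∂ν, |t| ≤ B) (hfint : ∀ n (k : ℕ), Integrable (fun x => x ^ k) (ρ n))
    (hmom : ∀ k : ℕ, Tendsto (fun n => ∫ x, x ^ k ∂(ρ n)) atTop (𝓝 (∫ x, x ^ k ∂ν)))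
    (φ : ℝ →ᵇ ℝ) : Tendsto (fun n => ∫ x, φ x ∂(ρ n)) atTop (𝓝 (∫ x, φ x ∂ν)) := by
  have hfintν := integrable_pow_of_ae_abs_le hB
  rw [Metric.tendsto_atTop']
  intro ε hε
  -- Replacing `φ` by a polynomial costs less than `2 δ` under each of the two measures, and
  -- comparing the polynomial integrals costs `δ`.
  set δ : ℝ := ε / 5 with hδ
  have hδ0 : 0 < δ := by positivity
  set R : ℝ := B + 1 with hR
  have hR1 : 1 ≤ R := by linarith
  obtain ⟨p, hp⟩ := exists_polynomial_near_of_continuousOn (-R) R φ φ.continuous.continuousOn δ hδ0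
  set D := p.natDegree with hD
  set K : ℝ := ‖φ‖ + ∑ i ∈ Finset.range (p.natDegree + 1), |p.coeff i| with hK
  have hK0 : 0 ≤ K := by positivity
  -- The polynomial approximates `φ` only on `[-R, R]`. Beyond, the error is at most `K x ^ (2 D)`,
  -- which may be multiplied by `(x / R) ^ (2 L) ≥ 1`.
  have hφp : ∀ (L : ℕ) (x : ℝ), |φ x - p.eval x| ≤ δ + K * x ^ (2 * (D + L)) / R ^ (2 * L) := by
    intro L x
    have hnn : 0 ≤ x ^ (2 * (D + L)) := by rw [pow_mul]; positivity
    rcases le_or_gt |x| R with hx | hx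
    · have h1 := hp x (abs_le.1 hx)
      have h2 : 0 ≤ K * x ^ (2 * (D + L)) / R ^ (2 * L) := by positivity
      rw [abs_sub_comm]
      linarith
    · have hx1 : 1 ≤ |x| := hR1.trans hx.le
      have h1 : |φ x - p.eval x| ≤ K * x ^ (2 * D) := by
        have h2 := abs_polynomial_eval_le p hx1
        have h3 : |φ x| ≤ ‖φ‖ * x ^ (2 * D) := by
          rw [← (even_two_mul D).pow_abs x]
          exact (φ.norm_coe_le_norm x).trans
            (le_mul_of_one_le_right (norm_nonneg _) (one_le_pow₀ hx1))
        have h4 := abs_sub (φ x) (p.eval x)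
        rw [hK, add_mul]
        linarith
      have h5 : x ^ (2 * D) ≤ x ^ (2 * (D + L)) / R ^ (2 * L) := by
        rw [le_div_iff₀ (by positivity), mul_add, pow_add]
        refine mul_le_mul_of_nonneg_left ?_ (by rw [pow_mul]; positivity)
        rw [← (even_two_mul L).pow_abs x]
        gcongr
      have h6 := mul_le_mul_of_nonneg_left h5 hK0
      rw [mul_div_assoc]
      linarith
  -- Since `R > B`, the tail term under the limit measure decays geometrically in `L`. Once `L` is
  -- fixed, convergence of a single moment makes the tail under `ρ n` small too.
  have hlimL : Tendsto (fun L : ℕ => K * B ^ (2 * D) * ((B / R) ^ 2) ^ L) atTop (𝓝 0) := by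
    have : Tendsto (fun L : ℕ => ((B / R) ^ 2) ^ L) atTop (𝓝 0) := by
      apply tendsto_pow_atTop_nhds_zero_of_lt_one (by positivity)
      apply pow_lt_one₀ (by positivity) _ two_ne_zero
      rw [div_lt_one (by linarith)]
      linarith
    simpa using this.const_mul (K * B ^ (2 * D))
  obtain ⟨L, hL⟩ := ((tendsto_order.1 hlimL).2 δ hδ0).exists
  have hMν : ∫ x, x ^ (2 * (D + L)) ∂ν ≤ B ^ (2 * (D + L)) := by
    have := integral_mono_ae (hfintν (2 * (D + L))) (integrable_const (B ^ (2 * (D + L))))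
      (by
        filter_upwards [hB] with t ht
        rw [← (even_two_mul (D + L)).pow_abs t]
        gcongr)
    simpa using this
  have hbound : ∀ (κ : Measure ℝ) [IsProbabilityMeasure κ],
      (∀ k : ℕ, Integrable (fun x => x ^ k) κ) →
      |∫ x, φ x ∂κ - ∫ x, p.eval x ∂κ| ≤
        δ + K * (∫ x, x ^ (2 * (D + L)) ∂κ) / R ^ (2 * L) := by
    intro κ _ hκ
    have h1 : Integrable (fun x => φ x) κ := φ.integrable κ
    have h2 := integrable_polynomial_eval hκ p
    rw [← integral_sub h1 h2]
    refine (abs_integral_le_integral_abs).trans ?_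
    refine (integral_mono (h1.sub h2).abs
      ((integrable_const δ).add (((hκ (2 * (D + L))).const_mul K).div_const _))
      (hφp L)).trans ?_
    rw [integral_add' (integrable_const δ) (((hκ (2 * (D + L))).const_mul K).div_const _),
      integral_const, integral_div (R ^ (2 * L)), integral_const_mul]
    simp
  have hsmall : K * (∫ x, x ^ (2 * (D + L)) ∂ν) / R ^ (2 * L) < δ := by
    refine lt_of_le_of_lt ?_ hL
    rw [div_le_iff₀ (by positivity)]
    refine (mul_le_mul_of_nonneg_left hMν hK0).trans (le_of_eq ?_)
    rw [← pow_mul, div_pow, mul_add, pow_add]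
    field_simp
  have hev1 : ∀ᶠ n in atTop, K * (∫ x, x ^ (2 * (D + L)) ∂(ρ n)) / R ^ (2 * L) < δ :=
    (tendsto_order.1 (((hmom (2 * (D + L))).const_mul K).div_const _)).2 δ hsmall
  have hpoly : Tendsto (fun n => ∫ x, p.eval x ∂(ρ n)) atTop (𝓝 (∫ x, p.eval x ∂ν)) := by
    simp only [integral_polynomial_eval (hfint _), integral_polynomial_eval hfintν]
    exact tendsto_finsetSum _ fun i _ => (hmom i).const_mul _
  have hev2 : ∀ᶠ n in atTop, |∫ x, p.eval x ∂(ρ n) - ∫ x, p.eval x ∂ν| < δ :=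
    (Metric.tendsto_nhds.1 hpoly) δ hδ0
  have hfin : ∀ᶠ n in atTop, dist (∫ x, φ x ∂(ρ n)) (∫ x, φ x ∂ν) < ε := by
    filter_upwards [hev1, hev2] with n h1 h2
    have h3 := hbound (ρ n) (hfint n)
    have h4 := hbound ν hfintν
    rw [Real.dist_eq]
    rw [abs_lt] at h2 ⊢
    rw [abs_le] at h3 h4
    constructor <;> linarith [h2.1, h2.2, h3.1, h3.2, h4.1, h4.2]
  obtain ⟨N, hN⟩ := eventually_atTop.1 hfin
  exact ⟨N, fun n hn => hN n hn.le⟩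

/-! ### Moments of the mean eigenvalue distribution -/

section MeanMoments

variable {μ : ℝ} (hμ : 0 ≤ μ)

theorem integrable_pow_orthMeasure (k j : ℕ) :
    Integrable (fun x => x ^ j) (orthMeasure hμ k) := by
  rw [orthMeasure, integrable_withDensity_ofReal (measurable_orth_density hμ k)
    (orth_density_nonneg hμ k)]
  refine (integrable_eval_mul_hermWeight hμ
    (Polynomial.X ^ j * (hermOrth hμ k * hermOrth hμ k))).congr (Eventually.of_forall fun x => ?_)
  simp only [Polynomial.eval_mul, Polynomial.eval_pow, Polynomial.eval_X, smul_eq_mul]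
  ring

theorem integral_even_pow_orthMeasure (k m : ℕ) :
    ∫ x, x ^ (2 * m) ∂(orthMeasure hμ k) = momentEntry hμ m k k := by
  rw [orthMeasure, integral_withDensity_ofReal (measurable_orth_density hμ k)
    (orth_density_nonneg hμ k), momentEntry, hermInt_apply]
  congr 1
  funext x
  simp only [Polynomial.eval_mul, Polynomial.eval_pow, Polynomial.eval_X, smul_eq_mul]
  ring

theorem hermOrth_eval_neg_sq (k : ℕ) (x : ℝ) :
    (hermOrth hμ k * hermOrth hμ k).eval (-x) = (hermOrth hμ k * hermOrth hμ k).eval x := by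
  have h1 : (hermPoly μ k).eval (-x) = (-1) ^ k * (hermPoly μ k).eval x := by
    have := congrArg (Polynomial.eval x) (hermPoly_comp_neg (μ := μ) k)
    simpa [Polynomial.eval_comp] using this
  have h2 : ((-1 : ℝ) ^ k) * (-1) ^ k = 1 := by rw [← mul_pow]; simp
  simp only [hermOrth, Polynomial.eval_mul, Polynomial.eval_smul, smul_eq_mul, h1]
  linear_combination ((√(hermNormSq hμ k))⁻¹ * (hermPoly μ k).eval x) ^ 2 * h2

theorem integral_odd_pow_orthMeasure (k m : ℕ) :
    ∫ x, x ^ (2 * m + 1) ∂(orthMeasure hμ k) = 0 := by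
  rw [orthMeasure, integral_withDensity_ofReal (measurable_orth_density hμ k)
    (orth_density_nonneg hμ k)]
  have h := integral_neg_eq_self (fun x : ℝ =>
    ((hermOrth hμ k * hermOrth hμ k).eval x * hermWeight μ x) • x ^ (2 * m + 1)) volume
  have h2 : ∀ x : ℝ, ((hermOrth hμ k * hermOrth hμ k).eval (-x) * hermWeight μ (-x)) •
      (-x) ^ (2 * m + 1) =
      -(((hermOrth hμ k * hermOrth hμ k).eval x * hermWeight μ x) • x ^ (2 * m + 1)) := fun x => by
    rw [Odd.neg_pow ⟨m, rfl⟩, smul_neg, hermOrth_eval_neg_sq, hermWeight_neg]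
  simp only [h2, integral_neg] at h
  linarith

theorem integrable_pow_meanEigenvalueDist {μ : ℝ} (hμ : 0 ≤ μ) {n : ℕ} (hn : 1 ≤ n) (j : ℕ) :
    Integrable (fun x => x ^ j) (meanEigenvalueDist n μ) := by
  rw [meanEigenvalueDist_eq hμ]
  refine Integrable.smul_measure ?_ (ENNReal.inv_ne_top.2 (by simpa using by lia))
  exact integrable_finsetSum_measure.2 fun k _ => integrable_pow_orthMeasure hμ k j

theorem integral_pow_meanEigenvalueDist (n j : ℕ) :
    ∫ x, x ^ j ∂(meanEigenvalueDist n μ) =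
      1 / (n : ℝ) * ∑ k ∈ Finset.range n, ∫ x, x ^ j ∂(orthMeasure hμ k) := by
  rw [meanEigenvalueDist_eq hμ, integral_smul_measure,
    integral_finsetSum_measure fun (k : Fin n) _ => integrable_pow_orthMeasure hμ k j,
    Finset.sum_range (fun k => ∫ x, x ^ j ∂(orthMeasure hμ k))]
  simp

end MeanMoments

/-- The moments of the rescaled mean eigenvalue distributions converge to those of the limit
measure. -/
theorem tendsto_moments {μ : ℕ → ℝ} (hμ : ∀ n, 0 ≤ μ n) {c : ℝ} (hc : 0 ≤ c)
    (hlim : Tendsto (fun n : ℕ => μ n / (n : ℝ)) atTop (𝓝 c)) (j : ℕ) :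
    Tendsto (fun n : ℕ => ∫ u, (u / √(n : ℝ)) ^ j ∂(meanEigenvalueDist n (μ n))) atTop
      (𝓝 (∫ u, u ^ j ∂(limitMeasure c))) := by
  simp only [div_pow, integral_div, integral_pow_meanEigenvalueDist (hμ _)]
  obtain ⟨m, rfl | rfl⟩ := Nat.even_or_odd' j
  · rw [integral_even_pow_limitMeasure hc]
    refine (tendsto_average_momentEntry hμ hlim m).congr fun n => ?_
    simp only [integral_even_pow_orthMeasure]
    rw [pow_mul, Real.sq_sqrt (Nat.cast_nonneg n), ← Finset.sum_div, mul_div_assoc]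
  · rw [integral_odd_pow_limitMeasure]
    simp only [integral_odd_pow_orthMeasure]
    simp

theorem tendsto_integral_meanEigenvalueDist {μ : ℕ → ℝ} (hμ : ∀ n, 0 ≤ μ n) {c : ℝ} (hc : 0 ≤ c)
    (hlim : Tendsto (fun n : ℕ => μ n / (n : ℝ)) atTop (𝓝 c)) (φ : ℝ →ᵇ ℝ) :
    Tendsto (fun n : ℕ => ∫ u, φ (u / √(n : ℝ)) ∂(meanEigenvalueDist n (μ n)))
      atTop (𝓝 (∫ u, φ u ∂(limitMeasure c))) := by
  -- Shifting the index discards `n = 0`, where the mean eigenvalue distribution is the zero measure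
  -- and not a probability measure.
  rw [← tendsto_add_atTop_iff_nat 1]
  have hprob (n : ℕ) : IsProbabilityMeasure (meanEigenvalueDist (n + 1) (μ (n + 1))) :=
    isProbabilityMeasure_meanEigenvalueDist (hμ _) (Nat.le_add_left 1 n)
  have hmeas (n : ℕ) : Measurable fun u : ℝ => u / √((n + 1 : ℕ) : ℝ) := by fun_prop
  let ρ (n : ℕ) : Measure ℝ :=
    (meanEigenvalueDist (n + 1) (μ (n + 1))).map fun u => u / √((n + 1 : ℕ) : ℝ)
  have hρ (n : ℕ) : IsProbabilityMeasure (ρ n) :=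
    Measure.isProbabilityMeasure_map (hmeas n).aemeasurable
  have hν := isProbabilityMeasure_limitMeasure hc
  have hmap (n : ℕ) {f : ℝ → ℝ} (hf : Continuous f) : ∫ x, f x ∂(ρ n) =
      ∫ u, f (u / √((n + 1 : ℕ) : ℝ)) ∂(meanEigenvalueDist (n + 1) (μ (n + 1))) :=
    integral_map (hmeas n).aemeasurable hf.aestronglyMeasurable
  have h := tendsto_integral_of_tendsto_moments (ρ := ρ) (Real.sqrt_nonneg _)
    (ae_abs_le_limitMeasure c) (fun n k => ?_) (fun k => ?_) φ
  · simpa only [hmap _ φ.continuous] using h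
  · rw [integrable_map_measure (by fun_prop) (hmeas n).aemeasurable]
    simpa only [Function.comp_def, div_pow] using
      (integrable_pow_meanEigenvalueDist (hμ _) (Nat.le_add_left 1 n) k).div_const _
  · simp only [hmap _ (continuous_pow k)]
    exact (tendsto_add_atTop_iff_nat 1).2 (tendsto_moments hμ hc hlim k)

end GenHermitian

end

theorem theorem2p1 (μ : ℕ → ℝ) (hμ : ∀ n, 0 ≤ μ n) (c : ℝ) (hc : 0 ≤ c)
    (hlim : Tendsto (fun n : ℕ => μ n / (n : ℝ)) atTop (𝓝 c)) :
    (∀ n, IsProbabilityMeasure (GenHermitian.ensemble n (μ n))) ∧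
    (∀ n, 1 ≤ n → IsProbabilityMeasure (GenHermitian.meanEigenvalueDist n (μ n))) ∧
    IsProbabilityMeasure (GenHermitian.limitMeasure c) ∧
    GenHermitian.limitMeasure c (GenHermitian.limitSupport c)ᶜ = 0 ∧
    (∀ φ : ℝ →ᵇ ℝ,
      Tendsto (fun n : ℕ => ∫ u, φ (u / √(n : ℝ)) ∂(GenHermitian.meanEigenvalueDist n (μ n)))
        atTop (𝓝 (∫ u, φ u ∂(GenHermitian.limitMeasure c)))) ∧
    (c = 0 → GenHermitian.limitMeasure c = GenHermitian.semicircleLaw) :=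
  ⟨fun n => GenHermitian.isProbabilityMeasure_ensemble n (hμ n),
    fun n hn => GenHermitian.isProbabilityMeasure_meanEigenvalueDist (hμ n) hn,
    GenHermitian.isProbabilityMeasure_limitMeasure hc,
    GenHermitian.limitMeasure_compl_limitSupport c,
    GenHermitian.tendsto_integral_meanEigenvalueDist hμ hc hlim,
    fun h => by rw [h, GenHermitian.limitMeasure_zero]⟩
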